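/- **Conventions.** Let $n\ge 2$ and $p_1\ge p_2\ge\dots\ge p_n\ge 0$ be real weights, padded by $p_t=0$ for $t>n$, and let $W_m=\sum_{t>m}p_t$. The *$g$-lengths problem* for an alphabet of size $r\ge 2$ and $g\ge 1$ asks for a prefix-free code $w_1,\dots,w_n$ over the alphabet with at most $g$ distinct codeword lengths that minimizes $\sum_t p_t|w_t|$. Suppose that for each level $i\ge 1$ there are $\Delta_i$ possible pairs $(r_{i,j},c_{i,j})$, $1\le j\le\Delta_i$, with integers $r_{i,j}\ge 1$ and reals $c_{i,j}\ge 0$. A *permissible tree* is a finite rooted tree for which there are choices $j_1,j_2,\dots$ such that every node on level $i-1$ has at most $r_{i,j_i}$ children, joined to it by edges of length $c_{i,j_i}$; it is *full* if every node on level $i-1$ that has children has exactly $r_{i,j_i}$ of them. Its nodes on level $i$ have depth $L(i)=\sum_{k\le i}c_{k,j_k}$. An *$i$-level tree* has no node below level $i$, and some nodes on level $i$ may be tagged as internal. The $k$-level signature ($k\le i$) is $(m,b)$, where $m$ is the number of leaves on levels $\le k$ and $b$ the number of internal nodes on level $k$. With the leaves $v_1,v_2,\dots$ listed from top to bottom,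 the partial cost of an $i$-level tree with $i$-level signature $(m,b)$ is $\sum_{t=1}^m p_t\,\mathrm{depth}(v_t)+L(i)\,W_m$. A pair $(m,b)$ is a *valid $i$-level signature* if either $b>0$ and $m+b\le n$, or $b=0$ and $\max(n,r_{i,j})\le m\le n+r_{i,j}-1$ for some $1\le j\le\Delta_i$. Let $OPT^i[m,b]$ be the minimum partial cost of a full permissible $i$-level tree with $i$-level signature $(m,b)$ whose $k$-level signatures are valid for all $0\le k\le i$ ($\infty$ if there is none). Write $(m',b')\xrightarrow{i,j}(m,b)$ if $(m',b')$ and $(m,b)$ are valid signatures for levels $i-1$ and $i$, $0\le b\le b'r_{i,j}$ and $m=m'+b'r_{i,j}-b$, and set $$OPT^{i,j}[m,b]=\min_{(m',b')\xrightarrow{i,j}(m,b)}\bigl\{OPT^{i-1}[m',b']+c_{i,j}W_{m'}\bigr\}.$$ **Theorem.** 1. *(Dynamic program.)* The minima that define finite $OPT^i[m,b]$ are attained, and when $b>0$ and $m+b\le n$, the set of partial costs of full permissible $i$-level trees with $i$-level signature $(m,b)$ does not change if the validity of the $k$-level signatures, $k\le i$, is not required. One has $OPT^0[0,1]=0$ and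 $OPT^0[m,b]=\infty$ otherwise, and for all $i\ge1$ and all valid $i$-level signatures $(m,b)$, $$OPT^i[m,b]=\min_{1\le j\le\Delta_i}OPT^{i,j}[m,b].$$ Moreover $OPT^{i,j}$ satisfies the following batched recurrence. Let $1\le j\le \Delta_i$, $d\le n$, $1\le b\le d$, $\rho=r_{i,j}$ and $\gamma(b')=OPT^{i-1}[d-b'\rho,b']+c_{i,j}W_{d-b'\rho}$. Then $OPT^{i,j}[d-b,b]$ equals $\infty$ if $b>\rho\lfloor d/\rho\rfloor$; $\gamma(\lfloor d/\rho\rfloor)$ if $b=\rho\lfloor d/\rho\rfloor$; and, if $b<\rho\lfloor d/\rho\rfloor$, it equals $OPT^{i,j}[d-b-1,b+1]$ when $\rho\nmid b$ and $\min\{OPT^{i,j}[d-b-1,b+1],\gamma(b/\rho)\}$ when $\rho\mid b$. 2. *(Reduction.)* Let the choices on every level be the pairs $(r^t,t)$, $0\le t\le 1+\lfloor\log_r n\rfloor$ (that is, $\Delta_i=2+\lfloor\log_r n\rfloor$, $r_{i,j}=r^{j-1}$, $c_{i,j}=j-1$). For every permissible tree with exactly $n$ leaves (none tagged, labelled by the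 weights in any order) and no node below level $g$, there is a feasible code for the $g$-lengths problem of the same cost; for every feasible code there is such a tree of at most its cost. Both minima exist and are equal, and they are equal to $\min_m OPT^g[m,0]$ over the valid $g$-level signatures $(m,0)$. 3. *(Running time.)* There is one algorithm (on a random access machine whose unit-cost operations are addition, subtraction, comparison and array access for natural numbers and for real weights) that, given $r\ge2$, $n\ge2$, $g\ge1$ and $p_1\ge\dots\ge p_n\ge0$, computes all entries $OPT^i[m,b]$, $0\le i\le g$, $(m,b)$ valid, for the choices in part 2, together with the cost and the codeword lengths of an optimal solution of the $g$-lengths problem, in $O(gn^2\log n)$ steps, with an absolute implied constant. -/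

import Mathlib

noncomputable section

namespace ReservedLength

/-! ### Prefix-free codes with few codeword lengths -/

/-- No codeword is a prefix of another one (in particular codewords are distinct). -/
def PrefixFree {r n : ℕ} (w : Fin n → List (Fin r)) : Prop :=
  ∀ i j, i ≠ j → ¬ (w i) <+: (w j)

/-- At most `g` distinct codeword lengths are used. -/
def AtMostLengths {r n : ℕ} (g : ℕ) (w : Fin n → List (Fin r)) : Prop :=
  (Finset.univ.image fun i => (w i).length).card ≤ g

/-- Expected encoding length. -/
def codeCost {r n : ℕ} (p : Fin n → ℝ) (w : Fin n → List (Fin r)) : ℝ :=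
  ∑ i, p i * ((w i).length : ℝ)

/-- The costs of all feasible solutions of the `g`-lengths problem. -/
def codeCosts (r g : ℕ) {n : ℕ} (p : Fin n → ℝ) : Set ℝ :=
  {x | ∃ w : Fin n → List (Fin r), PrefixFree w ∧ AtMostLengths g w ∧ x = codeCost p w}

/-! ### Weights -/

/-- The weight sequence, indexed from `0` and padded by zeros. -/
def pad {n : ℕ} (p : Fin n → ℝ) (t : ℕ) : ℝ := if h : t < n then p ⟨t, h⟩ else 0

/-- `W_m`: the total weight of all items but the first `m`. -/
def tailWeight {n : ℕ} (p : Fin n → ℝ) (m : ℕ) : ℝ :=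
  ∑ i : Fin n, if m ≤ (i : ℕ) then p i else 0

/-! ### Trees

A node is the word of child numbers on the path from the root, so the root is `[]`, the children
of `w` are the words `w ++ [a]`, and the level of a node is the length of the word.  `marked` is
the set of bottom nodes that are tagged as internal (they get children when the tree grows). -/

structure GTree where
  nodes : Finset (List ℕ)
  root_mem : [] ∈ nodes
  closed : ∀ w a, w ++ [a] ∈ nodes → w ∈ nodes
  marked : Finset (List ℕ)
  marked_sub : marked ⊆ nodes

namespace GTree

/-- An internal node: it has a child, or is tagged as internal. -/
def IsInternal (T : GTree) (w : List ℕ) : Prop :=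
  w ∈ T.nodes ∧ (w ∈ T.marked ∨ ∃ a, w ++ [a] ∈ T.nodes)

open Classical in
/-- The nodes that are not internal. -/
def leaves (T : GTree) : Finset (List ℕ) := T.nodes.filter fun w => ¬ T.IsInternal w

/-- All nodes have level at most `i`, and only nodes on level `i` are tagged. -/
def IsLevelTree (T : GTree) (i : ℕ) : Prop :=
  (∀ w ∈ T.nodes, w.length ≤ i) ∧ ∀ w ∈ T.marked, w.length = i

/-- A node on level `i - 1` has at most `R i` children, numbered by numbers below `R i`. -/
def Satisfies (T : GTree) (R : ℕ → ℕ) : Prop :=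
  ∀ w a, w ++ [a] ∈ T.nodes → a < R (w.length + 1)

/-- A node on level `i - 1` that has children has all `R i` of them. -/
def IsFull (T : GTree) (R : ℕ → ℕ) : Prop :=
  ∀ w a, w ++ [a] ∈ T.nodes → ∀ a' < R (w.length + 1), w ++ [a'] ∈ T.nodes

open Classical in
/-- The `k`-level signature: the number of leaves on levels up to `k`, and the number of internal
nodes on level `k`.  For `k` below the height, it is the signature of the truncation of the tree
to its first `k` levels. -/
def sig (T : GTree) (k : ℕ) : ℕ × ℕ :=
  ((T.leaves.filter fun w => w.length ≤ k).card,
   (T.nodes.filter fun w => T.IsInternal w ∧ w.length = k).card)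

/-- `v` lists the leaves, each of them once. -/
def IsLabelling (T : GTree) {m : ℕ} (v : Fin m → List ℕ) : Prop :=
  Function.Injective v ∧ ∀ w, w ∈ T.leaves ↔ ∃ t, v t = w

/-- `v` lists the leaves from top to bottom. -/
def IsTopDown (T : GTree) {m : ℕ} (v : Fin m → List ℕ) : Prop :=
  T.IsLabelling v ∧ ∀ s t, s ≤ t → (v s).length ≤ (v t).length

end GTree

/-- The depth `L(i)` of level `i` when the edges into level `k` have length `C k`. -/
def levelDepth (C : ℕ → ℝ) (i : ℕ) : ℝ := ∑ k ∈ Finset.Icc 1 i, C k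

/-- The `i`-level partial cost of a tree with leaves `v`. -/
def partialCost (C : ℕ → ℝ) {n : ℕ} (p : Fin n → ℝ) (i : ℕ) {m : ℕ} (v : Fin m → List ℕ) : ℝ :=
  ∑ t : Fin m, levelDepth C (v t).length * pad p t + levelDepth C i * tailWeight p m

/-! ### Generalized mixed-radix trees with choices -/

/-- For every level `i ≥ 1`, `Δ i` possible pairs `(arity i j, len i j)`, `1 ≤ j ≤ Δ i`, of an
arity of the nodes on level `i - 1` and a length of the edges that leave them. -/
structure LevelChoices where
  Δ : ℕ → ℕ
  arity : ℕ → ℕ → ℕ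
  len : ℕ → ℕ → ℝ

namespace LevelChoices

variable (S : LevelChoices)

/-- All arities are positive and all edge lengths are nonnegative. -/
def Proper : Prop :=
  ∀ i j, 1 ≤ j → j ≤ S.Δ i → 1 ≤ S.arity i j ∧ 0 ≤ S.len i j

/-- `J` selects one of the possible pairs for each of the levels `1, …, i`. -/
def Permissible (i : ℕ) (J : ℕ → ℕ) : Prop :=
  ∀ k, 1 ≤ k → k ≤ i → 1 ≤ J k ∧ J k ≤ S.Δ k

def R (J : ℕ → ℕ) (k : ℕ) : ℕ := S.arity k (J k)

def C (J : ℕ → ℕ) (k : ℕ) : ℝ := S.len k (J k)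

/-- Valid `i`-level signatures `(m, b)` for `n` words. -/
def Valid (n i : ℕ) (s : ℕ × ℕ) : Prop :=
  (0 < s.2 ∧ s.1 + s.2 ≤ n) ∨
  (s.2 = 0 ∧ ∃ j, 1 ≤ j ∧ j ≤ S.Δ i ∧
    max n (S.arity i j) ≤ s.1 ∧ s.1 ≤ n + S.arity i j - 1)

/-- The relation `(m', b') → (m, b)` of an expansion to level `i` with the `j`-th choice. -/
def Step (n i j : ℕ) (s' s : ℕ × ℕ) : Prop :=
  S.Valid n (i - 1) s' ∧ S.Valid n i s ∧
    s.2 ≤ s'.2 * S.arity i j ∧ s.1 + s.2 = s'.1 + s'.2 * S.arity i j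

/-- The `i`-level partial costs of all full permissible `i`-level trees with signature `(m, b)`. -/
def allPartialCosts {n : ℕ} (p : Fin n → ℝ) (i m b : ℕ) : Set ℝ :=
  {x | ∃ J, S.Permissible i J ∧ ∃ T : GTree,
    T.IsLevelTree i ∧ T.Satisfies (S.R J) ∧ T.IsFull (S.R J) ∧ T.sig i = (m, b) ∧
    ∃ v : Fin m → List ℕ, T.IsTopDown v ∧ x = partialCost (S.C J) p i v}

/-- The same for the trees all of whose truncations, to levels `0, …, i`, have valid
signatures. -/
def partialCosts {n : ℕ} (p : Fin n → ℝ) (i m b : ℕ) : Set ℝ :=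
  {x | ∃ J, S.Permissible i J ∧ ∃ T : GTree,
    T.IsLevelTree i ∧ T.Satisfies (S.R J) ∧ T.IsFull (S.R J) ∧ T.sig i = (m, b) ∧
    (∀ k ≤ i, S.Valid n k (T.sig k)) ∧
    ∃ v : Fin m → List ℕ, T.IsTopDown v ∧ x = partialCost (S.C J) p i v}

/-- `OPT^i[m, b]`, which is `∞` if there is no tree. -/
def OPT {n : ℕ} (p : Fin n → ℝ) (i m b : ℕ) : EReal :=
  sInf ((fun x : ℝ => (x : EReal)) '' S.partialCosts p i m b)

/-- `OPT^{i,j}[m, b]`, for `i ≥ 1`. -/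
def OPTj {n : ℕ} (p : Fin n → ℝ) (i j m b : ℕ) : EReal :=
  ⨅ (s' : ℕ × ℕ) (_ : S.Step n i j s' (m, b)),
    S.OPT p (i - 1) s'.1 s'.2 + ((S.len i j * tailWeight p s'.1 : ℝ) : EReal)

/-- `γ(b')` in the batch of all signatures `(m, b)` with `m + b = d`. -/
def gam {n : ℕ} (p : Fin n → ℝ) (i j d b' : ℕ) : EReal :=
  S.OPT p (i - 1) (d - b' * S.arity i j) b' +
    ((S.len i j * tailWeight p (d - b' * S.arity i j) : ℝ) : EReal)

/-- The costs of all permissible trees with exactly `n` leaves, labelled in any order, and with no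
node below level `g`. -/
def treeCosts {n : ℕ} (g : ℕ) (p : Fin n → ℝ) : Set ℝ :=
  {x | ∃ J, S.Permissible g J ∧ ∃ T : GTree,
    T.IsLevelTree g ∧ T.marked = ∅ ∧ T.Satisfies (S.R J) ∧
    ∃ v : Fin n → List ℕ, T.IsLabelling v ∧
      x = ∑ t, levelDepth (S.C J) (v t).length * p t}

end LevelChoices

/-- The choices of the `g`-lengths problem: on every level, any pair `(r ^ t, t)` with
`0 ≤ t ≤ 1 + ⌊log_r n⌋`, where `t = j - 1`. -/
def reservedChoices (r n : ℕ) : LevelChoices where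
  Δ _ := 2 + Nat.log r n
  arity _ j := r ^ (j - 1)
  len _ j := ((j - 1 : ℕ) : ℝ)

/-! ### A random access machine

Programs work on variables and arrays of natural numbers and on variables and arrays of real
numbers.  The only arithmetic is addition and subtraction, and the only operations on reals are
these and comparison.  Each elementary instruction and each evaluation of a test takes one step. -/

structure Store where
  nvar : ℕ → ℕ
  rvar : ℕ → ℝ
  narr : ℕ → ℕ → ℕ
  rarr : ℕ → ℕ → ℝ

/-- Elementary instructions.  Arguments are names of variables and arrays, except for the second
argument of `nconst`, which is a literal. -/
inductive Instr where
  | nconst (x k : ℕ)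
  | nmove (x y : ℕ)
  | nadd (x y z : ℕ)
  | nsub (x y z : ℕ)
  | nload (x a y : ℕ)
  | nstore (a x y : ℕ)
  | rzero (u : ℕ)
  | rmove (u v : ℕ)
  | radd (u v w : ℕ)
  | rsub (u v w : ℕ)
  | rload (u a x : ℕ)
  | rstore (a x u : ℕ)

def Instr.run : Instr → Store → Store
  | .nconst x k, s => { s with nvar := Function.update s.nvar x k }
  | .nmove x y, s => { s with nvar := Function.update s.nvar x (s.nvar y) }
  | .nadd x y z, s => { s with nvar := Function.update s.nvar x (s.nvar y + s.nvar z) }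
  | .nsub x y z, s => { s with nvar := Function.update s.nvar x (s.nvar y - s.nvar z) }
  | .nload x a y, s => { s with nvar := Function.update s.nvar x (s.narr a (s.nvar y)) }
  | .nstore a x y, s =>
      { s with narr := Function.update s.narr a
                 (Function.update (s.narr a) (s.nvar x) (s.nvar y)) }
  | .rzero u, s => { s with rvar := Function.update s.rvar u 0 }
  | .rmove u v, s => { s with rvar := Function.update s.rvar u (s.rvar v) }
  | .radd u v w, s => { s with rvar := Function.update s.rvar u (s.rvar v + s.rvar w) }
  | .rsub u v w, s => { s with rvar := Function.update s.rvar u (s.rvar v - s.rvar w) }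
  | .rload u a x, s => { s with rvar := Function.update s.rvar u (s.rarr a (s.nvar x)) }
  | .rstore a x u, s =>
      { s with rarr := Function.update s.rarr a
                 (Function.update (s.rarr a) (s.nvar x) (s.rvar u)) }

inductive Test where
  | nlt (x y : ℕ)
  | neq (x y : ℕ)
  | rle (u v : ℕ)

/-- `neq x y` tests for equality of two natural numbers. -/
def Test.holds : Test → Store → Prop
  | .nlt x y, s => s.nvar x < s.nvar y
  | .neq x y, s => s.nvar x = s.nvar y
  | .rle u v, s => s.rvar u ≤ s.rvar v

inductive Prog where
  | skip
  | instr (a : Instr)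
  | seq (P Q : Prog)
  | cond (b : Test) (P Q : Prog)
  | loop (b : Test) (P : Prog)

/-- `Exec P s s' t`: started in `s`, the program `P` halts in `s'` after exactly `t` steps.
(`loop b P` runs `P` as long as `b` holds.) -/
inductive Exec : Prog → Store → Store → ℕ → Prop
  | skip (s) : Exec .skip s s 0
  | instr (a s) : Exec (.instr a) s (a.run s) 1
  | seq {P Q s s₁ s₂ t₁ t₂} :
      Exec P s s₁ t₁ → Exec Q s₁ s₂ t₂ → Exec (.seq P Q) s s₂ (t₁ + t₂)
  | cond_true {b P Q s s' t} :
      b.holds s → Exec P s s' t → Exec (.cond b P Q) s s' (t + 1)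
  | cond_false {b P Q s s' t} :
      ¬ b.holds s → Exec Q s s' t → Exec (.cond b P Q) s s' (t + 1)
  | loop_true {b P s s₁ s₂ t₁ t₂} :
      b.holds s → Exec P s s₁ t₁ → Exec (.loop b P) s₁ s₂ t₂ →
        Exec (.loop b P) s s₂ (t₁ + t₂ + 1)
  | loop_false {b P s} : ¬ b.holds s → Exec (.loop b P) s s 1

/-- The input: `n`, `r`, `g` in the natural variables `0`, `1`, `2`, the weights in the cells
`0, …, n - 1` of real array `0`, and zeros everywhere else. -/
def input (r g : ℕ) {n : ℕ} (p : Fin n → ℝ) : Store where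
  nvar x := if x = 0 then n else if x = 1 then r else if x = 2 then g else 0
  rvar _ := 0
  narr _ _ := 0
  rarr a x := if a = 0 then pad p x else 0

/-- The address of the table entry `[i, m, b]`, in row-major order with `m < n * (r + 1)` and
`b < n + 1`. -/
def address (r n i m b : ℕ) : ℕ := (i * (n * (r + 1)) + m) * (n + 1) + b

/-- The table entry `[i, m, b]`: natural array `1` tells whether it is finite (a nonzero number)
or `∞` (zero), and real array `1` holds the finite values. -/
def tableEntry (r n : ℕ) (s : Store) (i m b : ℕ) : EReal :=
  if s.narr 1 (address r n i m b) = 0 then ⊤ else (s.rarr 1 (address r n i m b) : EReal)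

end ReservedLength

end

noncomputable section

namespace ReservedLength

/-! ### Depth vectors -/

/-! The cost of a tree depends only on its signatures. The edge into level `k + 1` is paid for by
every item that is not yet a leaf on levels up to `k`, so if `m k` counts those leaves, the partial
cost is the sum over `k` of `C (k + 1)` times the tail weight from `m k` on (`partialCost_eq`). A
sequence of signatures belongs to a full tree exactly when each step satisfies `b ≤ b' * ρ` and `m +
b = m' + b' * ρ` (`GTree.sig_succ`, `exists_tree`). So `OPT` is a shortest-path problem on
signatures (`LevelChoices.Path`), and the recurrence splits off the last step. On the diagonal `m +
b = d` a predecessor is determined by `b'`, which ranges over `b ≤ b' * ρ ≤ d`; raising `b` by one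
loses at most the value `b' = b / ρ`. This is the batched recurrence.

For the reduction, the number of a child among `r ^ t` siblings is written with `t` digits in base
`r`; the leaves then become a prefix-free code with one length per level (`exists_code_of_tree`).
Conversely, cut a code tree at its codeword lengths `l k`. The number of codewords of length at most
`l k` and the number of proper prefixes of length `l k` satisfy the inequality of an expansion with
arity `r ^ (l (k + 1) - l k)`, and the exponent can be capped at `1 + ⌊log_r n⌋` because that power
exceeds `n`. A greedy path of valid signatures does at least as well as these counts
(`exists_path_le`), and since tail weights are the least weights of sets of their size, it costs no
more than the code (`exists_path_of_code`).

For the running time, each table cell stands for a set of depth vectors (`reach`), of which it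
stores the least cost and a back pointer. A level is computed by pushing every cell along every edge
length with all children internal or all of them leaves, and then by one sweep that turns internal
nodes into leaves one at a time (`reach_succ_eq_union`). The sweep is shared by all edge lengths, so
a level takes O(n² log n) steps. Final signatures fill only two intervals of length at most `n`
(`valid_zero_iff_final`), and every multiplication loops over a factor of at most `n + 1`, so `r`
does not enter the bound. Programs are verified by total-correctness triples with time bounds
(`Runs`), and a syntactic frame rule handles what is left untouched. -/

/-- The vector that is `c` from index `m` on and `0` before. -/
def ind (c : ℝ) (m : ℕ) : ℕ → ℝ := fun q => if m ≤ q then c else 0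

/-- The cost of a vector of depths. -/
def costVec {n : ℕ} (p : Fin n → ℝ) (δ : ℕ → ℝ) : ℝ := ∑ q : Fin n, p q * δ q

/-- The depth vector of a tree with edge lengths `C` that has `m k` leaves on levels up to `k`. -/
def sigVec (C : ℕ → ℝ) (m : ℕ → ℕ) (i : ℕ) : ℕ → ℝ :=
  ∑ k ∈ Finset.range i, ind (C (k + 1)) (m k)

theorem costVec_zero {n : ℕ} (p : Fin n → ℝ) : costVec p 0 = 0 := by simp [costVec]

theorem costVec_add {n : ℕ} (p : Fin n → ℝ) (δ ε : ℕ → ℝ) :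
    costVec p (δ + ε) = costVec p δ + costVec p ε := by
  simp [costVec, mul_add, Finset.sum_add_distrib]

theorem costVec_ind {n : ℕ} (p : Fin n → ℝ) (c : ℝ) (m : ℕ) :
    costVec p (ind c m) = c * tailWeight p m := by
  simp only [costVec, ind, tailWeight, Finset.mul_sum]
  refine Finset.sum_congr rfl fun q _ => ?_
  split_ifs <;> ring

theorem sigVec_succ (C : ℕ → ℝ) (m : ℕ → ℕ) (i : ℕ) :
    sigVec C m (i + 1) = sigVec C m i + ind (C (i + 1)) (m i) := by
  simp [sigVec, Finset.sum_range_succ]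

theorem levelDepth_succ (C : ℕ → ℝ) (i : ℕ) :
    levelDepth C (i + 1) = levelDepth C i + C (i + 1) := by
  simp [levelDepth, Finset.sum_Icc_succ_top]

theorem sigVec_congr {C C' : ℕ → ℝ} {m m' : ℕ → ℕ} {i : ℕ} (hC : ∀ k, 1 ≤ k → k ≤ i → C k = C' k)
    (hm : ∀ k < i, m k = m' k) : sigVec C m i = sigVec C' m' i := by
  refine Finset.sum_congr rfl fun k hk => ?_
  rw [Finset.mem_range] at hk
  rw [hC (k + 1) (by omega) (by omega), hm k hk]

/-- Here `l` is the level of the leaf that carries item `q`: the edges above that leaf are those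
into levels `1, …, l`, and these are the indices that contribute. -/
theorem sigVec_apply_eq_levelDepth (C : ℕ → ℝ) (m : ℕ → ℕ) (i q l : ℕ) (hl : l ≤ i)
    (h : ∀ k < i, m k ≤ q ↔ k < l) : sigVec C m i q = levelDepth C l := by
  induction i with
  | zero =>
    obtain rfl : l = 0 := by omega
    simp [sigVec, levelDepth]
  | succ i ih =>
    rw [sigVec_succ, Pi.add_apply]
    rcases hl.eq_or_lt with rfl | hl'
    · have h1 : ∀ k < i + 1, m k ≤ q := fun k hk => (h k hk).2 hk
      rw [levelDepth_succ]
      congr 1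
      · clear ih h
        induction i with
        | zero => simp [sigVec, levelDepth]
        | succ i ih =>
          rw [sigVec_succ, Pi.add_apply, levelDepth_succ, ih (by omega) fun k hk => h1 k (by omega)]
          simp [ind, h1 i (by omega)]
      · simp [ind, h1 i (by omega)]
    · have : ¬ m i ≤ q := fun hh => by
        have := (h i (by omega)).1 hh
        omega
      rw [ih (by omega) fun k hk => h k (by omega)]
      simp [ind, this]

/-! ### Signatures of full trees -/

namespace GTree

theorem mem_leaves {T : GTree} {w : List ℕ} : w ∈ T.leaves ↔ w ∈ T.nodes ∧ ¬ T.IsInternal w := by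
  classical
  simp [leaves]

/-- The internal nodes on level `k`. -/
def internals (T : GTree) (k : ℕ) : Finset (List ℕ) := by
  classical exact T.nodes.filter fun w => T.IsInternal w ∧ w.length = k

theorem mem_internals {T : GTree} {k : ℕ} {w : List ℕ} :
    w ∈ T.internals k ↔ T.IsInternal w ∧ w.length = k := by
  classical
  simp only [internals, Finset.mem_filter]
  exact ⟨fun h => h.2, fun h => ⟨h.1.1, h⟩⟩

theorem sig_snd (T : GTree) (k : ℕ) : (T.sig k).2 = (T.internals k).card := by
  classical
  simp only [sig, internals]

theorem sig_fst (T : GTree) (k : ℕ) :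
    (T.sig k).1 = (T.leaves.filter fun w => w.length ≤ k).card := by
  classical
  simp only [sig]

end GTree

/-- All children, `ρ` of each, of the nodes in `I`. -/
def children (ρ : ℕ) (I : Finset (List ℕ)) : Finset (List ℕ) :=
  (I ×ˢ Finset.range ρ).image fun x => x.1 ++ [x.2]

theorem append_mem_children {ρ : ℕ} {I : Finset (List ℕ)} {w : List ℕ} {a : ℕ} :
    w ++ [a] ∈ children ρ I ↔ w ∈ I ∧ a < ρ := by
  simp only [children, Finset.mem_image, Finset.mem_product, Finset.mem_range, Prod.exists]
  constructor
  · rintro ⟨u, c, h, he⟩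
    obtain ⟨rfl, h2⟩ := List.append_inj' he rfl
    obtain rfl : c = a := by simpa using h2
    exact h
  · exact fun h => ⟨w, a, h, rfl⟩

theorem mem_children {ρ : ℕ} {I : Finset (List ℕ)} {u : List ℕ} :
    u ∈ children ρ I ↔ ∃ w a, w ∈ I ∧ a < ρ ∧ u = w ++ [a] := by
  simp only [children, Finset.mem_image, Finset.mem_product, Finset.mem_range, Prod.exists]
  constructor
  · rintro ⟨w, a, ⟨h1, h2⟩, h3⟩
    exact ⟨w, a, h1, h2, h3.symm⟩
  · rintro ⟨w, a, h1, h2, h3⟩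
    exact ⟨w, a, ⟨h1, h2⟩, h3.symm⟩

theorem card_children (ρ : ℕ) (I : Finset (List ℕ)) : (children ρ I).card = I.card * ρ := by
  rw [children, Finset.card_image_of_injective, Finset.card_product, Finset.card_range]
  rintro ⟨u, c⟩ ⟨w, a⟩ he
  obtain ⟨rfl, h2⟩ := List.append_inj' he rfl
  simpa using h2

namespace GTree

/-- Tags occur only on level `i`, so an internal node on a level `k < i` has a child and, by
fullness, all of its children. -/
theorem nodes_succ {T : GTree} {R : ℕ → ℕ} {i k : ℕ} (hL : T.IsLevelTree i) (hS : T.Satisfies R)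
    (hF : T.IsFull R) (hk : k < i) :
    T.nodes.filter (fun w => w.length = k + 1) = children (R (k + 1)) (T.internals k) := by
  ext u
  simp only [Finset.mem_filter, mem_children, mem_internals]
  constructor
  · rintro ⟨hu, hl⟩
    obtain ⟨w, a, rfl⟩ : ∃ w a, u = w ++ [a] := by
      rcases List.eq_nil_or_concat u with rfl | ⟨w, a, h⟩
      · simp at hl
      · exact ⟨w, a, by simpa using h⟩
    have hw : w.length = k := by simpa using hl
    exact ⟨w, a, ⟨⟨T.closed _ _ hu, Or.inr ⟨a, hu⟩⟩, hw⟩, by simpa [hw] using hS _ _ hu, rfl⟩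
  · rintro ⟨w, a, ⟨⟨hw, hi⟩, hl⟩, ha, rfl⟩
    refine ⟨?_, by simp [hl]⟩
    rcases hi with hi | ⟨c, hc⟩
    · have := hL.2 _ hi
      omega
    · exact hF _ _ hc a (by rwa [hl])

/-- By `nodes_succ` the size of level `k + 1` is known, and each node there is either internal or a
new leaf. -/
theorem sig_succ {T : GTree} {R : ℕ → ℕ} {i k : ℕ} (hL : T.IsLevelTree i) (hS : T.Satisfies R)
    (hF : T.IsFull R) (hk : k < i) :
    (T.sig (k + 1)).2 ≤ (T.sig k).2 * R (k + 1) ∧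
      (T.sig (k + 1)).1 + (T.sig (k + 1)).2 = (T.sig k).1 + (T.sig k).2 * R (k + 1) := by
  classical
  have h1 := nodes_succ hL hS hF hk
  have h2 : (T.nodes.filter fun w => w.length = k + 1).card = (T.sig k).2 * R (k + 1) := by
    rw [h1, card_children, sig_snd]
  have h3 : T.internals (k + 1) ⊆ T.nodes.filter fun w => w.length = k + 1 := by
    intro w hw
    rw [mem_internals] at hw
    exact Finset.mem_filter.2 ⟨hw.1.1, hw.2⟩
  have h4 : (T.leaves.filter fun w => w.length ≤ k + 1) = (T.leaves.filter fun w => w.length ≤ k) ∪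
      ((T.nodes.filter fun w => w.length = k + 1) \ T.internals (k + 1)) := by
    ext w
    simp only [Finset.mem_filter, Finset.mem_union, Finset.mem_sdiff, mem_leaves, mem_internals]
    constructor
    · rintro ⟨⟨a, b⟩, c⟩
      rcases Nat.lt_or_ge k w.length with h | h
      · exact Or.inr ⟨⟨a, by omega⟩, fun h => b h.1⟩
      · exact Or.inl ⟨⟨a, b⟩, h⟩
    · rintro (⟨a, b⟩ | ⟨⟨a, b⟩, c⟩)
      · exact ⟨a, by omega⟩
      · exact ⟨⟨a, fun h => c ⟨h, b⟩⟩, by omega⟩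
  have h5 := Finset.card_le_card h3
  rw [h2, ← sig_snd] at h5
  refine ⟨h5, ?_⟩
  rw [sig_fst, h4, Finset.card_union_of_disjoint, Finset.card_sdiff_of_subset h3, h2, ← sig_fst,
    ← sig_snd]
  · omega
  · rw [Finset.disjoint_left]
    intro w hw hw'
    simp only [Finset.mem_filter, Finset.mem_sdiff] at hw hw'
    omega

theorem sig_zero (T : GTree) : T.sig 0 = (0, 1) ∨ T.sig 0 = (1, 0) := by
  classical
  have hl : ∀ w : List ℕ, w.length ≤ 0 ↔ w = [] := by simp
  by_cases h : T.IsInternal []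
  · left
    ext
    · rw [sig_fst, Finset.card_eq_zero, Finset.filter_eq_empty_iff]
      intro w hw hw'
      rw [(hl w).1 hw', mem_leaves] at hw
      exact hw.2 h
    · rw [sig_snd]
      have : T.internals 0 = {[]} := by
        ext w
        rw [mem_internals, Finset.mem_singleton, List.length_eq_zero_iff]
        exact ⟨fun h => h.2, by rintro rfl; exact ⟨h, rfl⟩⟩
      simp [this]
  · right
    ext
    · rw [sig_fst]
      have : (T.leaves.filter fun w => w.length ≤ 0) = {[]} := by
        ext w
        rw [Finset.mem_filter, mem_leaves, Finset.mem_singleton, hl]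
        exact ⟨fun h => h.2, by rintro rfl; exact ⟨⟨T.root_mem, h⟩, rfl⟩⟩
      rw [this, Finset.card_singleton]
    · rw [sig_snd, Finset.card_eq_zero, Finset.eq_empty_iff_forall_notMem]
      intro w hw
      rw [mem_internals, List.length_eq_zero_iff] at hw
      exact h (hw.2 ▸ hw.1)

end GTree

/-- Only cardinalities are prescribed, so on each level any subset of the available children of the
right size will do. -/
theorem exists_levels (R b : ℕ → ℕ) (i : ℕ) (h0 : b 0 ≤ 1)
    (hb : ∀ k < i, b (k + 1) ≤ b k * R (k + 1)) :
    ∃ I : ℕ → Finset (List ℕ), I 0 ⊆ {[]} ∧ (∀ k < i, I (k + 1) ⊆ children (R (k + 1)) (I k)) ∧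
      ∀ k ≤ i, (I k).card = b k := by
  classical
  induction i with
  | zero =>
    obtain ⟨A, hA, hc⟩ := Finset.exists_subset_card_eq (s := {([] : List ℕ)}) (n := b 0) (by simpa)
    refine ⟨fun _ => A, hA, by simp, ?_⟩
    intro k hk
    obtain rfl : k = 0 := by omega
    exact hc
  | succ i ih =>
    obtain ⟨I, h1, h2, h3⟩ := ih fun k hk => hb k (by omega)
    obtain ⟨A, hA, hc⟩ := Finset.exists_subset_card_eq (s := children (R (i + 1)) (I i))
      (n := b (i + 1)) (by rw [card_children, h3 i le_rfl]; exact hb i (by omega))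
    refine ⟨Function.update I (i + 1) A, by rwa [Function.update_of_ne (by omega)], ?_, ?_⟩
    · intro k hk
      rw [Function.update_of_ne (a := k) (by omega)]
      rcases (Nat.lt_succ_iff.1 hk).eq_or_lt with rfl | hk'
      · simpa using hA
      · rw [Function.update_of_ne (by omega)]
        exact h2 k hk'
    · intro k hk
      rcases hk.eq_or_lt with rfl | hk'
      · simpa using hc
      · rw [Function.update_of_ne (by omega)]
        exact h3 k (by omega)

/-- Converse of `GTree.sig_succ`. The tree consists of the root and all children of the chosen
internal nodes, with the chosen nodes on level `i` tagged. The leaf counts need no choice: the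
recurrence determines them from the numbers of internal nodes. -/
theorem exists_tree (R : ℕ → ℕ) (i : ℕ) (hR : ∀ k, 1 ≤ k → k ≤ i → 1 ≤ R k) (σ : ℕ → ℕ × ℕ)
    (h0 : σ 0 = (0, 1) ∨ σ 0 = (1, 0))
    (hσ : ∀ k < i, (σ (k + 1)).2 ≤ (σ k).2 * R (k + 1) ∧
      (σ (k + 1)).1 + (σ (k + 1)).2 = (σ k).1 + (σ k).2 * R (k + 1)) :
    ∃ T : GTree, T.IsLevelTree i ∧ T.Satisfies R ∧ T.IsFull R ∧ ∀ k ≤ i, T.sig k = σ k := by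
  classical
  obtain ⟨I, hI0, hI, hc⟩ := exists_levels R (fun k => (σ k).2) i
    (by rcases h0 with h | h <;> simp [h]) fun k hk => (hσ k hk).1
  have hlen : ∀ k ≤ i, ∀ w ∈ I k, w.length = k := by
    intro k
    induction k with
    | zero =>
      intro _ w hw
      simpa using hI0 hw
    | succ k ih =>
      intro hk w hw
      obtain ⟨u, a, hu, -, rfl⟩ := mem_children.1 (hI k (by omega) hw)
      simp [ih (by omega) u hu]
  have happ : ∀ w a, w ++ [a] ∈ insert [] ((Finset.range i).biUnion
      fun k => children (R (k + 1)) (I k)) ↔ w.length < i ∧ w ∈ I w.length ∧ a < R (w.length + 1) := by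
    intro w a
    simp only [Finset.mem_insert, List.append_eq_nil_iff, List.cons_ne_self, and_false, false_or,
      Finset.mem_biUnion, Finset.mem_range, append_mem_children]
    constructor
    · rintro ⟨k, hk, hw, ha⟩
      obtain rfl := hlen k (by omega) w hw
      exact ⟨hk, hw, ha⟩
    · rintro ⟨h1, h2, h3⟩
      exact ⟨_, h1, h2, h3⟩
  have hsub : ∀ k ≤ i, I k ⊆ insert [] ((Finset.range i).biUnion
      fun k => children (R (k + 1)) (I k)) := by
    rintro (_ | k) hk w hw
    · have : w = [] := by simpa using hI0 hw
      simp [this]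
    · refine Finset.mem_insert_of_mem (Finset.mem_biUnion.2 ⟨k, ?_, hI k (by omega) hw⟩)
      simp only [Finset.mem_range]
      omega
  let T : GTree :=
    { nodes := insert [] ((Finset.range i).biUnion fun k => children (R (k + 1)) (I k))
      root_mem := Finset.mem_insert_self _ _
      closed := fun w a h => by
        have h' := (happ w a).1 h
        exact hsub _ h'.1.le h'.2.1
      marked := I i
      marked_sub := hsub i le_rfl }
  have hint : ∀ w, T.IsInternal w ↔ w.length ≤ i ∧ w ∈ I w.length := by
    intro w
    constructor
    · rintro ⟨-, h | ⟨a, h⟩⟩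
      · have := hlen i le_rfl w h
        exact ⟨this.le, by rw [this]; exact h⟩
      · have h' := (happ w a).1 h
        exact ⟨h'.1.le, h'.2.1⟩
    · rintro ⟨h1, h2⟩
      refine ⟨hsub _ h1 h2, ?_⟩
      rcases h1.eq_or_lt with h | h
      · left
        have h3 : w ∈ I i := by rw [← h]; exact h2
        exact h3
      · right
        -- A chosen node above level `i` is internal because its arity is positive, so that child
        -- `0` exists.
        exact ⟨0, (happ w 0).2 ⟨h, h2, hR _ (by omega) (by omega)⟩⟩
  have hb : ∀ k ≤ i, T.internals k = I k := by
    intro k hk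
    ext w
    rw [GTree.mem_internals, hint]
    constructor
    · rintro ⟨h, rfl⟩
      exact h.2
    · intro h
      obtain rfl := hlen k hk w h
      exact ⟨⟨hk, h⟩, rfl⟩
  have hL : T.IsLevelTree i := by
    refine ⟨fun w hw => ?_, fun w hw => hlen i le_rfl w hw⟩
    rcases List.eq_nil_or_concat w with rfl | ⟨u, a, h⟩
    · simp
    · have h : w = u ++ [a] := by simpa using h
      subst h
      have := ((happ u a).1 hw).1
      simp
      omega
  have hS : T.Satisfies R := fun w a h => ((happ w a).1 h).2.2
  have hF : T.IsFull R := fun w a h a' ha' => by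
    have h' := (happ w a).1 h
    exact (happ w a').2 ⟨h'.1, h'.2.1, ha'⟩
  have h2 : ∀ k ≤ i, (T.sig k).2 = (σ k).2 := fun k hk => by
    rw [GTree.sig_snd, hb k hk, hc k hk]
  refine ⟨T, hL, hS, hF, fun k => ?_⟩
  induction k with
  | zero =>
    intro hk
    have := h2 0 hk
    rcases T.sig_zero with h | h <;> rcases h0 with h' | h' <;> simp_all
  | succ k ih =>
    intro hk
    have e1 := (GTree.sig_succ hL hS hF (k := k) (by omega)).2
    have e2 := (hσ k (by omega)).2
    have e3 := h2 (k + 1) hk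
    rw [ih (by omega)] at e1
    ext
    · omega
    · exact e3

/-! ### Listing the leaves from top to bottom -/

namespace GTree

theorem card_leaves {T : GTree} {i : ℕ} (hL : T.IsLevelTree i) : T.leaves.card = (T.sig i).1 := by
  classical
  rw [sig_fst, Finset.filter_true_of_mem]
  intro w hw
  exact hL.1 w (mem_leaves.1 hw).1

theorem exists_isTopDown {T : GTree} {m : ℕ} (hm : T.leaves.card = m) :
    ∃ v : Fin m → List ℕ, T.IsTopDown v := by
  subst hm
  let e := T.leaves.equivFin.symm
  let f : Fin T.leaves.card → ℕ := fun t => (e t : List ℕ).length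
  refine ⟨fun t => e (Tuple.sort f t), ⟨?_, ?_⟩, ?_⟩
  · intro s t h
    simpa [Subtype.coe_inj] using h
  · intro w
    constructor
    · intro hw
      refine ⟨(Tuple.sort f).symm (e.symm ⟨w, hw⟩), by simp⟩
    · rintro ⟨t, rfl⟩
      exact Subtype.coe_prop _
  · intro s t h
    exact Tuple.monotone_sort f h

/-- In a list from top to bottom, the leaves on levels up to `k` form an initial segment, and the
signature gives its length. -/
theorem IsTopDown.length_le_iff {T : GTree} {m : ℕ} {v : Fin m → List ℕ} (hv : T.IsTopDown v)
    (k : ℕ) (t : Fin m) : (v t).length ≤ k ↔ (t : ℕ) < (T.sig k).1 := by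
  classical
  have h1 : (T.sig k).1 = (Finset.univ.filter fun t => (v t).length ≤ k).card := by
    rw [sig_fst, ← Finset.card_image_of_injective _ hv.1.1]
    congr 1
    ext w
    simp only [Finset.mem_filter, Finset.mem_image, Finset.mem_univ, true_and, hv.1.2]
    constructor
    · rintro ⟨⟨s, rfl⟩, h⟩
      exact ⟨s, h, rfl⟩
    · rintro ⟨s, h, rfl⟩
      exact ⟨⟨s, rfl⟩, h⟩
  rw [h1]
  constructor
  · intro h
    have : Finset.Iic t ⊆ Finset.univ.filter fun t => (v t).length ≤ k := by
      intro s hs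
      rw [Finset.mem_Iic] at hs
      exact Finset.mem_filter.2 ⟨Finset.mem_univ _, (hv.2 s t hs).trans h⟩
    have := Finset.card_le_card this
    rw [Fin.card_Iic] at this
    omega
  · intro h
    by_contra hn
    have : (Finset.univ.filter fun t => (v t).length ≤ k) ⊆ Finset.Iio t := by
      intro s hs
      rw [Finset.mem_filter] at hs
      rw [Finset.mem_Iio]
      by_contra hs'
      exact hn ((hv.2 t s (not_lt.1 hs')).trans hs.2)
    have := Finset.card_le_card this
    rw [Fin.card_Iio] at this
    omega

theorem IsTopDown.sigVec_eq {T : GTree} {i m : ℕ} {v : Fin m → List ℕ} (hv : T.IsTopDown v)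
    (hL : T.IsLevelTree i) (C : ℕ → ℝ) (t : Fin m) :
    sigVec C (fun k => (T.sig k).1) i t = levelDepth C (v t).length := by
  refine sigVec_apply_eq_levelDepth _ _ _ _ _ (hL.1 _ ?_) fun k _ => ?_
  · exact (mem_leaves.1 ((hv.1.2 _).2 ⟨t, rfl⟩)).1
  · rw [← not_lt, ← hv.length_le_iff, not_le]

theorem sig_fst_mono (T : GTree) : Monotone fun k => (T.sig k).1 := by
  classical
  intro k l h
  simp only [sig_fst]
  refine Finset.card_le_card fun w hw => ?_
  rw [Finset.mem_filter] at hw ⊢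
  exact ⟨hw.1, hw.2.trans h⟩

end GTree

/-- The cost is collected edge by edge instead of leaf by leaf. Leaves past index `n` weigh nothing
and items past index `m` get the depth of level `i`, so no comparison of `m` with `n` is needed. -/
theorem partialCost_eq {n : ℕ} (p : Fin n → ℝ) (C : ℕ → ℝ) {T : GTree} {i m : ℕ}
    {v : Fin m → List ℕ} (hv : T.IsTopDown v) (hL : T.IsLevelTree i) (hm : (T.sig i).1 = m) :
    partialCost C p i v = costVec p (sigVec C (fun k => (T.sig k).1) i) := by
  set δ := sigVec C (fun k => (T.sig k).1) i with hδ
  have h1 : ∀ q, m ≤ q → δ q = levelDepth C i := fun q hq =>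
    sigVec_apply_eq_levelDepth _ _ _ _ _ le_rfl fun k hk =>
      ⟨fun _ => hk, fun _ => (T.sig_fst_mono hk.le).trans (hm.le.trans hq)⟩
  have h2 : ∑ t : Fin m, levelDepth C (v t).length * pad p t =
      ∑ t ∈ Finset.range m, δ t * pad p t := by
    rw [← Fin.sum_univ_eq_sum_range fun t => δ t * pad p t]
    exact Finset.sum_congr rfl fun t _ => by rw [hδ, hv.sigVec_eq hL]
  have h3 : ∑ t ∈ Finset.range m, δ t * pad p t =
      ∑ q : Fin n, if m ≤ (q : ℕ) then 0 else p q * δ q := by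
    have h4 : ∀ q : Fin n, (if m ≤ (q : ℕ) then 0 else p q * δ q) =
        if m ≤ (q : ℕ) then 0 else δ q * pad p q := by
      intro q
      simp [pad, mul_comm]
    rw [Finset.sum_congr rfl fun q _ => h4 q,
      Fin.sum_univ_eq_sum_range fun q => if m ≤ q then 0 else δ q * pad p q]
    have h5 : ∀ q, n ≤ q → pad p q = 0 := fun q hq => by simp [pad, hq]
    -- One sum runs to `m` and the other to `n`; outside the common range up to `min m n` all terms
    -- vanish.
    rw [← Finset.sum_subset (Finset.range_subset_range.2 (min_le_left m n)),
      ← Finset.sum_subset (Finset.range_subset_range.2 (min_le_right m n))]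
    · refine Finset.sum_congr rfl fun q hq => ?_
      rw [Finset.mem_range] at hq
      rw [if_neg (by omega)]
    · intro q _ hq
      rw [Finset.mem_range] at *
      rw [if_pos (by omega)]
    · intro q _ hq
      rw [Finset.mem_range] at *
      rw [h5 q (by omega), mul_zero]
  rw [partialCost, h2, h3, costVec, tailWeight, Finset.mul_sum, ← Finset.sum_add_distrib]
  refine Finset.sum_congr rfl fun q _ => ?_
  split_ifs with h
  · rw [h1 _ h]
    ring
  · simp

/-! ### Paths of signatures -/

namespace LevelChoices

variable (S : LevelChoices)

/-- `S.Path Val i s δ`: there is a sequence of signatures that satisfy `Val`, one for each of the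
levels `0, …, i` and each an expansion of its predecessor, that ends in `s`; `δ` is the vector of
the depths of the leaves of the trees with these signatures. -/
inductive Path (Val : ℕ → ℕ × ℕ → Prop) : ℕ → ℕ × ℕ → (ℕ → ℝ) → Prop
  | root (h : Val 0 (0, 1)) : Path Val 0 (0, 1) 0
  | leaf (h : Val 0 (1, 0)) : Path Val 0 (1, 0) 0
  | step {i s' δ} (j : ℕ) (s : ℕ × ℕ) (h : Path Val i s' δ) (h1 : 1 ≤ j) (h2 : j ≤ S.Δ (i + 1))
      (hs : Val (i + 1) s) (hle : s.2 ≤ s'.2 * S.arity (i + 1) j)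
      (heq : s.1 + s.2 = s'.1 + s'.2 * S.arity (i + 1) j) :
      Path Val (i + 1) s (δ + ind (S.len (i + 1) j) s'.1)

variable {S}

theorem Path.val {Val : ℕ → ℕ × ℕ → Prop} {i : ℕ} {s : ℕ × ℕ} {δ : ℕ → ℝ} (h : S.Path Val i s δ) :
    Val i s := by
  cases h <;> assumption

/-- The predicate `Val` is left open: `S.Valid n` gives the trees with valid truncations, and the
constant `True` gives all trees. -/
theorem path_of_tree {Val : ℕ → ℕ × ℕ → Prop} {J : ℕ → ℕ} {i : ℕ} (hJ : S.Permissible i J)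
    {T : GTree} (hL : T.IsLevelTree i) (hS : T.Satisfies (S.R J)) (hF : T.IsFull (S.R J))
    (hV : ∀ k ≤ i, Val k (T.sig k)) (k : ℕ) (hk : k ≤ i) :
    S.Path Val k (T.sig k) (sigVec (S.C J) (fun k => (T.sig k).1) k) := by
  induction k with
  | zero =>
    have h := hV 0 hk
    have e : sigVec (S.C J) (fun k => (T.sig k).1) 0 = 0 := by simp [sigVec]
    rw [e]
    rcases T.sig_zero with h' | h' <;> rw [h'] at h ⊢
    · exact .root h
    · exact .leaf h
  | succ k ih =>
    rw [sigVec_succ]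
    have h := GTree.sig_succ hL hS hF (k := k) (by omega)
    exact (ih (by omega)).step (J (k + 1)) _ (hJ _ (by omega) hk).1 (hJ _ (by omega) hk).2
      (hV _ hk) h.1 h.2

theorem Path.exists_seq {Val : ℕ → ℕ × ℕ → Prop} {i : ℕ} {s : ℕ × ℕ} {δ : ℕ → ℝ}
    (h : S.Path Val i s δ) :
    ∃ (J : ℕ → ℕ) (σ : ℕ → ℕ × ℕ), S.Permissible i J ∧ (σ 0 = (0, 1) ∨ σ 0 = (1, 0)) ∧ σ i = s ∧
      (∀ k ≤ i, Val k (σ k)) ∧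
      (∀ k < i, (σ (k + 1)).2 ≤ (σ k).2 * S.R J (k + 1) ∧
        (σ (k + 1)).1 + (σ (k + 1)).2 = (σ k).1 + (σ k).2 * S.R J (k + 1)) ∧
      δ = sigVec (S.C J) (fun k => (σ k).1) i := by
  induction h with
  | root h =>
    exact ⟨fun _ => 0, fun _ => (0, 1), fun k _ _ => by omega, Or.inl rfl, rfl,
      fun k hk => by rwa [Nat.le_zero.1 hk], by simp, by simp [sigVec]⟩
  | leaf h =>
    exact ⟨fun _ => 0, fun _ => (1, 0), fun k _ _ => by omega, Or.inr rfl, rfl,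
      fun k hk => by rwa [Nat.le_zero.1 hk], by simp, by simp [sigVec]⟩
  | @step i s' δ j s h h1 h2 hs hle heq ih =>
    obtain ⟨J, σ, hJ, h0, hi, hV, hst, rfl⟩ := ih
    have hne : ∀ k ≤ i, k ≠ i + 1 := fun k hk => by omega
    have hJk : ∀ k ≤ i, Function.update J (i + 1) j k = J k := fun k hk =>
      Function.update_of_ne (hne k hk) _ _
    have hσk : ∀ k ≤ i, Function.update σ (i + 1) s k = σ k := fun k hk =>
      Function.update_of_ne (hne k hk) _ _
    refine ⟨Function.update J (i + 1) j, Function.update σ (i + 1) s, ?_, ?_, by simp, ?_, ?_, ?_⟩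
    · intro k hk hk'
      rcases hk'.eq_or_lt with rfl | hk''
      · simpa using ⟨h1, h2⟩
      · rw [hJk k (by omega)]
        exact hJ k hk (by omega)
    · rwa [hσk 0 (by omega)]
    · intro k hk
      rcases hk.eq_or_lt with rfl | hk''
      · simpa using hs
      · rw [hσk k (by omega)]
        exact hV k (by omega)
    · intro k hk
      rw [hσk k (by omega), R]
      rcases (Nat.lt_succ_iff.1 hk).eq_or_lt with rfl | hk''
      · rw [Function.update_self, Function.update_self, hi]
        exact ⟨hle, heq⟩
      · rw [hσk (k + 1) (by omega), hJk (k + 1) (by omega)]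
        exact hst k hk''
    · rw [sigVec_succ]
      congr 1
      · refine sigVec_congr (fun k _ hk => ?_) fun k hk => ?_
        · rw [C, C, hJk k hk]
        · rw [hσk k hk.le]
      · rw [C, Function.update_self, hσk i le_rfl, hi]

theorem Path.exists_tree {Val : ℕ → ℕ × ℕ → Prop} (hS : S.Proper) {i : ℕ} {s : ℕ × ℕ} {δ : ℕ → ℝ}
    (h : S.Path Val i s δ) :
    ∃ J, S.Permissible i J ∧ ∃ T : GTree, T.IsLevelTree i ∧ T.Satisfies (S.R J) ∧
      T.IsFull (S.R J) ∧ T.sig i = s ∧ (∀ k ≤ i, Val k (T.sig k)) ∧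
      δ = sigVec (S.C J) (fun k => (T.sig k).1) i := by
  obtain ⟨J, σ, hJ, h0, rfl, hV, hst, rfl⟩ := h.exists_seq
  obtain ⟨T, h1, h2, h3, h4⟩ := ReservedLength.exists_tree (S.R J) i
    (fun k hk hk' => (hS k (J k) (hJ k hk hk').1 (hJ k hk hk').2).1) σ h0 hst
  refine ⟨J, hJ, T, h1, h2, h3, h4 i le_rfl, fun k hk => by rw [h4 k hk]; exact hV k hk, ?_⟩
  exact sigVec_congr (fun _ _ _ => rfl) fun k hk => by rw [h4 k hk.le]

/-- With this the dynamic program can be studied on paths alone, without mention of trees. -/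
theorem mem_partialCosts {n : ℕ} (p : Fin n → ℝ) (hS : S.Proper) {i m b : ℕ} {x : ℝ} :
    x ∈ S.partialCosts p i m b ↔ ∃ δ, S.Path (S.Valid n) i (m, b) δ ∧ x = costVec p δ := by
  constructor
  · rintro ⟨J, hJ, T, hL, hSa, hF, hs, hV, v, hv, rfl⟩
    refine ⟨_, hs ▸ path_of_tree hJ hL hSa hF hV i le_rfl, ?_⟩
    exact partialCost_eq p _ hv hL (by rw [hs])
  · rintro ⟨δ, h, rfl⟩
    obtain ⟨J, hJ, T, hL, hSa, hF, hs, hV, rfl⟩ := h.exists_tree hS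
    obtain ⟨v, hv⟩ := GTree.exists_isTopDown (T := T) (m := m) (by rw [GTree.card_leaves hL, hs])
    exact ⟨J, hJ, T, hL, hSa, hF, hs, hV, v, hv, (partialCost_eq p _ hv hL (by rw [hs])).symm⟩

theorem mem_allPartialCosts {n : ℕ} (p : Fin n → ℝ) (hS : S.Proper) {i m b : ℕ} {x : ℝ} :
    x ∈ S.allPartialCosts p i m b ↔
      ∃ δ, S.Path (fun _ _ => True) i (m, b) δ ∧ x = costVec p δ := by
  constructor
  · rintro ⟨J, hJ, T, hL, hSa, hF, hs, v, hv, rfl⟩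
    refine ⟨_, hs ▸ path_of_tree hJ hL hSa hF (fun _ _ => trivial) i le_rfl, ?_⟩
    exact partialCost_eq p _ hv hL (by rw [hs])
  · rintro ⟨δ, h, rfl⟩
    obtain ⟨J, hJ, T, hL, hSa, hF, hs, -, rfl⟩ := h.exists_tree hS
    obtain ⟨v, hv⟩ := GTree.exists_isTopDown (T := T) (m := m) (by rw [GTree.card_leaves hL, hs])
    exact ⟨J, hJ, T, hL, hSa, hF, hs, v, hv, (partialCost_eq p _ hv hL (by rw [hs])).symm⟩

end LevelChoices

/-! ### The dynamic program -/

namespace LevelChoices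

variable {S : LevelChoices}

theorem path_zero_iff {Val : ℕ → ℕ × ℕ → Prop} {s : ℕ × ℕ} {δ : ℕ → ℝ} :
    S.Path Val 0 s δ ↔ Val 0 s ∧ (s = (0, 1) ∨ s = (1, 0)) ∧ δ = 0 := by
  constructor
  · intro h
    cases h with
    | root h => exact ⟨h, Or.inl rfl, rfl⟩
    | leaf h => exact ⟨h, Or.inr rfl, rfl⟩
  · rintro ⟨h, rfl | rfl, rfl⟩
    · exact .root h
    · exact .leaf h

theorem path_succ_iff {Val : ℕ → ℕ × ℕ → Prop} {i : ℕ} {s : ℕ × ℕ} {δ : ℕ → ℝ} :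
    S.Path Val (i + 1) s δ ↔ Val (i + 1) s ∧ ∃ j s' δ', 1 ≤ j ∧ j ≤ S.Δ (i + 1) ∧
      S.Path Val i s' δ' ∧ s.2 ≤ s'.2 * S.arity (i + 1) j ∧
      s.1 + s.2 = s'.1 + s'.2 * S.arity (i + 1) j ∧ δ = δ' + ind (S.len (i + 1) j) s'.1 := by
  constructor
  · intro h
    cases h with
    | step j s h h1 h2 hs hle heq => exact ⟨hs, j, _, _, h1, h2, h, hle, heq, rfl⟩
  · rintro ⟨hs, j, s', δ', h1, h2, h, hle, heq, rfl⟩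
    exact h.step j s h1 h2 hs hle heq

/-- Arities are positive, so a predecessor `(m', b')` of `(m, b)` satisfies `m' + b' ≤ m' + b' * ρ =
m + b`, which leaves finitely many. -/
theorem path_finite (hS : S.Proper) (Val : ℕ → ℕ × ℕ → Prop) (i : ℕ) (s : ℕ × ℕ) :
    {δ | S.Path Val i s δ}.Finite := by
  induction i generalizing s with
  | zero => exact (Set.finite_singleton 0).subset fun δ h => (path_zero_iff.1 h).2.2
  | succ i ih =>
    have hf : (⋃ j ∈ Finset.Icc 1 (S.Δ (i + 1)), ⋃ m ∈ Finset.range (s.1 + s.2 + 1),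
        ⋃ b ∈ Finset.range (s.1 + s.2 + 1),
        (fun δ' => δ' + ind (S.len (i + 1) j) m) '' {δ | S.Path Val i (m, b) δ}).Finite := by
      refine Set.Finite.biUnion (Finset.finite_toSet _) fun j _ => ?_
      refine Set.Finite.biUnion (Finset.finite_toSet _) fun m _ => ?_
      exact Set.Finite.biUnion (Finset.finite_toSet _) fun b _ => (ih _).image _
    refine hf.subset ?_
    intro δ h
    obtain ⟨-, j, ⟨m, b⟩, δ', h1, h2, h', hle, heq, rfl⟩ := path_succ_iff.1 h
    have h3 : b ≤ b * S.arity (i + 1) j := Nat.le_mul_of_pos_right _ (hS _ j h1 h2).1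
    simp only [Set.mem_iUnion]
    refine ⟨j, Finset.mem_Icc.2 ⟨h1, h2⟩, m, Finset.mem_range.2 ?_, b, Finset.mem_range.2 ?_, δ', h',
      rfl⟩
    · simp only at heq
      omega
    · simp only at heq
      omega

theorem OPT_le {n : ℕ} (p : Fin n → ℝ) (hS : S.Proper) {i m b : ℕ} {δ : ℕ → ℝ}
    (h : S.Path (S.Valid n) i (m, b) δ) : S.OPT p i m b ≤ (costVec p δ : ℝ) :=
  sInf_le ⟨_, (mem_partialCosts p hS).2 ⟨δ, h, rfl⟩, rfl⟩

theorem le_OPT {n : ℕ} (p : Fin n → ℝ) (hS : S.Proper) {i m b : ℕ} {a : EReal}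
    (h : ∀ δ, S.Path (S.Valid n) i (m, b) δ → a ≤ (costVec p δ : ℝ)) : a ≤ S.OPT p i m b := by
  refine le_sInf ?_
  rintro _ ⟨x, hx, rfl⟩
  obtain ⟨δ, hδ, rfl⟩ := (mem_partialCosts p hS).1 hx
  exact h δ hδ

theorem OPT_eq_top {n : ℕ} (p : Fin n → ℝ) (hS : S.Proper) {i m b : ℕ}
    (h : ∀ δ, ¬ S.Path (S.Valid n) i (m, b) δ) : S.OPT p i m b = ⊤ :=
  top_le_iff.1 (le_OPT p hS fun δ hδ => (h δ hδ).elim)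

theorem OPT_attained {n : ℕ} (p : Fin n → ℝ) (hS : S.Proper) {i m b : ℕ}
    (h : S.OPT p i m b ≠ ⊤) :
    ∃ δ, S.Path (S.Valid n) i (m, b) δ ∧ S.OPT p i m b = (costVec p δ : ℝ) := by
  have hne : {δ | S.Path (S.Valid n) i (m, b) δ}.Nonempty := by
    by_contra hn
    exact h (OPT_eq_top p hS fun δ hδ => hn ⟨δ, hδ⟩)
  obtain ⟨δ, hδ, hmin⟩ := Set.exists_min_image _ (costVec p) (path_finite hS (S.Valid n) i (m, b)) hne
  exact ⟨δ, hδ, le_antisymm (OPT_le p hS hδ)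
    (le_OPT p hS fun δ' hδ' => EReal.coe_le_coe_iff.2 (hmin δ' hδ'))⟩

/-- Along a path the sum `m + b` never decreases, and `b` cannot become positive again after it has
vanished. Hence `0 < b` and `m + b ≤ n` at the end imply the same on every earlier level. -/
theorem allPartialCosts_eq {n : ℕ} (p : Fin n → ℝ) (hS : S.Proper) {i m b : ℕ} (hb : 0 < b)
    (hn : m + b ≤ n) : S.partialCosts p i m b = S.allPartialCosts p i m b := by
  ext x
  rw [mem_partialCosts p hS, mem_allPartialCosts p hS]
  constructor
  · rintro ⟨δ, h, rfl⟩
    refine ⟨δ, ?_, rfl⟩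
    clear hb hn
    generalize (m, b) = s at h
    induction h with
    | root h => exact .root trivial
    | leaf h => exact .leaf trivial
    | step j s h h1 h2 hs hle heq ih => exact ih.step j s h1 h2 trivial hle heq
  · rintro ⟨δ, h, rfl⟩
    refine ⟨δ, ?_, rfl⟩
    have key : ∀ {i s δ}, S.Path (fun _ _ => True) i s δ → 0 < s.2 → s.1 + s.2 ≤ n →
        S.Path (S.Valid n) i s δ := by
      clear h
      intro i s δ h
      induction h with
      | root h => exact fun h1 h2 => .root (Or.inl ⟨h1, h2⟩)
      | leaf h => exact fun h1 => by simp at h1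
      | @step i s' δ j s h h1 h2 hs hle heq ih =>
        intro hb hn
        have h3 : 0 < s'.2 := by
          rcases Nat.eq_zero_or_pos s'.2 with h0 | h0
          · rw [h0] at hle
            omega
          · exact h0
        have h4 : s'.2 ≤ s'.2 * S.arity (i + 1) j := Nat.le_mul_of_pos_right _ (hS _ j h1 h2).1
        exact (ih h3 (by omega)).step j s h1 h2 (Or.inl ⟨hb, hn⟩) hle heq
    exact key h hb hn

theorem OPT_zero {n : ℕ} (hn : 2 ≤ n) (p : Fin n → ℝ) (hS : S.Proper) : S.OPT p 0 0 1 = 0 := by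
  refine le_antisymm ?_ (le_OPT p hS fun δ h => ?_)
  · have := OPT_le p hS (Path.root (S := S) (Val := S.Valid n) (Or.inl ⟨by simp, by simp; omega⟩))
    rwa [costVec_zero] at this
  · rw [(path_zero_iff.1 h).2.2, costVec_zero]
    rfl

theorem not_valid_one_zero {n : ℕ} (hn : 2 ≤ n) (i : ℕ) : ¬ S.Valid n i (1, 0) := by
  rintro (h | ⟨-, j, -, -, h, -⟩)
  · exact absurd h.1 (by simp)
  · have := le_of_max_le_left h
    simp only at this
    omega

theorem OPT_zero_of_ne {n : ℕ} (hn : 2 ≤ n) (p : Fin n → ℝ) (hS : S.Proper) {m b : ℕ}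
    (h : (m, b) ≠ (0, 1)) : S.OPT p 0 m b = ⊤ := by
  refine OPT_eq_top p hS fun δ hδ => ?_
  obtain ⟨hV, h1 | h1, -⟩ := path_zero_iff.1 hδ
  · exact h h1
  · rw [h1] at hV
    exact not_valid_one_zero hn 0 hV

theorem OPTj_le {n : ℕ} (p : Fin n → ℝ) {i j m b : ℕ} {s' : ℕ × ℕ} (h : S.Step n i j s' (m, b)) :
    S.OPTj p i j m b ≤
      S.OPT p (i - 1) s'.1 s'.2 + ((S.len i j * tailWeight p s'.1 : ℝ) : EReal) :=
  iInf₂_le (f := fun s' (_ : S.Step n i j s' (m, b)) =>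
    S.OPT p (i - 1) s'.1 s'.2 + ((S.len i j * tailWeight p s'.1 : ℝ) : EReal)) s' h

theorem OPT_succ {n : ℕ} (p : Fin n → ℝ) (hS : S.Proper) {i m b : ℕ}
    (hV : S.Valid n (i + 1) (m, b)) :
    S.OPT p (i + 1) m b = ⨅ j ∈ Finset.Icc 1 (S.Δ (i + 1)), S.OPTj p (i + 1) j m b := by
  refine le_antisymm ?_ (le_OPT p hS fun δ h => ?_)
  · refine le_iInf₂ fun j hj => le_iInf₂ fun s' hs => ?_
    rw [Finset.mem_Icc] at hj
    rw [Nat.add_sub_cancel] at *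
    by_cases ht : S.OPT p i s'.1 s'.2 = ⊤
    · rw [ht, EReal.top_add_coe]
      exact le_top
    · obtain ⟨δ, hδ, he⟩ := OPT_attained p hS ht
      rw [he, ← EReal.coe_add, ← costVec_ind, ← costVec_add]
      exact OPT_le p hS (hδ.step j (m, b) hj.1 hj.2 hV hs.2.2.1 hs.2.2.2)
  · obtain ⟨-, j, s', δ', h1, h2, h', hle, heq, rfl⟩ := path_succ_iff.1 h
    refine (iInf₂_le j (Finset.mem_Icc.2 ⟨h1, h2⟩)).trans ?_
    refine (OPTj_le p (s' := s') ⟨h'.val, hV, hle, heq⟩).trans ?_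
    rw [costVec_add, costVec_ind, EReal.coe_add]
    exact add_le_add_left (OPT_le p hS h') _

/-- On the diagonal `m + b = d ≤ n` with `b` positive the validity conditions hold automatically,
and `b'` alone determines the predecessor. -/
theorem step_batch_iff {n i j d b : ℕ} (hρ : 1 ≤ S.arity i j) (hd : d ≤ n) (hb : 1 ≤ b)
    (hbd : b ≤ d) {s' : ℕ × ℕ} :
    S.Step n i j s' (d - b, b) ↔ s'.1 = d - s'.2 * S.arity i j ∧ s'.2 * S.arity i j ≤ d ∧
      b ≤ s'.2 * S.arity i j := by
  constructor
  · rintro ⟨-, -, h1, h2⟩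
    simp only at h1 h2
    omega
  · rintro ⟨h1, h2, h3⟩
    have h4 : s'.2 ≤ s'.2 * S.arity i j := Nat.le_mul_of_pos_right _ hρ
    have h5 : 0 < s'.2 := by
      rcases Nat.eq_zero_or_pos s'.2 with h0 | h0
      · rw [h0] at h3
        omega
      · exact h0
    refine ⟨Or.inl ⟨h5, by omega⟩, Or.inl ⟨hb, ?_⟩, h3, ?_⟩
    · simp only
      omega
    · simp only
      omega

theorem OPTj_batch {n : ℕ} (p : Fin n → ℝ) {i j d b : ℕ} (hρ : 1 ≤ S.arity i j) (hd : d ≤ n)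
    (hb : 1 ≤ b) (hbd : b ≤ d) :
    S.OPTj p i j (d - b) b = ⨅ (b' : ℕ) (_ : b' ≤ d / S.arity i j ∧ b ≤ b' * S.arity i j),
      S.gam p i j d b' := by
  refine le_antisymm (le_iInf₂ fun b' h => ?_) (le_iInf₂ fun s' hs => ?_)
  · rw [Nat.le_div_iff_mul_le hρ] at h
    exact OPTj_le p (s' := (d - b' * S.arity i j, b'))
      ((step_batch_iff hρ hd hb hbd).2 ⟨rfl, h.1, h.2⟩)
  · obtain ⟨h1, h2, h3⟩ := (step_batch_iff hρ hd hb hbd).1 hs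
    refine (iInf₂_le s'.2 ⟨(Nat.le_div_iff_mul_le hρ).2 h2, h3⟩).trans ?_
    rw [gam, ← h1]

/-- By `OPTj_batch` each entry is a minimum of `gam` over the range `b ≤ b' * ρ ≤ d`. The ranges for
`b` and `b + 1` differ at most by `b' = b / ρ`, and only if `ρ` divides `b`. -/
theorem OPTj_batch_recurrence {n : ℕ} (p : Fin n → ℝ) {i j d b : ℕ} (hρ : 1 ≤ S.arity i j)
    (hd : d ≤ n) (hb : 1 ≤ b) (hbd : b ≤ d) :
    (S.arity i j * (d / S.arity i j) < b → S.OPTj p i j (d - b) b = ⊤) ∧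
    (b = S.arity i j * (d / S.arity i j) →
      S.OPTj p i j (d - b) b = S.gam p i j d (d / S.arity i j)) ∧
    (b < S.arity i j * (d / S.arity i j) → ¬ S.arity i j ∣ b →
      S.OPTj p i j (d - b) b = S.OPTj p i j (d - b - 1) (b + 1)) ∧
    (b < S.arity i j * (d / S.arity i j) → S.arity i j ∣ b →
      S.OPTj p i j (d - b) b =
        min (S.OPTj p i j (d - b - 1) (b + 1)) (S.gam p i j d (b / S.arity i j))) := by
  set ρ := S.arity i j with hρdef
  have hdiv : ρ * (d / ρ) ≤ d := Nat.mul_div_le d ρ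
  refine ⟨fun h => ?_, fun h => ?_, fun h hndvd => ?_, fun h hdvd => ?_⟩
  · rw [OPTj_batch p hρ hd hb hbd]
    refine top_le_iff.1 (le_iInf₂ fun b' h' => ?_)
    have : b' * ρ ≤ ρ * (d / ρ) := by
      rw [mul_comm]
      exact Nat.mul_le_mul_left _ h'.1
    have := h'.2
    rw [← hρdef] at this
    omega
  · rw [OPTj_batch p hρ hd hb hbd]
    refine le_antisymm (iInf₂_le _ ⟨le_rfl, by rw [mul_comm]; exact h.le⟩) (le_iInf₂ fun b' h' => ?_)
    have : d / ρ ≤ b' := by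
      have h1 := h'.2
      rw [h, mul_comm] at h1
      exact Nat.le_of_mul_le_mul_right h1 hρ
    rw [le_antisymm h'.1 this]
  · rw [Nat.sub_sub, OPTj_batch p hρ hd hb hbd, OPTj_batch p hρ hd (by omega) (by omega)]
    refine iInf_congr fun b' => iInf_congr_Prop ?_ fun _ => rfl
    refine and_congr_right fun _ => ⟨fun h' => ?_, fun h' => by omega⟩
    rcases h'.eq_or_lt with e | e
    · exact (hndvd ⟨b', by rw [mul_comm]; exact e⟩).elim
    · exact e
  · rw [Nat.sub_sub, OPTj_batch p hρ hd hb hbd, OPTj_batch p hρ hd (by omega) (by omega)]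
    obtain ⟨c, rfl⟩ := hdvd
    rw [Nat.mul_div_cancel_left _ hρ]
    have hc : c < d / ρ := lt_of_mul_lt_mul_left' h
    refine le_antisymm (le_min (le_iInf₂ fun b' h' => iInf₂_le b' ⟨h'.1, by omega⟩)
      (iInf₂_le c ⟨hc.le, by rw [mul_comm]⟩)) (le_iInf₂ fun b' h' => ?_)
    rcases h'.2.eq_or_lt with e | e
    · rw [mul_comm b'] at e
      rw [← Nat.eq_of_mul_eq_mul_left hρ e]
      exact min_le_right _ _
    · exact (min_le_left _ _).trans (iInf₂_le b' ⟨h'.1, e⟩)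

theorem dynamicProgram {n : ℕ} (hn : 2 ≤ n) (p : Fin n → ℝ) (hS : S.Proper) :
    (∀ i m b, S.OPT p i m b ≠ ⊤ → ∃ x ∈ S.partialCosts p i m b, S.OPT p i m b = (x : EReal)) ∧
    (∀ i m b, 0 < b → m + b ≤ n → S.partialCosts p i m b = S.allPartialCosts p i m b) ∧
    S.OPT p 0 0 1 = 0 ∧
    (∀ m b, (m, b) ≠ (0, 1) → S.OPT p 0 m b = ⊤) ∧
    (∀ i, 1 ≤ i → ∀ m b, S.Valid n i (m, b) →
      S.OPT p i m b = ⨅ j ∈ Finset.Icc 1 (S.Δ i), S.OPTj p i j m b) ∧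
    (∀ i, 1 ≤ i → ∀ j, 1 ≤ j → j ≤ S.Δ i → ∀ d, d ≤ n → ∀ b, 1 ≤ b → b ≤ d →
      (S.arity i j * (d / S.arity i j) < b → S.OPTj p i j (d - b) b = ⊤) ∧
      (b = S.arity i j * (d / S.arity i j) →
        S.OPTj p i j (d - b) b = S.gam p i j d (d / S.arity i j)) ∧
      (b < S.arity i j * (d / S.arity i j) → ¬ S.arity i j ∣ b →
        S.OPTj p i j (d - b) b = S.OPTj p i j (d - b - 1) (b + 1)) ∧
      (b < S.arity i j * (d / S.arity i j) → S.arity i j ∣ b →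
        S.OPTj p i j (d - b) b =
          min (S.OPTj p i j (d - b - 1) (b + 1)) (S.gam p i j d (b / S.arity i j)))) := by
  refine ⟨fun i m b h => ?_, fun i m b => allPartialCosts_eq p hS, OPT_zero hn p hS,
    fun m b => OPT_zero_of_ne hn p hS, fun i hi m b hV => ?_,
    fun i _ j h1 h2 d hd b hb hbd => OPTj_batch_recurrence p (hS i j h1 h2).1 hd hb hbd⟩
  · obtain ⟨δ, hδ, he⟩ := OPT_attained p hS h
    exact ⟨_, (mem_partialCosts p hS).2 ⟨δ, hδ, rfl⟩, he⟩
  · obtain ⟨i, rfl⟩ : ∃ k, i = k + 1 := ⟨i - 1, by omega⟩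
    exact OPT_succ p hS hV

end LevelChoices

/-! ### From trees to codes -/

/-- The digits of `a < r ^ t` to the base `r`, with leading zeros. -/
def digitWord (r t a : ℕ) : List (Fin r) :=
  if h : a < r ^ t then List.ofFn (finFunctionFinEquiv.symm ⟨a, h⟩) else []

theorem length_digitWord {r t a : ℕ} (h : a < r ^ t) : (digitWord r t a).length = t := by
  simp [digitWord, h]

theorem digitWord_injective {r t a b : ℕ} (ha : a < r ^ t) (hb : b < r ^ t)
    (h : digitWord r t a = digitWord r t b) : a = b := by
  rw [digitWord, dif_pos ha, digitWord, dif_pos hb] at h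
  have := finFunctionFinEquiv.symm.injective (List.ofFn_injective h)
  simpa using this

/-- The letters of the word are below `R k`, `R (k + 1)`, …. -/
def LettersBelow (R : ℕ → ℕ) : ℕ → List ℕ → Prop
  | _, [] => True
  | k, a :: w => a < R k ∧ LettersBelow R (k + 1) w

theorem lettersBelow_append {R : ℕ → ℕ} {k a : ℕ} {w : List ℕ} :
    LettersBelow R k (w ++ [a]) ↔ LettersBelow R k w ∧ a < R (k + w.length) := by
  induction w generalizing k with
  | nil => simp [LettersBelow]
  | cons c w ih =>
    simp only [List.cons_append, LettersBelow, ih, List.length_cons, and_assoc]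
    rw [show k + (w.length + 1) = k + 1 + w.length by ring]

/-- Replace each letter of a word by its digits, `t k` of them for the letter in position `k`. -/
def digitCode (r : ℕ) (t : ℕ → ℕ) : ℕ → List ℕ → List (Fin r)
  | _, [] => []
  | k, a :: w => digitWord r (t k) a ++ digitCode r t (k + 1) w

theorem length_digitCode {r : ℕ} {t : ℕ → ℕ} {k : ℕ} {w : List ℕ}
    (h : LettersBelow (fun k => r ^ t k) k w) :
    (digitCode r t k w).length = ∑ l ∈ Finset.range w.length, t (k + l) := by
  induction w generalizing k with
  | nil => simp [digitCode]
  | cons a w ih =>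
    rw [digitCode, List.length_append, length_digitWord h.1, ih h.2, List.length_cons,
      Finset.sum_range_succ', add_comm]
    simp only [add_zero]
    congr 1
    exact Finset.sum_congr rfl fun l _ => by rw [show k + 1 + l = k + (l + 1) by ring]

/-- Letters in the same position are replaced by blocks of the same length, so the prefix relation
can be read off block by block. -/
theorem prefix_of_digitCode {r : ℕ} {t : ℕ → ℕ} {k : ℕ} {v w : List ℕ}
    (hv : LettersBelow (fun k => r ^ t k) k v) (hw : LettersBelow (fun k => r ^ t k) k w)
    (hl : v.length ≤ w.length) (h : digitCode r t k v <+: digitCode r t k w) : v <+: w := by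
  induction v generalizing k w with
  | nil => exact ⟨_, List.nil_append _⟩
  | cons a v ih =>
    cases w with
    | nil => simp at hl
    | cons c w =>
      obtain ⟨u, hu⟩ := h
      simp only [digitCode, List.append_assoc] at hu
      obtain ⟨h1, h2⟩ := List.append_inj hu (by rw [length_digitWord hv.1, length_digitWord hw.1])
      obtain rfl := digitWord_injective hv.1 hw.1 h1
      rw [List.prefix_cons_inj]
      exact ih hv.2 hw.2 (by simpa using hl) ⟨u, h2⟩

namespace GTree

theorem prefix_mem (T : GTree) {u w : List ℕ} (h : u <+: w) (hw : w ∈ T.nodes) : u ∈ T.nodes := by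
  obtain ⟨x, rfl⟩ := h
  induction x using List.reverseRecOn with
  | nil => simpa using hw
  | append_singleton x a ih =>
    rw [← List.append_assoc] at hw
    exact ih (T.closed _ _ hw)

theorem eq_of_prefix_of_mem_leaves {T : GTree} {u w : List ℕ} (hu : u ∈ T.leaves)
    (hw : w ∈ T.leaves) (h : u <+: w) : u = w := by
  obtain ⟨x, rfl⟩ := h
  cases x with
  | nil => simp
  | cons a x =>
    rw [mem_leaves] at hu hw
    refine (hu.2 ⟨hu.1, Or.inr ⟨a, ?_⟩⟩).elim
    exact T.prefix_mem ⟨x, by simp⟩ hw.1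

theorem Satisfies.lettersBelow {T : GTree} {R : ℕ → ℕ} (hS : T.Satisfies R) {w : List ℕ}
    (hw : w ∈ T.nodes) : LettersBelow R 1 w := by
  induction w using List.reverseRecOn with
  | nil => trivial
  | append_singleton w a ih =>
    rw [lettersBelow_append, add_comm]
    exact ⟨ih (T.closed _ _ hw), hS _ _ hw⟩

end GTree

theorem levelDepth_reserved (r n : ℕ) (J : ℕ → ℕ) (i : ℕ) :
    levelDepth ((reservedChoices r n).C J) i =
      ((∑ l ∈ Finset.range i, (J (1 + l) - 1) : ℕ) : ℝ) := by
  induction i with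
  | zero => simp [levelDepth]
  | succ i ih =>
    rw [levelDepth_succ, ih, Finset.sum_range_succ, Nat.cast_add, add_comm 1 i]
    rfl

/-- The length of a digit code depends only on the level of the leaf, and the root is not among the
leaves because there are at least two of them. This leaves `g` levels and so at most `g` lengths. -/
theorem exists_code_of_tree {r n g : ℕ} (hn : 2 ≤ n) {J : ℕ → ℕ} {T : GTree} (hL : T.IsLevelTree g)
    (hS : T.Satisfies ((reservedChoices r n).R J)) {v : Fin n → List ℕ}
    (hv : Function.Injective v) (hvT : ∀ t, v t ∈ T.leaves) :
    ∃ w : Fin n → List (Fin r), PrefixFree w ∧ AtMostLengths g w ∧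
      ∀ t, ((w t).length : ℝ) = levelDepth ((reservedChoices r n).C J) (v t).length := by
  have hB : ∀ t, LettersBelow (fun k => r ^ (J k - 1)) 1 (v t) := fun t =>
    hS.lettersBelow (GTree.mem_leaves.1 (hvT t)).1
  have hlen : ∀ t, (digitCode r (fun k => J k - 1) 1 (v t)).length =
      ∑ l ∈ Finset.range (v t).length, (J (1 + l) - 1) := fun t => length_digitCode (hB t)
  refine ⟨fun t => digitCode r (fun k => J k - 1) 1 (v t), ?_, ?_, fun t => ?_⟩
  · intro i j hij h
    rcases le_total (v i).length (v j).length with hl | hl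
    · exact hij (hv (GTree.eq_of_prefix_of_mem_leaves (hvT i) (hvT j)
        (prefix_of_digitCode (hB i) (hB j) hl h)))
    -- The code of `v j` is at most as long as that of `v i`, so the prefix relation is an equality
    -- and the roles can be exchanged.
    · have h1 : (digitCode r (fun k => J k - 1) 1 (v j)).length ≤
          (digitCode r (fun k => J k - 1) 1 (v i)).length := by
        rw [hlen, hlen]
        exact Finset.sum_le_sum_of_subset (Finset.range_subset_range.2 hl)
      have h2 := h.eq_of_length_le h1
      exact hij (hv (GTree.eq_of_prefix_of_mem_leaves (hvT j) (hvT i)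
        (prefix_of_digitCode (hB j) (hB i) hl ⟨[], by simpa using h2.symm⟩)).symm)
  · have hsub : (Finset.univ.image fun t => (digitCode r (fun k => J k - 1) 1 (v t)).length) ⊆
        (Finset.Icc 1 g).image fun i => ∑ l ∈ Finset.range i, (J (1 + l) - 1) := by
      intro x hx
      obtain ⟨t, -, rfl⟩ := Finset.mem_image.1 hx
      refine Finset.mem_image.2 ⟨(v t).length, Finset.mem_Icc.2 ⟨?_, ?_⟩, (hlen t).symm⟩
      · by_contra h0
        have h0 : v t = [] := by
          rw [← List.length_eq_zero_iff]
          omega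
        have : Nontrivial (Fin n) := Fin.nontrivial_iff_two_le.2 hn
        obtain ⟨s, hs⟩ := exists_ne t
        refine hs (hv (GTree.eq_of_prefix_of_mem_leaves (hvT t) (hvT s) ?_).symm)
        rw [h0]
        exact ⟨_, List.nil_append _⟩
      · exact hL.1 _ (GTree.mem_leaves.1 (hvT t)).1
    refine (Finset.card_le_card hsub).trans (Finset.card_image_le.trans ?_)
    simp
  · rw [levelDepth_reserved, hlen]

theorem treeCosts_subset {r n g : ℕ} (hn : 2 ≤ n) (p : Fin n → ℝ) :
    (reservedChoices r n).treeCosts g p ⊆ codeCosts r g p := by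
  rintro x ⟨J, -, T, hL, -, hS, v, hv, rfl⟩
  obtain ⟨w, h1, h2, h3⟩ := exists_code_of_tree hn hL hS hv.1 fun t => (hv.2 _).2 ⟨t, rfl⟩
  refine ⟨w, h1, h2, Finset.sum_congr rfl fun t _ => ?_⟩
  rw [h3, mul_comm]

/-! ### From full trees to trees with exactly `n` leaves -/

/-- A full tree may have more than `n` leaves. The prefixes of `n` selected leaves form a subtree
with exactly these leaves; fullness is lost, but the bounds on the numbers of children survive. -/
theorem exists_tree_isLabelling {n i : ℕ} (hn : 1 ≤ n) {R : ℕ → ℕ} {T : GTree}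
    (hL : T.IsLevelTree i) (hS : T.Satisfies R) {v : Fin n → List ℕ} (hv : Function.Injective v)
    (hvT : ∀ t, v t ∈ T.leaves) :
    ∃ T' : GTree, T'.IsLevelTree i ∧ T'.marked = ∅ ∧ T'.Satisfies R ∧ T'.IsLabelling v := by
  classical
  have hmem : ∀ u, u ∈ (Finset.univ.biUnion fun t => (v t).inits.toFinset) ↔ ∃ t, u <+: v t := by
    simp
  have hsub : ∀ u, (∃ t, u <+: v t) → u ∈ T.nodes := by
    rintro u ⟨t, h⟩
    exact T.prefix_mem h (GTree.mem_leaves.1 (hvT t)).1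
  let T' : GTree :=
    { nodes := Finset.univ.biUnion fun t => (v t).inits.toFinset
      root_mem := (hmem _).2 ⟨⟨0, hn⟩, ⟨_, List.nil_append _⟩⟩
      closed := fun w a h => by
        obtain ⟨t, ht⟩ := (hmem _).1 h
        exact (hmem _).2 ⟨t, (List.prefix_append w [a]).trans ht⟩
      marked := ∅
      marked_sub := Finset.empty_subset _ }
  have hmem' : ∀ u, u ∈ T'.nodes ↔ ∃ t, u <+: v t := hmem
  refine ⟨T', ⟨fun w hw => hL.1 w (hsub w ((hmem' w).1 hw)), by simp [T']⟩, rfl,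
    fun w a h => hS w a (hsub _ ((hmem' _).1 h)), hv, fun w => ?_⟩
  rw [GTree.mem_leaves]
  constructor
  · rintro ⟨h1, h2⟩
    obtain ⟨t, x, hx⟩ := (hmem' w).1 h1
    cases x with
    | nil => exact ⟨t, by simpa using hx.symm⟩
    | cons a x => exact (h2 ⟨h1, Or.inr ⟨a, (hmem' _).2 ⟨t, x, by simpa using hx⟩⟩⟩).elim
  · rintro ⟨t, rfl⟩
    refine ⟨(hmem' _).2 ⟨t, List.prefix_refl _⟩, ?_⟩
    rintro ⟨-, h | ⟨a, h⟩⟩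
    · simp [T'] at h
    · have h' := hsub _ ((hmem' _).1 h)
      exact (GTree.mem_leaves.1 (hvT t)).2 ⟨(GTree.mem_leaves.1 (hvT t)).1, Or.inr ⟨a, h'⟩⟩

namespace LevelChoices

theorem Path.exists_leaves {S : LevelChoices} (hS : S.Proper) {Val : ℕ → ℕ × ℕ → Prop} {n i m b : ℕ}
    {δ : ℕ → ℝ} (h : S.Path Val i (m, b) δ) (hm : n ≤ m) :
    ∃ J, S.Permissible i J ∧ ∃ T : GTree, T.IsLevelTree i ∧ T.Satisfies (S.R J) ∧
      ∃ v : Fin n → List ℕ, Function.Injective v ∧ (∀ t, v t ∈ T.leaves) ∧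
        ∀ t : Fin n, δ t = levelDepth (S.C J) (v t).length := by
  obtain ⟨J, hJ, T, hL, hSa, -, hs, -, rfl⟩ := h.exists_tree hS
  obtain ⟨v, hv⟩ := GTree.exists_isTopDown (T := T) (m := m) (by rw [GTree.card_leaves hL, hs])
  refine ⟨J, hJ, T, hL, hSa, fun t => v (Fin.castLE hm t),
    hv.1.1.comp (Fin.castLE_injective hm), fun t => (hv.1.2 _).2 ⟨_, rfl⟩, fun t => ?_⟩
  rw [← hv.sigVec_eq hL]
  rfl

theorem Path.mem_treeCosts {S : LevelChoices} (hS : S.Proper) {Val : ℕ → ℕ × ℕ → Prop}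
    {n i m b : ℕ} (hn : 1 ≤ n) (p : Fin n → ℝ) {δ : ℕ → ℝ} (h : S.Path Val i (m, b) δ)
    (hm : n ≤ m) : costVec p δ ∈ S.treeCosts i p := by
  obtain ⟨J, hJ, T, hL, hSa, v, hv, hvT, hδ⟩ := h.exists_leaves hS hm
  obtain ⟨T', h1, h2, h3, h4⟩ := exists_tree_isLabelling hn hL hSa hv hvT
  refine ⟨J, hJ, T', h1, h2, h3, v, h4, Finset.sum_congr rfl fun t _ => ?_⟩
  rw [hδ, mul_comm]

end LevelChoices

theorem proper_reservedChoices {r n : ℕ} (hr : 2 ≤ r) : (reservedChoices r n).Proper :=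
  fun _ j _ _ => ⟨Nat.one_le_pow _ _ (by omega), Nat.cast_nonneg (j - 1)⟩

theorem exists_code_of_path {r n g m b : ℕ} (hr : 2 ≤ r) (hn : 2 ≤ n)
    {Val : ℕ → ℕ × ℕ → Prop} {δ : ℕ → ℝ} (h : (reservedChoices r n).Path Val g (m, b) δ)
    (hm : n ≤ m) :
    ∃ w : Fin n → List (Fin r), PrefixFree w ∧ AtMostLengths g w ∧
      ∀ t : Fin n, ((w t).length : ℝ) = δ t := by
  obtain ⟨J, -, T, hL, hSa, v, hv, hvT, hδ⟩ := h.exists_leaves (proper_reservedChoices hr) hm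
  obtain ⟨w, h1, h2, h3⟩ := exists_code_of_tree hn hL hSa hv hvT
  exact ⟨w, h1, h2, fun t => by rw [h3, hδ]⟩

/-! ### Tail weights -/

theorem tailWeight_nonneg {n : ℕ} {p : Fin n → ℝ} (hp : ∀ t, 0 ≤ p t) (m : ℕ) :
    0 ≤ tailWeight p m :=
  Finset.sum_nonneg fun q _ => by split_ifs; exacts [hp q, le_rfl]

theorem tailWeight_antitone {n : ℕ} {p : Fin n → ℝ} (hp : ∀ t, 0 ≤ p t) :
    Antitone (tailWeight p) := by
  intro a b h
  refine Finset.sum_le_sum fun q _ => ?_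
  split_ifs with h1 h2
  exacts [le_rfl, absurd (h.trans h1) h2, hp q, le_rfl]

/-- Exchange argument: the tail `B` and the set `A` have equally many elements outside each other,
those of `B` weigh at most `p m` each and those of `A` at least `p m` each. -/
theorem tailWeight_le_sum {n : ℕ} {p : Fin n → ℝ} (ha : Antitone p) (hp : ∀ t, 0 ≤ p t)
    {m : ℕ} {A : Finset (Fin n)} (hA : A.card + m = n) : tailWeight p m ≤ ∑ q ∈ A, p q := by
  classical
  rcases Nat.lt_or_ge m n with hm | hm
  · set B := Finset.Ici (⟨m, hm⟩ : Fin n) with hB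
    have hcard : B.card = A.card := by
      rw [hB, Fin.card_Ici]
      simp only
      omega
    have h1 : tailWeight p m = ∑ q ∈ B, p q := by
      rw [tailWeight, ← Finset.sum_filter]
      refine Finset.sum_congr ?_ fun _ _ => rfl
      ext q
      simp [hB, Fin.le_def]
    have h2 : (B \ A).card = (A \ B).card := by
      have := Finset.card_sdiff_add_card_inter B A
      have := Finset.card_sdiff_add_card_inter A B
      rw [Finset.inter_comm] at this
      omega
    rw [h1, ← Finset.sum_inter_add_sum_sdiff B A, ← Finset.sum_inter_add_sum_sdiff A B,
      Finset.inter_comm A B]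
    refine add_le_add le_rfl ?_
    calc ∑ q ∈ B \ A, p q ≤ (B \ A).card • p ⟨m, hm⟩ := by
          refine Finset.sum_le_card_nsmul _ _ _ fun q hq => ha ?_
          exact Finset.mem_Ici.1 (Finset.mem_sdiff.1 hq).1
      _ = (A \ B).card • p ⟨m, hm⟩ := by rw [h2]
      _ ≤ ∑ q ∈ A \ B, p q := by
          refine Finset.card_nsmul_le_sum _ _ _ fun q hq => ha ?_
          have := (Finset.mem_sdiff.1 hq).2
          rw [hB, Finset.mem_Ici, not_le] at this
          exact this.le
  · have : tailWeight p m = 0 := Finset.sum_eq_zero fun q _ => if_neg (by omega)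
    rw [this]
    exact Finset.sum_nonneg fun q _ => hp q

/-! ### From codes to paths of signatures -/

/-- The values are listed in increasing order after a leading `0`. Repetitions are allowed, so fewer
than `g` values cause no trouble. -/
theorem exists_levels_of_lengths (g : ℕ) (s : Finset ℕ) (hs : s.card ≤ g) :
    ∃ l : ℕ → ℕ, l 0 = 0 ∧ Monotone l ∧ ∀ x ∈ s, ∃ k ≤ g, l k = x := by
  induction g generalizing s with
  | zero =>
    obtain rfl : s = ∅ := by simpa using hs
    exact ⟨fun _ => 0, rfl, monotone_const, by simp⟩
  | succ g ih =>
    rcases s.eq_empty_or_nonempty with rfl | hne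
    · exact ⟨fun _ => 0, rfl, monotone_const, by simp⟩
    set x := s.max' hne with hx
    have hxs : x ∈ s := s.max'_mem hne
    obtain ⟨l, h0, hm, hl⟩ := ih (s.erase x) (by rw [Finset.card_erase_of_mem hxs]; omega)
    -- The sequence from the induction need not stay below the maximum, hence the truncation by `x`;
    -- the other values are at most `x` and are still attained.
    refine ⟨fun k => if k ≤ g then min (l k) x else x, by simp [h0], ?_, ?_⟩
    · intro a b hab
      simp only
      split_ifs with h1 h2
      · exact min_le_min_right _ (hm hab)
      · exact min_le_right _ _
      · omega
      · exact le_rfl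
    · intro y hy
      rcases eq_or_ne y x with rfl | hyx
      · exact ⟨g + 1, le_rfl, by simp⟩
      · obtain ⟨k, hk, rfl⟩ := hl y (Finset.mem_erase.2 ⟨hyx, hy⟩)
        exact ⟨k, by omega, by simp [hk, hx, Finset.le_max' s _ hy]⟩

theorem valid_reserved_zero_iff {r n i m : ℕ} :
    (reservedChoices r n).Valid n i (m, 0) ↔
      ∃ t ≤ Nat.log r n + 1, max n (r ^ t) ≤ m ∧ m ≤ n + r ^ t - 1 := by
  constructor
  · rintro (h | ⟨-, j, h1, h2, h3, h4⟩)
    · exact absurd h.1 (by simp)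
    · have h2 : j ≤ 2 + Nat.log r n := h2
      exact ⟨j - 1, by omega, h3, h4⟩
  · rintro ⟨t, h1, h2, h3⟩
    refine Or.inr ⟨rfl, t + 1, by omega, ?_, ?_, ?_⟩
    · change t + 1 ≤ 2 + Nat.log r n
      omega
    · exact h2
    · exact h3

/-- The depth vector does not depend on which nodes of the last level are leaves, so some internal
nodes there can be made leaves for free. At least one has to remain internal for the signature to
stay valid. -/
theorem path_split {S : LevelChoices} {n i m b c : ℕ} {δ : ℕ → ℝ}
    (h : S.Path (S.Valid n) i (m, b) δ) (hn : m + b ≤ n) (hc : 1 ≤ c) (hcb : c ≤ b) :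
    S.Path (S.Valid n) i (m + b - c, c) δ := by
  cases i with
  | zero =>
    obtain ⟨-, h1 | h1, -⟩ := LevelChoices.path_zero_iff.1 h
    · rw [Prod.mk.injEq] at h1
      obtain ⟨rfl, rfl⟩ := h1
      obtain rfl : c = 1 := by omega
      exact h
    · rw [Prod.mk.injEq] at h1
      omega
  | succ i =>
    rw [LevelChoices.path_succ_iff] at h ⊢
    obtain ⟨-, j, s', δ', h1, h2, h, hle, heq, rfl⟩ := h
    simp only at hle heq
    refine ⟨Or.inl ⟨hc, ?_⟩, j, s', δ', h1, h2, h, hcb.trans hle, ?_, rfl⟩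
    · simp only
      omega
    · simp only
      omega

/-- A path through valid signatures that does not cost more than a tree with `M k` leaves on levels
up to `k` and `B k` internal nodes on level `k`. -/
theorem exists_path_le {r n g : ℕ} (hr : 2 ≤ r) (hn : 2 ≤ n) {p : Fin n → ℝ} (hp : ∀ t, 0 ≤ p t)
    {M B t : ℕ → ℕ} (ht : ∀ k, t k ≤ Nat.log r n + 1) (hM : Monotone M) (hM0 : M 0 = 0)
    (hB0 : B 0 ≤ 1) (hB : ∀ k, M k < n → 1 ≤ B k)
    (hMB : ∀ k, M (k + 1) + B (k + 1) ≤ M k + B k * r ^ t k) (hg : n ≤ M g) :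
    ∃ m δ, (reservedChoices r n).Path ((reservedChoices r n).Valid n) g (m, 0) δ ∧
      costVec p δ ≤ ∑ k ∈ Finset.range g, (t k : ℝ) * tailWeight p (M k) := by
  set S := reservedChoices r n with hS
  -- Either the path has already ended in a final signature, or it has exactly `M k` leaves and at
  -- least `B k` internal nodes. Surplus nodes are always kept internal.
  have key : ∀ k, (∃ m δ, S.Path (S.Valid n) k (m, 0) δ ∧
      costVec p δ ≤ ∑ k ∈ Finset.range k, (t k : ℝ) * tailWeight p (M k)) ∨
      (∃ b δ, S.Path (S.Valid n) k (M k, b) δ ∧ M k + b < n ∧ B k ≤ b ∧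
        costVec p δ ≤ ∑ k ∈ Finset.range k, (t k : ℝ) * tailWeight p (M k)) := by
    intro k
    induction k with
    | zero =>
      right
      refine ⟨1, 0, ?_, by omega, hB0, by simp [costVec_zero]⟩
      rw [hM0]
      exact .root (Or.inl ⟨by simp, by simp; omega⟩)
    | succ k ih =>
      rw [Finset.sum_range_succ]
      have hj : t k + 1 ≤ S.Δ (k + 1) := by
        have := ht k
        change t k + 1 ≤ 2 + Nat.log r n
        omega
      have harity : S.arity (k + 1) (t k + 1) = r ^ t k := rfl
      have hlen : S.len (k + 1) (t k + 1) = (t k : ℝ) := rfl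
      rcases ih with ⟨m, δ, h, hc⟩ | ⟨b, δ, h, hmb, hb, hc⟩
      · left
        -- A path that has ended is continued by choice `1`, with arity `r ^ 0 = 1` and edge length
        -- `0`; without internal nodes nothing changes.
        refine ⟨m, _, h.step 1 (m, 0) le_rfl ?_ ?_ (by simp) (by simp), ?_⟩
        · change 1 ≤ 2 + Nat.log r n
          omega
        · exact valid_reserved_zero_iff.2 (valid_reserved_zero_iff.1 h.val)
        · have h0 : S.len (k + 1) 1 = 0 := Nat.cast_zero
          rw [costVec_add, costVec_ind, h0, zero_mul, add_zero]
          have := mul_nonneg (Nat.cast_nonneg (α := ℝ) (t k)) (tailWeight_nonneg hp (M k))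
          linarith
      · have hρ : 1 ≤ r ^ t k := Nat.one_le_pow _ _ (by omega)
        rcases Nat.lt_or_ge (M k + b * r ^ t k) n with hd | hd
        · right
          have h1 := hMB k
          have h2 : B k * r ^ t k ≤ b * r ^ t k := Nat.mul_le_mul_right _ hb
          have h3 := hB (k + 1) (by omega)
          have h4 := hM (Nat.le_succ k)
          rw [Nat.succ_eq_add_one] at h4
          refine ⟨M k + b * r ^ t k - M (k + 1), _,
            h.step (t k + 1) _ (by omega) hj (Or.inl ⟨?_, ?_⟩) ?_ ?_, by omega, by omega, ?_⟩
          · simp only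
            omega
          · simp only
            omega
          · simp only [harity]
            omega
          · simp only [harity]
            omega
          · rw [costVec_add, costVec_ind, hlen]
            linarith
        · left
          -- The next expansion can reach `n` leaves. Before it, as many internal nodes as possible
          -- are made leaves; `c` is the least number of nodes that must stay internal. Its
          -- minimality yields the upper bound `n + r ^ t k - 1` on a final signature.
          have hex : ∃ x, n ≤ M k + b - x + x * r ^ t k := ⟨b, by omega⟩
          set c := Nat.find hex with hcdef
          have hc1 : n ≤ M k + b - c + c * r ^ t k := Nat.find_spec hex
          have hcb : c ≤ b := Nat.find_min' hex (by omega)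
          have hc0 : 1 ≤ c := by
            by_contra h0
            have h0 : c = 0 := by omega
            rw [h0] at hc1
            omega
          have hc2 := Nat.find_min hex (m := c - 1) (by omega)
          have hc3 : (c - 1) * r ^ t k + r ^ t k = c * r ^ t k := by
            rw [← Nat.succ_mul]
            congr 1
            omega
          have hc4 : r ^ t k ≤ c * r ^ t k := Nat.le_mul_of_pos_left _ hc0
          refine ⟨M k + b - c + c * r ^ t k, _, (path_split h hmb.le hc0 hcb).step (t k + 1) _
            (by omega) hj ?_ (Nat.zero_le _) rfl, ?_⟩
          · refine valid_reserved_zero_iff.2 ⟨t k, ht k, max_le hc1 (by omega), by omega⟩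
          · rw [costVec_add, costVec_ind, hlen]
            -- The extra leaves on level `k` only lower the tail weight that the next edges are
            -- charged for.
            have := mul_le_mul_of_nonneg_left
              (tailWeight_antitone hp (show M k ≤ M k + b - c by omega))
              (Nat.cast_nonneg (α := ℝ) (t k))
            simp only
            linarith
  rcases key g with h | ⟨b, δ, -, h, -⟩
  · exact h
  · omega

/-! ### Counting the nodes of a code tree. -/

/-- All words of length `d`. -/
def wordsOfLength (r d : ℕ) : Finset (List (Fin r)) :=
  Finset.univ.image (List.ofFn : (Fin d → Fin r) → List (Fin r))

theorem card_wordsOfLength_le (r d : ℕ) : (wordsOfLength r d).card ≤ r ^ d :=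
  Finset.card_image_le.trans (by simp)

theorem mem_wordsOfLength {r d : ℕ} {w : List (Fin r)} (h : w.length = d) :
    w ∈ wordsOfLength r d := by
  subst h
  exact Finset.mem_image.2 ⟨w.get, Finset.mem_univ _, List.ofFn_get w⟩

/-- The nodes on level `l` of the code tree that are proper prefixes of codewords. -/
def properPrefixes {r n : ℕ} (w : Fin n → List (Fin r)) (l : ℕ) : Finset (List (Fin r)) :=
  (Finset.univ.filter fun q => l < (w q).length).image fun q => (w q).take l

/-- No codeword length lies strictly between `l` and `l'`. By prefix-freeness the codewords of
length `l'` that are longer than `l` and the proper prefixes of length `l'` are distinct words, each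
of which continues a proper prefix of length `l` by `l' - l` letters. -/
theorem card_properPrefixes_step {r n : ℕ} {w : Fin n → List (Fin r)} (hw : PrefixFree w)
    {l l' : ℕ} (hl : l ≤ l') (hgap : ∀ q, l < (w q).length → l' ≤ (w q).length) :
    (Finset.univ.filter fun q => (w q).length ≤ l').card + (properPrefixes w l').card ≤
      (Finset.univ.filter fun q => (w q).length ≤ l).card +
        (properPrefixes w l).card * r ^ (l' - l) := by
  classical
  set A := Finset.univ.filter fun q => l < (w q).length ∧ (w q).length ≤ l' with hA
  have hAl : ∀ q ∈ A, (w q).length = l' := fun q hq => by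
    rw [hA, Finset.mem_filter] at hq
    exact le_antisymm hq.2.2 (hgap q hq.2.1)
  have h1 : (Finset.univ.filter fun q => (w q).length ≤ l').card =
      (Finset.univ.filter fun q => (w q).length ≤ l).card + A.card := by
    rw [← Finset.card_union_of_disjoint]
    · congr 1
      ext q
      simp only [hA, Finset.mem_filter, Finset.mem_univ, true_and, Finset.mem_union]
      omega
    · rw [Finset.disjoint_left]
      intro q h1 h2
      simp only [hA, Finset.mem_filter, Finset.mem_univ, true_and] at h1 h2
      omega
  have h2 : (A.image w).card = A.card := by
    refine Finset.card_image_of_injective _ fun x y hxy => ?_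
    by_contra hne
    exact hw x y hne (by rw [hxy])
  have h3 : Disjoint (A.image w) (properPrefixes w l') := by
    rw [Finset.disjoint_left]
    intro u hu hu'
    obtain ⟨x, hx, rfl⟩ := Finset.mem_image.1 hu
    obtain ⟨y, hy, he⟩ := Finset.mem_image.1 hu'
    rw [Finset.mem_filter] at hy
    refine hw x y ?_ ?_
    · rintro rfl
      have := hAl x hx
      omega
    · rw [← he]
      exact ⟨_, List.take_append_drop _ _⟩
  have h4 : A.image w ∪ properPrefixes w l' ⊆
      (properPrefixes w l ×ˢ wordsOfLength r (l' - l)).image fun x => x.1 ++ x.2 := by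
    have hq : ∀ q, l < (w q).length → (w q).take l' ∈
        (properPrefixes w l ×ˢ wordsOfLength r (l' - l)).image fun x => x.1 ++ x.2 := by
      intro q hq
      refine Finset.mem_image.2 ⟨((w q).take l, ((w q).take l').drop l), ?_, ?_⟩
      · refine Finset.mem_product.2 ⟨?_, mem_wordsOfLength ?_⟩
        · exact Finset.mem_image.2 ⟨q, Finset.mem_filter.2 ⟨Finset.mem_univ _, hq⟩, rfl⟩
        · have := hgap q hq
          simp
          omega
      · have : (w q).take l = ((w q).take l').take l := by
          rw [List.take_take, min_eq_left hl]
        simp only [this]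
        exact List.take_append_drop _ _
    intro u hu
    rcases Finset.mem_union.1 hu with hu | hu
    · obtain ⟨x, hx, rfl⟩ := Finset.mem_image.1 hu
      have := hq x (Finset.mem_filter.1 hx).2.1
      rwa [List.take_of_length_le (hAl x hx).le] at this
    · obtain ⟨y, hy, rfl⟩ := Finset.mem_image.1 hu
      exact hq y (hl.trans_lt (Finset.mem_filter.1 hy).2)
  have h5 := Finset.card_le_card h4
  rw [Finset.card_union_of_disjoint h3, h2] at h5
  have h6 := h5.trans (Finset.card_image_le.trans
    ((Finset.card_product _ _).le.trans (Nat.mul_le_mul_left _ (card_wordsOfLength_le r (l' - l)))))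
  omega

/-- The levels are the codeword lengths. A gap above `⌊log_r n⌋ + 1` is shortened to that value: the
arity then still exceeds `n`, so the counting inequality survives and the cost can only drop. -/
theorem exists_path_of_code {r n g : ℕ} (hr : 2 ≤ r) (hn : 2 ≤ n) {p : Fin n → ℝ}
    (ha : Antitone p) (hp : ∀ t, 0 ≤ p t) {w : Fin n → List (Fin r)} (hw : PrefixFree w)
    (hwg : AtMostLengths g w) :
    ∃ m δ, (reservedChoices r n).Path ((reservedChoices r n).Valid n) g (m, 0) δ ∧
      costVec p δ ≤ codeCost p w := by
  classical
  obtain ⟨l, hl0, hlm, hl⟩ := exists_levels_of_lengths g _ hwg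
  have hl : ∀ q, ∃ k ≤ g, l k = (w q).length := fun q =>
    hl _ (Finset.mem_image_of_mem _ (Finset.mem_univ q))
  have hgap : ∀ k q, l k < (w q).length → l (k + 1) ≤ (w q).length := by
    intro k q h
    obtain ⟨j, -, hj⟩ := hl q
    rw [← hj] at h ⊢
    exact hlm (hlm.reflect_lt h)
  have hpos : ∀ q, 0 < (w q).length := by
    intro q
    by_contra h0
    have h0 : w q = [] := by
      rw [← List.length_eq_zero_iff]
      omega
    have : Nontrivial (Fin n) := Fin.nontrivial_iff_two_le.2 hn
    obtain ⟨s, hs⟩ := exists_ne q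
    exact hw q s hs.symm (by rw [h0]; exact ⟨_, List.nil_append _⟩)
  set M : ℕ → ℕ := fun k => (Finset.univ.filter fun q => (w q).length ≤ l k).card with hMdef
  set B : ℕ → ℕ := fun k => (properPrefixes w (l k)).card with hBdef
  set t : ℕ → ℕ := fun k => min (l (k + 1) - l k) (Nat.log r n + 1) with htdef
  have hcompl : ∀ k, (Finset.univ.filter fun q => l k < (w q).length).card + M k = n := by
    intro k
    have h := Finset.card_filter_add_card_filter_not (s := (Finset.univ : Finset (Fin n)))
      (fun q => l k < (w q).length)
    simp only [not_lt, Finset.card_univ, Fintype.card_fin] at h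
    exact h
  have hMB : ∀ k, M k + B k ≤ n := fun k => by
    have h1 : B k ≤ _ := Finset.card_image_le
    have := hcompl k
    omega
  have hB : ∀ k, M k < n → 1 ≤ B k := by
    intro k hk
    have h1 := hcompl k
    have h2 : 0 < (Finset.univ.filter fun q => l k < (w q).length).card := by omega
    exact Finset.card_pos.2 ((Finset.card_pos.1 h2).image _)
  have hM : Monotone M := by
    intro a b hab
    refine Finset.card_le_card fun q hq => ?_
    rw [Finset.mem_filter] at hq ⊢
    exact ⟨hq.1, hq.2.trans (hlm hab)⟩
  have hM0 : M 0 = 0 := by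
    rw [hMdef]
    simp only [hl0, Finset.card_eq_zero, Finset.filter_eq_empty_iff]
    intro q _ h
    have := hpos q
    omega
  have hB0 : B 0 ≤ 1 := by
    have : properPrefixes w (l 0) ⊆ {[]} := by
      intro u hu
      obtain ⟨q, -, rfl⟩ := Finset.mem_image.1 hu
      simp [hl0]
    simpa using Finset.card_le_card this
  have hMB' : ∀ k, M (k + 1) + B (k + 1) ≤ M k + B k * r ^ t k := by
    intro k
    rcases le_total (l (k + 1) - l k) (Nat.log r n + 1) with h | h
    · have e : t k = l (k + 1) - l k := min_eq_left h
      rw [e]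
      exact card_properPrefixes_step hw (hlm (Nat.le_succ k)) (hgap k)
    · have e : t k = Nat.log r n + 1 := min_eq_right h
      have h1 : n < r ^ t k := by
        rw [e]
        exact Nat.lt_pow_succ_log_self (by omega) n
      rcases Nat.lt_or_ge (M k) n with hk | hk
      · have h2 := Nat.mul_le_mul_right (r ^ t k) (hB k hk)
        have := hMB (k + 1)
        omega
      · have := hMB (k + 1)
        omega
  have hMg : n ≤ M g := by
    have : (Finset.univ.filter fun q => (w q).length ≤ l g) = Finset.univ := by
      refine Finset.filter_true_of_mem fun q _ => ?_
      obtain ⟨k, hk, he⟩ := hl q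
      rw [← he]
      exact hlm hk
    rw [hMdef]
    simp [this]
  obtain ⟨m, δ, h, hc⟩ := exists_path_le (M := M) (B := B) (t := t) (g := g) hr hn hp
    (fun k => min_le_right _ _) hM hM0 hB0 hB hMB' hMg
  refine ⟨m, δ, h, hc.trans ?_⟩
  -- The codewords longer than `l k` belong to `n - M k` items, whose weight is at least that of the
  -- lightest `n - M k` items.
  have h1 : ∀ k, tailWeight p (M k) ≤ ∑ q, if l k < (w q).length then p q else 0 := fun k => by
    rw [← Finset.sum_filter]
    exact tailWeight_le_sum ha hp (hcompl k)
  -- The true gaps above a codeword telescope to its length, and the capped ones are not larger.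
  have h2 : ∀ q K, ∑ k ∈ Finset.range K, (if l k < (w q).length then t k else 0) ≤
      min (l K) (w q).length := by
    intro q K
    induction K with
    | zero => simp
    | succ K ih =>
      rw [Finset.sum_range_succ]
      have h3 : t K ≤ l (K + 1) - l K := min_le_left _ _
      have h4 := hlm (Nat.le_succ K)
      have h5 := hgap K q
      rw [Nat.succ_eq_add_one] at h4
      split_ifs with h
      · have := h5 h
        omega
      · omega
  calc ∑ k ∈ Finset.range g, (t k : ℝ) * tailWeight p (M k)
      ≤ ∑ k ∈ Finset.range g, (t k : ℝ) * ∑ q, if l k < (w q).length then p q else 0 :=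
        Finset.sum_le_sum fun k _ => mul_le_mul_of_nonneg_left (h1 k) (Nat.cast_nonneg _)
    _ = ∑ q, p q * ((∑ k ∈ Finset.range g, if l k < (w q).length then t k else 0 : ℕ) : ℝ) := by
        simp only [Finset.mul_sum, Nat.cast_sum]
        rw [Finset.sum_comm]
        refine Finset.sum_congr rfl fun q _ => Finset.sum_congr rfl fun k _ => ?_
        split_ifs
        · ring
        · simp
    _ ≤ codeCost p w := by
        refine Finset.sum_le_sum fun q _ => mul_le_mul_of_nonneg_left ?_ (hp q)
        exact_mod_cast (h2 q g).trans (min_le_right _ _)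

/-! ### The reduction -/

/-- A block code of length `⌊log_r n⌋ + 1` has enough words and uses a single length. -/
theorem codeCosts_nonempty {r n g : ℕ} (hr : 2 ≤ r) (hg : 1 ≤ g) (p : Fin n → ℝ) :
    (codeCosts r g p).Nonempty := by
  have hlt : n ≤ r ^ (Nat.log r n + 1) := (Nat.lt_pow_succ_log_self (by omega) n).le
  set w : Fin n → List (Fin r) := fun q => digitWord r (Nat.log r n + 1) q with hw
  have hlen : ∀ q, (w q).length = Nat.log r n + 1 := fun q =>
    length_digitWord (q.2.trans_le hlt)
  refine ⟨_, w, ?_, ?_, rfl⟩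
  · intro i j hij h
    have h1 := h.eq_of_length (by rw [hlen, hlen])
    exact hij (Fin.ext (digitWord_injective (i.2.trans_le hlt) (j.2.trans_le hlt) h1))
  · rw [AtMostLengths]
    refine le_trans (Finset.card_le_card (t := {Nat.log r n + 1}) fun x hx => ?_) (by simpa)
    obtain ⟨q, -, rfl⟩ := Finset.mem_image.1 hx
    simp [hlen]

theorem le_of_path_zero {r n i m : ℕ} {δ : ℕ → ℝ}
    (h : (reservedChoices r n).Path ((reservedChoices r n).Valid n) i (m, 0) δ) : n ≤ m := by
  obtain ⟨t, -, h1, -⟩ := valid_reserved_zero_iff.1 h.val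
  exact (le_max_left _ _).trans h1

/-- The upper bound on final signatures leaves finitely many `m`, each with finitely many paths. -/
theorem exists_best_path {r n g : ℕ} (hr : 2 ≤ r) (hn : 2 ≤ n) (hg : 1 ≤ g) {p : Fin n → ℝ}
    (ha : Antitone p) (hp : ∀ t, 0 ≤ p t) :
    ∃ m δ, (reservedChoices r n).Path ((reservedChoices r n).Valid n) g (m, 0) δ ∧
      ∀ m' δ', (reservedChoices r n).Path ((reservedChoices r n).Valid n) g (m', 0) δ' →
        costVec p δ ≤ costVec p δ' := by
  set S := reservedChoices r n with hS
  obtain ⟨_, w, h1, h2, -⟩ := codeCosts_nonempty (n := n) hr hg p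
  obtain ⟨m₀, δ₀, h₀, -⟩ := exists_path_of_code hr hn ha hp h1 h2
  have hfin : {x : ℕ × (ℕ → ℝ) | S.Path (S.Valid n) g (x.1, 0) x.2}.Finite := by
    have hf : (⋃ m ∈ Finset.range (n + r ^ (Nat.log r n + 1)),
        (fun δ => (m, δ)) '' {δ | S.Path (S.Valid n) g (m, 0) δ}).Finite :=
      Set.Finite.biUnion (Finset.finite_toSet _) fun m _ =>
        (LevelChoices.path_finite (proper_reservedChoices hr) _ _ _).image _
    refine hf.subset ?_
    rintro ⟨m, δ⟩ h
    obtain ⟨t, ht, -, h3⟩ := valid_reserved_zero_iff.1 (LevelChoices.Path.val h)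
    have h4 : r ^ t ≤ r ^ (Nat.log r n + 1) := Nat.pow_le_pow_right (by omega) ht
    have h5 : 1 ≤ r ^ t := Nat.one_le_pow _ _ (by omega)
    simp only [Set.mem_iUnion]
    exact ⟨m, Finset.mem_range.2 (by omega), δ, h, rfl⟩
  obtain ⟨⟨m, δ⟩, h, hmin⟩ := Set.exists_min_image _ (fun x => costVec p x.2) hfin ⟨(m₀, δ₀), h₀⟩
  exact ⟨m, δ, h, fun m' δ' h' => hmin (m', δ') h'⟩

theorem isLeast_codeCosts {r n g : ℕ} (hr : 2 ≤ r) (hn : 2 ≤ n) {p : Fin n → ℝ}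
    (ha : Antitone p) (hp : ∀ t, 0 ≤ p t) {m : ℕ} {δ : ℕ → ℝ}
    (h : (reservedChoices r n).Path ((reservedChoices r n).Valid n) g (m, 0) δ)
    (hmin : ∀ m' δ', (reservedChoices r n).Path ((reservedChoices r n).Valid n) g (m', 0) δ' →
      costVec p δ ≤ costVec p δ') :
    IsLeast (codeCosts r g p) (costVec p δ) := by
  refine ⟨treeCosts_subset hn p
    (h.mem_treeCosts (proper_reservedChoices hr) (by omega) p (le_of_path_zero h)), ?_⟩
  rintro _ ⟨w, h1, h2, rfl⟩
  obtain ⟨m', δ', h', hc⟩ := exists_path_of_code hr hn ha hp h1 h2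
  exact (hmin m' δ' h').trans hc

theorem reduction {r n g : ℕ} (hr : 2 ≤ r) (hn : 2 ≤ n) (hg : 1 ≤ g) {p : Fin n → ℝ}
    (ha : Antitone p) (hp : ∀ t, 0 ≤ p t) :
    (reservedChoices r n).treeCosts g p ⊆ codeCosts r g p ∧
    (∀ x ∈ codeCosts r g p, ∃ y ∈ (reservedChoices r n).treeCosts g p, y ≤ x) ∧
    ∃ x : ℝ, IsLeast (codeCosts r g p) x ∧ IsLeast ((reservedChoices r n).treeCosts g p) x ∧
      (⨅ (m : ℕ) (_ : (reservedChoices r n).Valid n g (m, 0)),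
        (reservedChoices r n).OPT p g m 0) = (x : EReal) := by
  have hS := proper_reservedChoices (n := n) hr
  refine ⟨treeCosts_subset hn p, ?_, ?_⟩
  · rintro _ ⟨w, h1, h2, rfl⟩
    obtain ⟨m, δ, h, hc⟩ := exists_path_of_code hr hn ha hp h1 h2
    exact ⟨_, h.mem_treeCosts hS (by omega) p (le_of_path_zero h), hc⟩
  · obtain ⟨m, δ, h, hmin⟩ := exists_best_path hr hn hg ha hp
    have hl := isLeast_codeCosts hr hn ha hp h hmin
    refine ⟨costVec p δ, hl, ⟨h.mem_treeCosts hS (by omega) p (le_of_path_zero h), ?_⟩, ?_⟩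
    · exact fun y hy => hl.2 (treeCosts_subset hn p hy)
    · refine le_antisymm ((iInf₂_le m h.val).trans (LevelChoices.OPT_le p hS h)) ?_
      exact le_iInf₂ fun x _ => LevelChoices.le_OPT p hS fun δ' hδ =>
        EReal.coe_le_coe_iff.2 (hmin x δ' hδ)

/-! ### Reasoning about programs -/

/-- The instruction assigns to the natural variable `x`. -/
def Instr.writesNVar : Instr → ℕ → Bool
  | .nconst x _, y => x == y
  | .nmove x _, y => x == y
  | .nadd x _ _, y => x == y
  | .nsub x _ _, y => x == y
  | .nload x _ _, y => x == y
  | _, _ => false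

/-- The instruction assigns to the real variable `u`. -/
def Instr.writesRVar : Instr → ℕ → Bool
  | .rzero u, v => u == v
  | .rmove u _, v => u == v
  | .radd u _ _, v => u == v
  | .rsub u _ _, v => u == v
  | .rload u _ _, v => u == v
  | _, _ => false

/-- The instruction stores into the natural array `a`. -/
def Instr.writesNArr : Instr → ℕ → Bool
  | .nstore a _ _, c => a == c
  | _, _ => false

/-- The instruction stores into the real array `a`. -/
def Instr.writesRArr : Instr → ℕ → Bool
  | .rstore a _ _, c => a == c
  | _, _ => false

/-- Some instruction of the program satisfies `f`. -/
def Prog.anyInstr (f : Instr → Bool) : Prog → Bool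
  | .skip => false
  | .instr a => f a
  | .seq P Q => P.anyInstr f || Q.anyInstr f
  | .cond _ P Q => P.anyInstr f || Q.anyInstr f
  | .loop _ P => P.anyInstr f

/-- What `P` does not write to is the same in `s'` as in `s`. -/
structure Frame (P : Prog) (s s' : Store) : Prop where
  nvar : ∀ x, P.anyInstr (fun a => a.writesNVar x) = false → s'.nvar x = s.nvar x
  rvar : ∀ x, P.anyInstr (fun a => a.writesRVar x) = false → s'.rvar x = s.rvar x
  narr : ∀ x, P.anyInstr (fun a => a.writesNArr x) = false → s'.narr x = s.narr x
  rarr : ∀ x, P.anyInstr (fun a => a.writesRArr x) = false → s'.rarr x = s.rarr x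

theorem Frame.refl (P : Prog) (s : Store) : Frame P s s :=
  ⟨fun _ _ => rfl, fun _ _ => rfl, fun _ _ => rfl, fun _ _ => rfl⟩

theorem Frame.trans {P : Prog} {s s' s'' : Store} (h : Frame P s s') (h' : Frame P s' s'') :
    Frame P s s'' :=
  ⟨fun x hx => (h'.nvar x hx).trans (h.nvar x hx), fun x hx => (h'.rvar x hx).trans (h.rvar x hx),
    fun x hx => (h'.narr x hx).trans (h.narr x hx), fun x hx => (h'.rarr x hx).trans (h.rarr x hx)⟩

theorem Frame.mono {P Q : Prog} {s s' : Store} (h : Frame P s s')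
    (hPQ : ∀ f, Q.anyInstr f = false → P.anyInstr f = false) : Frame Q s s' :=
  ⟨fun x hx => h.nvar x (hPQ _ hx), fun x hx => h.rvar x (hPQ _ hx),
    fun x hx => h.narr x (hPQ _ hx), fun x hx => h.rarr x (hPQ _ hx)⟩

theorem Frame.instr (a : Instr) (s : Store) : Frame (.instr a) s (a.run s) := by
  constructor <;> intro x hx <;> cases a <;>
    simp_all [Prog.anyInstr, Instr.writesNVar, Instr.writesRVar, Instr.writesNArr,
      Instr.writesRArr, Instr.run, Function.update_of_ne, Ne.symm]

/-- What a program may write is computed from its text. For concrete programs and registers,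
preservation is then settled by `rfl`, and postconditions only mention what has changed. -/
theorem Exec.frame {P : Prog} {s s' : Store} {t : ℕ} (h : Exec P s s' t) : Frame P s s' := by
  induction h with
  | skip s => exact Frame.refl _ _
  | instr a s => exact Frame.instr a s
  | seq _ _ ih1 ih2 =>
    refine Frame.trans (ih1.mono fun f hf => ?_) (ih2.mono fun f hf => ?_) <;>
      simp_all [Prog.anyInstr]
  | cond_true _ _ ih => exact ih.mono fun f hf => by simp_all [Prog.anyInstr]
  | cond_false _ _ ih => exact ih.mono fun f hf => by simp_all [Prog.anyInstr]
  | loop_true _ _ _ ih1 ih2 => exact Frame.trans (ih1.mono fun f hf => by simpa [Prog.anyInstr] using hf) ih2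
  | loop_false _ => exact Frame.refl _ _

/-- Started in `s`, the program `P` halts after at most `T` steps in a store that satisfies `Q`. -/
def Runs (P : Prog) (s : Store) (T : ℕ) (Q : Store → Prop) : Prop :=
  ∃ s' t, Exec P s s' t ∧ t ≤ T ∧ Q s'

namespace Runs

variable {P P' : Prog} {b : Test} {s : Store} {T T' : ℕ} {Q Q' : Store → Prop}

theorem mono (h : Runs P s T Q) (hT : T ≤ T') (hQ : ∀ s', Frame P s s' → Q s' → Q' s') :
    Runs P s T' Q' := by
  obtain ⟨s', t, h1, h2, h3⟩ := h
  exact ⟨s', t, h1, h2.trans hT, hQ s' h1.frame h3⟩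

theorem skip (h : Q s) : Runs .skip s 0 Q := ⟨s, 0, .skip s, le_rfl, h⟩

theorem instr {a : Instr} (h : Q (a.run s)) : Runs (.instr a) s 1 Q := ⟨_, 1, .instr a s, le_rfl, h⟩

theorem seq (h : Runs P s T Q) (h' : ∀ s', Frame P s s' → Q s' → Runs P' s' T' Q') :
    Runs (.seq P P') s (T + T') Q' := by
  obtain ⟨s', t, h1, h2, h3⟩ := h
  obtain ⟨s'', t', h4, h5, h6⟩ := h' s' h1.frame h3
  exact ⟨s'', _, .seq h1 h4, by omega, h6⟩

theorem cond (h : b.holds s → Runs P s T Q) (h' : ¬ b.holds s → Runs P' s T Q) :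
    Runs (.cond b P P') s (T + 1) Q := by
  by_cases hb : b.holds s
  · obtain ⟨s', t, h1, h2, h3⟩ := h hb
    exact ⟨s', _, .cond_true hb h1, by omega, h3⟩
  · obtain ⟨s', t, h1, h2, h3⟩ := h' hb
    exact ⟨s', _, .cond_false hb h1, by omega, h3⟩

/-- The invariant is indexed by the number of completed rounds, which gives termination and time
together: `N` rounds of one test and one body, and a last failing test. -/
theorem loop (I : ℕ → Store → Prop) (N : ℕ) (h0 : I 0 s)
    (hstep : ∀ k < N, ∀ s', Frame (.loop b P) s s' → I k s' → b.holds s' ∧ Runs P s' T (I (k + 1)))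
    (hend : ∀ s', Frame (.loop b P) s s' → I N s' → ¬ b.holds s') : Runs (.loop b P) s (N * (T + 1) + 1) (I N) := by
  induction N generalizing s I with
  | zero => exact ⟨s, 1, .loop_false (hend s (Frame.refl _ _) h0), by omega, h0⟩
  | succ N ih =>
    obtain ⟨hb, s₁, t₁, h1, h2, h3⟩ := hstep 0 (by omega) s (Frame.refl _ _) h0
    have hf : Frame (.loop b P) s s₁ := h1.frame.mono fun f hf => by
      simpa [Prog.anyInstr] using hf
    obtain ⟨s₂, t₂, h4, h5, h6⟩ := ih (fun k => I (k + 1)) h3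
      (fun k hk s' hs' => hstep (k + 1) (by omega) s' (hf.trans hs'))
      fun s' hs' => hend s' (hf.trans hs')
    refine ⟨s₂, _, .loop_true hb h1 h4, ?_, h6⟩
    have : (N + 1) * (T + 1) = N * (T + 1) + (T + 1) := by ring
    omega

end Runs

/-- A sequence of instructions. -/
def Prog.block : List Instr → Prog
  | [] => .skip
  | a :: l => .seq (.instr a) (Prog.block l)

theorem Runs.block {l : List Instr} {s : Store} {Q : Store → Prop}
    (h : Q (l.foldl (fun s a => a.run s) s)) : Runs (Prog.block l) s l.length Q := by
  induction l generalizing s with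
  | nil => exact Runs.skip h
  | cons a l ih =>
    rw [List.length_cons, add_comm]
    exact Runs.seq (Q := fun s' => s' = a.run s) (Runs.instr rfl) fun s' _ hst => ih (by rwa [hst])

/-! ### Multiplication by repeated addition -/

/-- Assign to `z` the product of `x` and `y`.  The variable `3` has to hold `1`. -/
def mulProg (z x y : ℕ) : Prog :=
  .seq (.block [.nconst z 0, .nconst 90 0])
    (.loop (.nlt 90 y) (.block [.nadd z z x, .nadd 90 90 3]))

/-- The time is linear in the second factor alone. The program always puts a number of at most `n +
1` there, which keeps `r` out of the running time. -/
theorem runs_mulProg {z x y : ℕ} {s : Store} (h1 : s.nvar 3 = 1) (hz : z ≠ 90) (hx : x ≠ 90)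
    (hy : y ≠ 90) (hzx : z ≠ x) (hzy : z ≠ y) (hz3 : z ≠ 3) :
    Runs (mulProg z x y) s (3 * s.nvar y + 3) fun s' => s'.nvar z = s.nvar x * s.nvar y := by
  refine (Runs.seq (Q := fun s' => s'.nvar z = 0 ∧ s'.nvar 90 = 0 ∧ s'.nvar x = s.nvar x ∧
    s'.nvar y = s.nvar y ∧ s'.nvar 3 = 1) (Runs.block ?_) fun s₁ _ h => Runs.mono
    (Runs.loop (T := 2) (fun k s' => s'.nvar z = s.nvar x * k ∧ s'.nvar 90 = k ∧
      s'.nvar x = s.nvar x ∧ s'.nvar y = s.nvar y ∧ s'.nvar 3 = 1) (s.nvar y) ?_ ?_ ?_) le_rfl ?_).mono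
      ?_ fun _ _ h => h
  · simp [Instr.run, hz, hx, hy, hzx.symm, hzy.symm, hz3.symm, h1]
  · simpa using h
  · rintro k hk s' - ⟨h2, h3, h4, h5, h6⟩
    refine ⟨by simpa [Test.holds, h3, h5] using hk, Runs.block ?_⟩
    simp [Instr.run, hz, hx, hy, hzx.symm, hzy.symm, hz3.symm, h2, h3, h4,
      h5, h6, hz.symm]
    ring
  · rintro s' - ⟨-, h3, -, h5, -⟩
    simp [Test.holds, h3, h5]
  · exact fun s' _ h => h.1
  · simp
    omega

/-! ### The sets of depth vectors that the algorithm minimizes over -/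

/-- `(x, 0)` is a valid signature. -/
def Final (r n x : ℕ) : Prop :=
  (n ≤ x ∧ x < n + r ^ Nat.log r n) ∨
    (r ^ (Nat.log r n + 1) ≤ x ∧ x < r ^ (Nat.log r n + 1) + n)

theorem lt_pow_log_succ {r : ℕ} (hr : 2 ≤ r) (n : ℕ) : n < r ^ (Nat.log r n + 1) :=
  Nat.lt_pow_succ_log_self (by omega) n

theorem pow_log_le {r n : ℕ} (hn : 2 ≤ n) : r ^ Nat.log r n ≤ n :=
  Nat.pow_log_le_self r (by omega)

theorem pow_log_succ_le {r n : ℕ} (hn : 2 ≤ n) : r ^ (Nat.log r n + 1) ≤ n * r := by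
  rw [pow_succ]
  exact Nat.mul_le_mul_right _ (pow_log_le hn)

/-- For `t ≤ ⌊log_r n⌋` the power `r ^ t` is at most `n`, and the admissible intervals are nested in
the one for the largest such `t`; the remaining exponent gives the second interval. So there are at
most `2 * n` final signatures, although their values may be of order `n * r`. -/
theorem valid_zero_iff_final {r n i x : ℕ} (hr : 2 ≤ r) (hn : 2 ≤ n) :
    (reservedChoices r n).Valid n i (x, 0) ↔ Final r n x := by
  rw [valid_reserved_zero_iff]
  constructor
  · rintro ⟨t, ht, h1, h2⟩
    have h0 : 1 ≤ r ^ t := Nat.one_le_pow _ _ (by omega)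
    rcases ht.eq_or_lt with rfl | ht
    · right
      have h3 := (le_max_right _ _).trans h1
      omega
    · left
      have h3 : r ^ t ≤ r ^ Nat.log r n := Nat.pow_le_pow_right (by omega) (by omega)
      have h4 := (le_max_left _ _).trans h1
      omega
  · rintro (⟨h1, h2⟩ | ⟨h1, h2⟩)
    · exact ⟨Nat.log r n, by omega, max_le h1 ((pow_log_le hn).trans h1), by omega⟩
    · exact ⟨Nat.log r n + 1, le_rfl, max_le ((lt_pow_log_succ hr n).le.trans h1) h1, by omega⟩

theorem Final.le {r n x : ℕ} (hr : 2 ≤ r) (h : Final r n x) : n ≤ x := by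
  rcases h with h | h
  · exact h.1
  · exact (lt_pow_log_succ hr n).le.trans h.1

theorem Final.lt {r n x : ℕ} (hr : 2 ≤ r) (hn : 2 ≤ n) (h : Final r n x) : x < n * (r + 1) := by
  have h1 := pow_log_le (r := r) hn
  have h2 := pow_log_succ_le (r := r) hn
  have h3 : n * 2 ≤ n * r := Nat.mul_le_mul_left _ hr
  rw [mul_add, mul_one]
  rcases h with h | h <;> omega

/-- The validity of a signature on a level below the root. -/
def ValidSig (r n x y : ℕ) : Prop := (1 ≤ y ∧ x + y ≤ n) ∨ (y = 0 ∧ Final r n x)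

theorem validSig_iff {r n i x y : ℕ} (hr : 2 ≤ r) (hn : 2 ≤ n) :
    (reservedChoices r n).Valid n i (x, y) ↔ ValidSig r n x y := by
  rcases Nat.eq_zero_or_pos y with rfl | hy
  · rw [valid_zero_iff_final hr hn]
    simp [ValidSig]
  · simp only [LevelChoices.Valid, ValidSig]
    constructor
    · rintro (h | h)
      · exact Or.inl h
      · omega
    · rintro (h | h)
      · exact Or.inl h
      · omega

theorem ValidSig.lt {r n x y : ℕ} (hr : 2 ≤ r) (hn : 2 ≤ n) (h : ValidSig r n x y) :
    x < n * (r + 1) ∧ y ≤ n := by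
  rcases h with h | h
  · rw [mul_add, mul_one]
    omega
  · exact ⟨h.2.lt hr hn, by omega⟩

/-- The depth vectors for the signature `(x, y)` on a level.  A tree without internal nodes on its
last level is extended by edges of length `0` only. -/
def reach (r n : ℕ) : ℕ → ℕ → ℕ → Set (ℕ → ℝ)
  | 0, x, y => {δ | x = 0 ∧ y = 1 ∧ δ = 0}
  | i + 1, x, y => {δ | ValidSig r n x y ∧ ∃ t ≤ Nat.log r n + 1, ∃ m b, ∃ δ' ∈ reach r n i m b,
      y ≤ b * r ^ t ∧ x + y = m + b * r ^ t ∧ (b = 0 → t = 0) ∧ δ = δ' + ind t m}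

theorem validSig_of_mem_reach {r n i x y : ℕ} (hn : 2 ≤ n) {δ : ℕ → ℝ} (h : δ ∈ reach r n i x y) :
    ValidSig r n x y := by
  cases i with
  | zero =>
    obtain ⟨rfl, rfl, -⟩ := h
    exact Or.inl ⟨le_rfl, by omega⟩
  | succ i => exact h.1

theorem path_of_mem_reach {r n i x y : ℕ} (hr : 2 ≤ r) (hn : 2 ≤ n) {δ : ℕ → ℝ}
    (h : δ ∈ reach r n i x y) :
    (reservedChoices r n).Path ((reservedChoices r n).Valid n) i (x, y) δ := by
  induction i generalizing x y δ with
  | zero =>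
    have hV := (validSig_iff (i := 0) hr hn).2 (validSig_of_mem_reach hn h)
    obtain ⟨rfl, rfl, rfl⟩ := h
    exact .root hV
  | succ i ih =>
    obtain ⟨hV, t, ht, m, b, δ', hδ', h1, h2, -, rfl⟩ := h
    refine (ih hδ').step (t + 1) (x, y) (by omega) ?_ ((validSig_iff hr hn).2 hV) h1 h2
    change t + 1 ≤ 2 + Nat.log r n
    omega

/-- Without internal nodes a path may still use positive edge lengths, while `reach` allows only
`0`. These edges lie below at least `n` leaves, so the vectors differ only at indices from `n` on,
which no cost sees. -/
theorem exists_mem_reach {r n i x y : ℕ} (hr : 2 ≤ r) (hn : 2 ≤ n) {δ : ℕ → ℝ}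
    (h : (reservedChoices r n).Path ((reservedChoices r n).Valid n) i (x, y) δ) :
    ∃ δ' ∈ reach r n i x y, ∀ q < n, δ' q = δ q := by
  induction i generalizing x y δ with
  | zero =>
    obtain ⟨hV, hs, rfl⟩ := LevelChoices.path_zero_iff.1 h
    refine ⟨0, ?_, fun _ _ => rfl⟩
    rcases hs with h1 | h1
    · rw [Prod.mk.injEq] at h1
      exact ⟨h1.1, h1.2, rfl⟩
    · rw [h1] at hV
      exact (LevelChoices.not_valid_one_zero hn 0 hV).elim
  | succ i ih =>
    obtain ⟨hV, j, ⟨m, b⟩, δ', h1, h2, h', hle, heq, rfl⟩ := LevelChoices.path_succ_iff.1 h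
    obtain ⟨δ'', hδ'', he⟩ := ih h'
    rw [validSig_iff hr hn] at hV
    have h2 : j ≤ 2 + Nat.log r n := h2
    rcases Nat.eq_zero_or_pos b with rfl | hb
    · simp only [zero_mul, nonpos_iff_eq_zero, add_zero] at hle heq
      subst hle
      refine ⟨_, ⟨hV, 0, by omega, m, 0, δ'', hδ'', by simp, by simpa using heq, fun _ => rfl, rfl⟩,
        fun q hq => ?_⟩
      have hm : n ≤ m := ((valid_zero_iff_final hr hn).1 h'.val).le hr
      have hm' : ¬ m ≤ q := by omega
      simp [ind, he q hq, hm']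
    · refine ⟨_, ⟨hV, j - 1, by omega, m, b, δ'', hδ'', hle, heq, by omega, rfl⟩, fun q hq => ?_⟩
      simp only [Pi.add_apply, he q hq]
      rfl

/-- The depth vectors that arise from those for `(m, b)` on a level when all children, `r ^ t` of
each of the internal nodes, are made internal or all of them are made leaves. -/
def pushSet (r n i m t b x y : ℕ) : Set (ℕ → ℝ) :=
  {δ | ∃ δ' ∈ reach r n i m b, δ = δ' + ind t m ∧
    ((x = m ∧ y = b * r ^ t ∧ x + y ≤ n) ∨ (x = m + b * r ^ t ∧ y = 0 ∧ Final r n x))}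

/-- The depth vectors that arise without turning some, but not all nodes on a level into leaves. -/
def pushedSet (r n i x y : ℕ) : Set (ℕ → ℝ) :=
  {δ | (y = 0 ∧ Final r n x ∧ δ ∈ reach r n i x 0) ∨
    ∃ m < n, ∃ t ≤ Nat.log r n + 1, ∃ b, 1 ≤ b ∧ m + b ≤ n ∧ δ ∈ pushSet r n i m t b x y}

theorem ind_zero (m : ℕ) : ind ((0 : ℕ) : ℝ) m = 0 := by
  funext q
  simp [ind]

/-- With no internal node left, either all children have become leaves or there were no internal
nodes before. Both cases are covered by pushing, so no sweep is needed for `y = 0`. -/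
theorem reach_succ_zero {r n i x : ℕ} (hr : 2 ≤ r) (hn : 2 ≤ n) :
    reach r n (i + 1) x 0 = pushedSet r n i x 0 := by
  ext δ
  constructor
  · rintro ⟨hV, t, ht, m, b, δ', hδ', h1, h2, h3, rfl⟩
    have hF : Final r n x := by
      rcases hV with hV | hV
      · omega
      · exact hV.2
    rcases Nat.eq_zero_or_pos b with rfl | hb
    · left
      obtain rfl := h3 rfl
      obtain rfl : x = m := by simpa using h2
      refine ⟨rfl, hF, ?_⟩
      rwa [ind_zero, add_zero]
    · right
      have hV' := validSig_of_mem_reach hn hδ'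
      rcases hV' with hV' | hV'
      · exact ⟨m, by omega, t, ht, b, hb, hV'.2, δ', hδ', rfl, Or.inr ⟨by omega, rfl, hF⟩⟩
      · omega
  · rintro (⟨-, hF, h⟩ | ⟨m, hm, t, ht, b, hb, hmb, δ', hδ', rfl, h | h⟩)
    · refine ⟨Or.inr ⟨rfl, hF⟩, 0, by omega, x, 0, δ, h, by simp, by simp, by simp, ?_⟩
      rw [ind_zero, add_zero]
    · have h1 : 1 ≤ b * r ^ t := Nat.mul_pos hb (Nat.pow_pos (by omega))
      omega
    · exact ⟨Or.inr ⟨rfl, h.2.2⟩, t, ht, m, b, δ', hδ', by omega, by omega, by omega, rfl⟩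

theorem reach_succ_of_lt {r n i x y : ℕ} (hy : 1 ≤ y) (h : n < x + y) :
    reach r n (i + 1) x y = ∅ := by
  refine Set.eq_empty_iff_forall_notMem.2 fun δ hδ => ?_
  rcases hδ.1 with h' | h'
  · omega
  · omega

theorem pushedSet_of_lt {r n i x y : ℕ} (hy : 1 ≤ y) (h : n < x + y) :
    pushedSet r n i x y = ∅ := by
  refine Set.eq_empty_iff_forall_notMem.2 ?_
  rintro δ (h' | ⟨m, hm, t, ht, b, hb, hmb, δ', hδ', rfl, h' | h'⟩)
  · omega
  · omega
  · omega

theorem mem_pushedSet_iff {r n i x y : ℕ} (hn : 2 ≤ n) (hy : 1 ≤ y) {δ : ℕ → ℝ} :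
    δ ∈ pushedSet r n i x y ↔ x + y ≤ n ∧ ∃ t ≤ Nat.log r n + 1, ∃ b, ∃ δ' ∈ reach r n i x b,
      y = b * r ^ t ∧ δ = δ' + ind t x := by
  constructor
  · rintro (h' | ⟨m, hm, t, ht, b, hb, hmb, δ', hδ', rfl, h' | h'⟩)
    · omega
    · obtain ⟨rfl, h1, h2⟩ := h'
      exact ⟨h2, t, ht, b, δ', hδ', h1, rfl⟩
    · omega
  · rintro ⟨hxy, t, ht, b, δ', hδ', h1, rfl⟩
    have hb : 1 ≤ b := by
      rcases Nat.eq_zero_or_pos b with rfl | hb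
      · rw [zero_mul] at h1
        omega
      · exact hb
    rcases validSig_of_mem_reach hn hδ' with h | h
    · exact Or.inr ⟨x, by omega, t, ht, b, hb, h.2, δ', hδ', rfl, Or.inl ⟨rfl, h1, hxy⟩⟩
    · omega

/-- No node has become a leaf. This row starts the sweep. -/
theorem reach_succ_eq_zero_left {r n i y : ℕ} (hn : 2 ≤ n) (hy : 1 ≤ y) :
    reach r n (i + 1) 0 y = pushedSet r n i 0 y := by
  ext δ
  rw [mem_pushedSet_iff hn hy]
  constructor
  · rintro ⟨hV, t, ht, m, b, δ', hδ', h1, h2, h3, rfl⟩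
    obtain rfl : m = 0 := by omega
    rcases hV with hV | hV
    · exact ⟨hV.2, t, ht, b, δ', hδ', by omega, rfl⟩
    · omega
  · rintro ⟨hxy, t, ht, b, δ', hδ', h1, rfl⟩
    refine ⟨Or.inl ⟨hy, hxy⟩, t, ht, 0, b, δ', hδ', h1.le, by omega, ?_, rfl⟩
    rintro rfl
    simp at h1
    omega

/-- Either no child on the new level is a leaf, or one of the leaves can be made internal again,
which leads to `(x, y + 1)`. The edge length plays no role in this, so one sweep serves all of them.
-/
theorem reach_succ_eq_union {r n i x y : ℕ} (hn : 2 ≤ n) (hy : 1 ≤ y) (hxy : x + 1 + y ≤ n) :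
    reach r n (i + 1) (x + 1) y =
      pushedSet r n i (x + 1) y ∪ reach r n (i + 1) x (y + 1) := by
  ext δ
  rw [Set.mem_union, mem_pushedSet_iff hn hy]
  constructor
  · rintro ⟨hV, t, ht, m, b, δ', hδ', h1, h2, h3, rfl⟩
    rcases h1.eq_or_lt with h1 | h1
    · obtain rfl : m = x + 1 := by omega
      exact Or.inl ⟨hxy, t, ht, b, δ', hδ', h1, rfl⟩
    · exact Or.inr ⟨Or.inl ⟨by omega, by omega⟩, t, ht, m, b, δ', hδ', h1, by omega, h3, rfl⟩
  · rintro (⟨-, t, ht, b, δ', hδ', h1, rfl⟩ | ⟨hV, t, ht, m, b, δ', hδ', h1, h2, h3, rfl⟩)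
    · refine ⟨Or.inl ⟨hy, hxy⟩, t, ht, x + 1, b, δ', hδ', h1.le, by omega, ?_, rfl⟩
      rintro rfl
      simp at h1
      omega
    · exact ⟨Or.inl ⟨hy, hxy⟩, t, ht, m, b, δ', hδ', by omega, by omega, h3, rfl⟩

/-! ### Tables of minimal depth vectors -/

/-- `flag` is `0` if `X` is empty; otherwise `val` is the least cost of a vector in `X`, and some
vector of this cost satisfies `W`. -/
def BestIn {n : ℕ} (p : Fin n → ℝ) (flag : ℕ) (val : ℝ) (W : (ℕ → ℝ) → Prop)
    (X : Set (ℕ → ℝ)) : Prop :=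
  (flag = 0 → X = ∅) ∧
    (flag ≠ 0 → ∃ δ ∈ X, W δ ∧ val = costVec p δ ∧ ∀ δ' ∈ X, costVec p δ ≤ costVec p δ')

theorem BestIn.mono {n : ℕ} {p : Fin n → ℝ} {flag : ℕ} {val : ℝ} {W W' : (ℕ → ℝ) → Prop}
    {X : Set (ℕ → ℝ)} (h : BestIn p flag val W X) (hW : ∀ δ, W δ → W' δ) :
    BestIn p flag val W' X :=
  ⟨h.1, fun hf => by
    obtain ⟨δ, h1, h2, h3⟩ := h.2 hf
    exact ⟨δ, h1, hW δ h2, h3⟩⟩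

theorem BestIn.union_left {n : ℕ} {p : Fin n → ℝ} {f f' : ℕ} {v v' : ℝ} {W W' : (ℕ → ℝ) → Prop}
    {X X' : Set (ℕ → ℝ)} (h : BestIn p f v W X) (h' : BestIn p f' v' W' X')
    (hf : f' = 0 ∨ (f ≠ 0 ∧ v ≤ v')) : BestIn p f v W (X ∪ X') := by
  by_cases h0 : f' = 0
  · rwa [h'.1 h0, Set.union_empty]
  · obtain ⟨h1, h2⟩ := hf.resolve_left h0
    refine ⟨fun h => absurd h h1, fun _ => ?_⟩
    obtain ⟨δ, a1, a2, a3, a4⟩ := h.2 h1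
    obtain ⟨δ', b1, b2, b3, b4⟩ := h'.2 h0
    refine ⟨δ, Or.inl a1, a2, a3, ?_⟩
    rintro ε (hε | hε)
    · exact a4 ε hε
    · exact (a3 ▸ b3 ▸ h2).trans (b4 ε hε)

/-- Following the pointers from the cell `a` on level `i` down to the root gives the depth vector
`δ`.  The natural arrays `2`, `3` and `4` hold, for each cell, the number of leaves on the levels
above the last one, the length of the edges into the last level, and the preceding cell. -/
def Traced (r n : ℕ) (s : Store) : ℕ → ℕ → (ℕ → ℝ) → Prop
  | 0, _, δ => δ = 0
  | i + 1, a, δ => s.narr 4 a < address r n (i + 1) 0 0 ∧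
      ∃ δ', Traced r n s i (s.narr 4 a) δ' ∧ δ = δ' + ind (s.narr 3 a) (s.narr 2 a)

theorem address_eq (r n i m b : ℕ) :
    address r n i m b = address r n i 0 0 + m * (n + 1) + b := by
  simp only [address]
  ring

theorem address_succ (r n i : ℕ) :
    address r n (i + 1) 0 0 = address r n i 0 0 + n * (r + 1) * (n + 1) := by
  simp only [address]
  ring

theorem address_mono (r n : ℕ) : Monotone fun i => address r n i 0 0 :=
  monotone_nat_of_le_succ fun i => by
    rw [address_succ]
    omega

theorem address_lt {r n i m b : ℕ} (hm : m < n * (r + 1)) (hb : b ≤ n) :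
    address r n i m b < address r n (i + 1) 0 0 := by
  rw [address_eq, address_succ]
  have : (m + 1) * (n + 1) ≤ n * (r + 1) * (n + 1) := Nat.mul_le_mul_right _ hm
  rw [add_mul, one_mul] at this
  omega

theorem address_inj {r n i m b m' b' : ℕ} (hb : b ≤ n) (hb' : b' ≤ n)
    (h : address r n i m b = address r n i m' b') : m = m' ∧ b = b' := by
  rw [address_eq, address_eq r n i m' b'] at h
  have h1 : (b + (n + 1) * m) = b' + (n + 1) * m' := by
    rw [mul_comm (n + 1) m, mul_comm (n + 1) m']
    omega
  have h2 := congrArg (· % (n + 1)) h1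
  simp only [Nat.add_mul_mod_self_left] at h2
  rw [Nat.mod_eq_of_lt (by omega), Nat.mod_eq_of_lt (by omega)] at h2
  subst h2
  exact ⟨Nat.eq_of_mul_eq_mul_left (Nat.succ_pos n) (Nat.add_left_cancel h1), rfl⟩

/-- Every pointer on a trace leads to an address below `B`, so changes at `B` or beyond do not
matter. -/
theorem Traced.congr {r n i a B : ℕ} {s s' : Store} {δ : ℕ → ℝ} (h : Traced r n s i a δ)
    (ha : a < B) (hB : ∀ j < i, address r n (j + 1) 0 0 ≤ B)
    (h2 : ∀ x < B, s'.narr 2 x = s.narr 2 x) (h3 : ∀ x < B, s'.narr 3 x = s.narr 3 x)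
    (h4 : ∀ x < B, s'.narr 4 x = s.narr 4 x) : Traced r n s' i a δ := by
  induction i generalizing a δ with
  | zero => exact h
  | succ i ih =>
    obtain ⟨h1, δ', hδ', rfl⟩ := h
    refine ⟨by rwa [h4 a ha], δ', ?_, by rw [h2 a ha, h3 a ha]⟩
    rw [h4 a ha]
    exact ih hδ' (h1.trans_le (hB i (by omega))) fun j hj => hB j (by omega)

/-- The cell `a` holds the least cost of a vector in `X`, and a trace of such a vector. -/
def CellOK (r n : ℕ) (p : Fin n → ℝ) (s : Store) (i a : ℕ) (X : Set (ℕ → ℝ)) : Prop :=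
  BestIn p (s.narr 1 a) (s.rarr 1 a) (Traced r n s i a) X

/-- The registers hold the least cost of a vector in `X` and a trace of such a vector; what they
hold may become a cell on level `i + 1`. -/
def RegOK (r n : ℕ) (p : Fin n → ℝ) (s : Store) (i : ℕ) (X : Set (ℕ → ℝ)) : Prop :=
  BestIn p (s.nvar 70) (s.rvar 20) (fun δ => s.nvar 73 < address r n (i + 1) 0 0 ∧
    ∃ δ', Traced r n s i (s.nvar 73) δ' ∧ δ = δ' + ind (s.nvar 72) (s.nvar 71)) X

/-- The levels `0, …, i` of the table are complete, the cells on level `i + 1` hold the least costs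
of the vectors in `S`, and the next levels are empty. -/
structure InLevel (r n : ℕ) (p : Fin n → ℝ) (s : Store) (i : ℕ) (S : ℕ → ℕ → Set (ℕ → ℝ)) :
    Prop where
  lower : ∀ i' ≤ i, ∀ m < n * (r + 1), ∀ b ≤ n,
    CellOK r n p s i' (address r n i' m b) (reach r n i' m b)
  cur : ∀ m < n * (r + 1), ∀ b ≤ n, CellOK r n p s (i + 1) (address r n (i + 1) m b) (S m b)
  upper : ∀ a, address r n (i + 2) 0 0 ≤ a → s.narr 1 a = 0

theorem CellOK.congr {r n i a B : ℕ} {p : Fin n → ℝ} {s s' : Store} {X : Set (ℕ → ℝ)}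
    (h : CellOK r n p s i a X) (ha : a < B) (hB : ∀ j < i, address r n (j + 1) 0 0 ≤ B)
    (h1 : s'.narr 1 a = s.narr 1 a) (hr : s'.rarr 1 a = s.rarr 1 a)
    (h2 : ∀ x < B, s'.narr 2 x = s.narr 2 x) (h3 : ∀ x < B, s'.narr 3 x = s.narr 3 x)
    (h4 : ∀ x < B, s'.narr 4 x = s.narr 4 x) : CellOK r n p s' i a X := by
  rw [CellOK, h1, hr]
  exact BestIn.mono h fun δ hδ => hδ.congr ha hB h2 h3 h4

theorem InLevel.of_frame {r n i : ℕ} {p : Fin n → ℝ} {s s' : Store} {S : ℕ → ℕ → Set (ℕ → ℝ)}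
    (h : InLevel r n p s i S) {P : Prog} (hf : Frame P s s')
    (hn : ∀ x ∈ [1, 2, 3, 4], P.anyInstr (fun a => a.writesNArr x) = false)
    (hr : P.anyInstr (fun a => a.writesRArr 1) = false) : InLevel r n p s' i S := by
  have h1 := hf.narr 1 (hn 1 (by simp))
  have h2 := hf.narr 2 (hn 2 (by simp))
  have h3 := hf.narr 3 (hn 3 (by simp))
  have h4 := hf.narr 4 (hn 4 (by simp))
  have h5 := hf.rarr 1 hr
  have key : ∀ i a X, CellOK r n p s i a X → CellOK r n p s' i a X := fun i a X hc =>
    hc.congr (B := max (a + 1) (address r n i 0 0)) (by omega)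
      (fun j hj => (address_mono r n (by omega : j + 1 ≤ i)).trans (le_max_right _ _))
      (by rw [h1]) (by rw [h5]) (fun _ _ => by rw [h2]) (fun _ _ => by rw [h3])
      (fun _ _ => by rw [h4])
  exact ⟨fun i' hi m hm b hb => key _ _ _ (h.lower i' hi m hm b hb),
    fun m hm b hb => key _ _ _ (h.cur m hm b hb), fun a ha => by rw [h1]; exact h.upper a ha⟩

theorem InLevel.congr {r n i : ℕ} {p : Fin n → ℝ} {s : Store} {S S' : ℕ → ℕ → Set (ℕ → ℝ)}
    (h : InLevel r n p s i S) (hS : ∀ m b, S m b = S' m b) : InLevel r n p s i S' :=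
  ⟨h.lower, fun m hm b hb => hS m b ▸ h.cur m hm b hb, h.upper⟩

theorem InLevel.next {r n i : ℕ} {p : Fin n → ℝ} {s : Store}
    (h : InLevel r n p s i (reach r n (i + 1))) : InLevel r n p s (i + 1) fun _ _ => ∅ := by
  refine ⟨fun i' hi m hm b hb => ?_, fun m hm b hb => ?_, fun a ha => h.upper a ?_⟩
  · rcases hi.eq_or_lt with rfl | hi
    · exact h.cur m hm b hb
    · exact h.lower i' (by omega) m hm b hb
  · have h0 : s.narr 1 (address r n (i + 1 + 1) m b) = 0 := h.upper _ (by
      rw [address_eq r n (i + 1 + 1) m b, add_assoc]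
      exact Nat.le_add_right _ _)
    exact ⟨fun _ => rfl, fun hne => absurd h0 hne⟩
  · exact (address_mono r n (by omega : i + 2 ≤ i + 3)).trans ha

/-! ### Storing candidates in the table -/

/-- The constants of the algorithm: natural variables `0` to `12`, real variable `1`, the powers of
`r` in natural array `5` and the tail weights in real array `2`. -/
structure Env (r n g : ℕ) (p : Fin n → ℝ) (s : Store) : Prop where
  v0 : s.nvar 0 = n
  v1 : s.nvar 1 = r
  v2 : s.nvar 2 = g
  v3 : s.nvar 3 = 1
  v4 : s.nvar 4 = Nat.log r n + 2
  v5 : s.nvar 5 = n + 1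
  v6 : s.nvar 6 = n * (r + 1) * (n + 1)
  v7 : s.nvar 7 = n + r ^ Nat.log r n
  v8 : s.nvar 8 = r ^ (Nat.log r n + 1)
  v9 : s.nvar 9 = r ^ (Nat.log r n + 1) + n
  v10 : s.nvar 10 = n * (n + 1)
  v11 : s.nvar 11 = r ^ (Nat.log r n + 1) * (n + 1)
  v12 : s.nvar 12 = 0
  rz : s.rvar 1 = 0
  pow : ∀ t ≤ Nat.log r n + 1, s.narr 5 t = r ^ t
  w : ∀ m ≤ n, s.rarr 2 m = tailWeight p m

/-- The program does not write to the constants. -/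
def Prog.KeepsEnv (P : Prog) : Prop :=
  (∀ x < 13, P.anyInstr (fun a => a.writesNVar x) = false) ∧
    P.anyInstr (fun a => a.writesRVar 1) = false ∧
    P.anyInstr (fun a => a.writesNArr 5) = false ∧ P.anyInstr (fun a => a.writesRArr 2) = false

theorem Env.of_frame {r n g : ℕ} {p : Fin n → ℝ} {s s' : Store} {P : Prog} (h : Env r n g p s)
    (hf : Frame P s s') (hP : P.KeepsEnv) : Env r n g p s' := by
  have hv : ∀ x < 13, s'.nvar x = s.nvar x := fun x hx => hf.nvar x (hP.1 x hx)
  have hr := hf.rvar 1 hP.2.1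
  have h5 := hf.narr 5 hP.2.2.1
  have h2 := hf.rarr 2 hP.2.2.2
  constructor <;> first
    | (rw [hv _ (by norm_num)]; first
        | exact h.v0 | exact h.v1 | exact h.v2 | exact h.v3 | exact h.v4 | exact h.v5 | exact h.v6
        | exact h.v7 | exact h.v8 | exact h.v9 | exact h.v10 | exact h.v11 | exact h.v12)
    | (rw [hr]; exact h.rz)
    | (rw [h5]; exact h.pow)
    | (rw [h2]; exact h.w)

/-- Add the set `X` to the entry `(m, b)` of `S`. -/
def addSet (S : ℕ → ℕ → Set (ℕ → ℝ)) (m b : ℕ) (X : Set (ℕ → ℝ)) : ℕ → ℕ → Set (ℕ → ℝ) :=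
  fun m' b' => S m' b' ∪ {δ | m' = m ∧ b' = b ∧ δ ∈ X}

theorem addSet_self (S : ℕ → ℕ → Set (ℕ → ℝ)) (m b : ℕ) (X : Set (ℕ → ℝ)) :
    addSet S m b X m b = S m b ∪ X := by
  simp [addSet]

theorem addSet_of_ne (S : ℕ → ℕ → Set (ℕ → ℝ)) {m b m' b' : ℕ} (X : Set (ℕ → ℝ))
    (h : ¬ (m' = m ∧ b' = b)) : addSet S m b X m' b' = S m' b' := by
  have : {δ | m' = m ∧ b' = b ∧ δ ∈ X} = ∅ :=
    Set.eq_empty_iff_forall_notMem.2 fun δ hδ => h ⟨hδ.1, hδ.2.1⟩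
  rw [addSet, this, Set.union_empty]

/-- Store the registers in the cell whose address is in variable `d`. -/
def storeProg (d : ℕ) : Prog :=
  .block [.nstore 1 d 70, .rstore 1 d 20, .nstore 2 d 71, .nstore 3 d 72, .nstore 4 d 73]

/-- Store the registers in the cell whose address is in variable `d` if that improves it. -/
def relaxProg (d : ℕ) : Prog :=
  .cond (.neq 70 12) .skip (.seq (.instr (.nload 74 1 d)) (.cond (.neq 74 12) (storeProg d)
    (.seq (.instr (.rload 21 1 d)) (.cond (.rle 21 20) .skip (storeProg d)))))

section

variable {r n g i m b : ℕ} {p : Fin n → ℝ} {s : Store} {S : ℕ → ℕ → Set (ℕ → ℝ)}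
  {X : Set (ℕ → ℝ)}

/-- Writing to a cell on level `i + 1` spoils no trace, since the pointers of all cells considered
lead below that level. -/
theorem inLevel_addSet {s' : Store} (h : InLevel r n p s i S) (hm : m < n * (r + 1)) (hb : b ≤ n)
    {a : ℕ} (ha : a = address r n (i + 1) m b)
    (hc : BestIn p (s'.narr 1 a) (s'.rarr 1 a) (Traced r n s' (i + 1) a) (S m b ∪ X))
    (h1 : ∀ x ≠ a, s'.narr 1 x = s.narr 1 x) (hr : ∀ x ≠ a, s'.rarr 1 x = s.rarr 1 x)
    (h2 : ∀ x ≠ a, s'.narr 2 x = s.narr 2 x) (h3 : ∀ x ≠ a, s'.narr 3 x = s.narr 3 x)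
    (h4 : ∀ x ≠ a, s'.narr 4 x = s.narr 4 x) : InLevel r n p s' i (addSet S m b X) := by
  have ha1 : address r n (i + 1) 0 0 ≤ a := by
    rw [ha, address_eq r n (i + 1) m b, add_assoc]
    exact Nat.le_add_right _ _
  have ha2 : a < address r n (i + 2) 0 0 := ha ▸ address_lt hm hb
  have hB : ∀ {i'}, i' ≤ i → ∀ j < i', address r n (j + 1) 0 0 ≤ address r n (i + 1) 0 0 :=
    fun hi j hj => address_mono r n (by omega : j + 1 ≤ i + 1)
  refine ⟨fun i' hi m' hm' b' hb' => ?_, fun m' hm' b' hb' => ?_, fun x hx => ?_⟩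
  · have hlt : address r n i' m' b' < address r n (i + 1) 0 0 :=
      (address_lt hm' hb').trans_le (address_mono r n (by omega : i' + 1 ≤ i + 1))
    exact (h.lower i' hi m' hm' b' hb').congr hlt (hB hi) (h1 _ (by omega)) (hr _ (by omega))
      (fun x hx => h2 x (by omega)) (fun x hx => h3 x (by omega)) fun x hx => h4 x (by omega)
  · by_cases he : m' = m ∧ b' = b
    · obtain ⟨rfl, rfl⟩ := he
      rw [addSet_self, CellOK, ← ha]
      exact hc
    · rw [addSet_of_ne S X he, CellOK]
      have hne : address r n (i + 1) m' b' ≠ a := fun h' => he (address_inj hb' hb (h'.trans ha))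
      rw [h1 _ hne, hr _ hne]
      refine BestIn.mono (h.cur m' hm' b' hb') ?_
      rintro δ ⟨e1, δ', e2, rfl⟩
      refine ⟨by rwa [h4 _ hne], δ', ?_, by rw [h2 _ hne, h3 _ hne]⟩
      rw [h4 _ hne]
      exact e2.congr e1 (hB le_rfl) (fun x hx => h2 x (by omega)) (fun x hx => h3 x (by omega))
        fun x hx => h4 x (by omega)
  · rw [h1 x (by omega)]
    exact h.upper x hx

/-- The first hypothesis on the registers describes the new content of the cell; the second lets the
same registers be stored again elsewhere. -/
theorem runs_storeProg {d : ℕ} (h : InLevel r n p s i S) (hm : m < n * (r + 1)) (hb : b ≤ n)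
    (hd : s.nvar d = address r n (i + 1) m b) (hX : RegOK r n p s i (S m b ∪ X))
    (hX' : RegOK r n p s i X) :
    Runs (storeProg d) s 5 fun s' =>
      InLevel r n p s' i (addSet S m b X) ∧ RegOK r n p s' i X := by
  refine Runs.block ?_
  have hB : ∀ j < i, address r n (j + 1) 0 0 ≤ address r n (i + 1) 0 0 :=
    fun j hj => address_mono r n (by omega : j + 1 ≤ i + 1)
  have ha1 : ∀ x < address r n (i + 1) 0 0, x ≠ address r n (i + 1) m b := by
    rw [address_eq r n (i + 1) m b]
    intro x hx
    omega
  refine ⟨inLevel_addSet h hm hb (a := s.nvar d) hd ?_ ?_ ?_ ?_ ?_ ?_, ?_⟩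
  · simp only [List.foldl, Instr.run, Function.update_self, ne_eq, OfNat.ofNat_ne_one,
      OfNat.one_ne_ofNat, not_false_eq_true, Function.update_of_ne, Nat.reduceEqDiff]
    refine BestIn.mono hX ?_
    rintro δ ⟨e1, δ', e2, rfl⟩
    refine ⟨by simpa using e1, δ', ?_, by simp⟩
    simp only [Function.update_self]
    refine e2.congr e1 hB ?_ ?_ ?_ <;> intro x hx <;>
      simp [Function.update_of_ne, hd, ha1 x hx]
  iterate 5
    intro x hx
    simp [Instr.run, hx]
  refine BestIn.mono hX' ?_
  rintro δ ⟨e1, δ', e2, rfl⟩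
  refine ⟨e1, δ', ?_, rfl⟩
  refine e2.congr e1 hB ?_ ?_ ?_ <;> intro x hx <;> simp [Instr.run, hd, ha1 x hx]

theorem RegOK.of_frame {s' : Store} (h : RegOK r n p s i X) {P : Prog} (hf : Frame P s s')
    (hv : ∀ x ∈ [70, 71, 72, 73], P.anyInstr (fun a => a.writesNVar x) = false)
    (hn : ∀ x ∈ [2, 3, 4], P.anyInstr (fun a => a.writesNArr x) = false)
    (hr : P.anyInstr (fun a => a.writesRVar 20) = false) : RegOK r n p s' i X := by
  rw [RegOK, hf.nvar 70 (hv _ (by simp)), hf.nvar 71 (hv _ (by simp)),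
    hf.nvar 72 (hv _ (by simp)), hf.nvar 73 (hv _ (by simp)), hf.rvar 20 hr]
  refine BestIn.mono h ?_
  rintro δ ⟨e1, δ', e2, rfl⟩
  refine ⟨e1, δ', ?_, rfl⟩
  exact e2.congr (B := address r n (i + 1) 0 0) e1
    (fun j hj => address_mono r n (by omega : j + 1 ≤ i + 1))
    (fun x _ => by rw [hf.narr 2 (hn _ (by simp))]) (fun x _ => by rw [hf.narr 3 (hn _ (by simp))])
    (fun x _ => by rw [hf.narr 4 (hn _ (by simp))])

/-- A zero flag stands for an empty set, on either side; if both sets are nonempty, the smaller of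
the two minima is the minimum over the union. -/
theorem runs_relaxProg {d : ℕ} (hd74 : d ≠ 74) (hz : s.nvar 12 = 0) (h : InLevel r n p s i S)
    (hm : m < n * (r + 1)) (hb : b ≤ n) (hd : s.nvar d = address r n (i + 1) m b)
    (hX : RegOK r n p s i X) :
    Runs (relaxProg d) s 10 fun s' =>
      InLevel r n p s' i (addSet S m b X) ∧ RegOK r n p s' i X := by
  have hcell := h.cur m hm b hb
  have hkeep : S m b ∪ X = S m b → InLevel r n p s i (addSet S m b X) := fun he =>
    h.congr fun m' b' => by
      by_cases hmb : m' = m ∧ b' = b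
      · rw [hmb.1, hmb.2, addSet_self, he]
      · rw [addSet_of_ne S X hmb]
  refine (Runs.cond (T := 9) (fun hb70 => ?_) fun hb70 => ?_).mono le_rfl fun _ _ h => h
  · have h0 : s.nvar 70 = 0 := by simpa [Test.holds, hz] using hb70
    refine (Runs.skip ?_).mono (Nat.zero_le _) fun _ _ h => h
    exact ⟨hkeep (by rw [hX.1 h0, Set.union_empty]), hX⟩
  · have h0 : s.nvar 70 ≠ 0 := by simpa [Test.holds, hz] using hb70
    refine (Runs.seq (T' := 8) (Q := fun s' => s' = (Instr.nload 74 1 d).run s) (Runs.instr rfl)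
      fun s₁ hf₁ hs₁ => ?_).mono le_rfl fun _ _ h => h
    have hI₁ : InLevel r n p s₁ i S := h.of_frame hf₁ (by simp [Prog.anyInstr, Instr.writesNArr]) rfl
    have hX₁ : RegOK r n p s₁ i X :=
      hX.of_frame hf₁ (by simp [Prog.anyInstr, Instr.writesNVar])
        (by simp [Prog.anyInstr, Instr.writesNArr]) rfl
    have hd₁ : s₁.nvar d = address r n (i + 1) m b := by
      rw [hs₁]
      simpa [Instr.run, hd74] using hd
    have h74 : s₁.nvar 74 = s.narr 1 (address r n (i + 1) m b) := by
      rw [hs₁]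
      simp [Instr.run, hd]
    have hz₁ : s₁.nvar 12 = 0 := (hf₁.nvar 12 rfl).trans hz
    have h0₁ : s₁.nvar 70 ≠ 0 := by rwa [hf₁.nvar 70 rfl]
    refine (Runs.cond (T := 7) (fun hb74 => ?_) fun hb74 => ?_).mono le_rfl fun _ _ h => h
    · have hz74 : s.narr 1 (address r n (i + 1) m b) = 0 := by
        simpa [Test.holds, hz₁, h74] using hb74
      refine (runs_storeProg (X := X) hI₁ hm hb hd₁ ?_ hX₁).mono (by norm_num) fun _ _ h => h
      rwa [hcell.1 hz74, Set.empty_union]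
    · have hz74 : s.narr 1 (address r n (i + 1) m b) ≠ 0 := by
        simpa [Test.holds, hz₁, h74] using hb74
      refine (Runs.seq (T' := 6) (Q := fun s' => s' = (Instr.rload 21 1 d).run s₁) (Runs.instr rfl)
        fun s₂ hf₂ hs₂ => ?_).mono le_rfl fun _ _ h => h
      have hI₂ : InLevel r n p s₂ i S :=
        hI₁.of_frame hf₂ (by simp [Prog.anyInstr, Instr.writesNArr]) rfl
      have hX₂ : RegOK r n p s₂ i X :=
        hX₁.of_frame hf₂ (by simp [Prog.anyInstr, Instr.writesNVar])
          (by simp [Prog.anyInstr, Instr.writesNArr]) rfl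
      have hd₂ : s₂.nvar d = address r n (i + 1) m b := by
        rw [hs₂]
        exact hd₁
      have h21 : s₂.rvar 21 = s₂.rarr 1 (address r n (i + 1) m b) := by
        rw [hs₂]
        simp [Instr.run, hd₁]
      have hcell₂ := hI₂.cur m hm b hb
      have h1₂ : s₂.narr 1 (address r n (i + 1) m b) ≠ 0 := by
        rwa [hf₂.narr 1 rfl, hf₁.narr 1 rfl]
      have h0₂ : s₂.nvar 70 ≠ 0 := by rwa [hf₂.nvar 70 rfl]
      refine (Runs.cond (T := 5) (fun hle => ?_) fun hle => ?_).mono le_rfl fun _ _ h => h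
      · refine (Runs.skip ?_).mono (Nat.zero_le _) fun _ _ h => h
        have hle' : s₂.rarr 1 (address r n (i + 1) m b) ≤ s₂.rvar 20 := by
          simpa [Test.holds, h21] using hle
        have hu : BestIn p _ _ _ (S m b ∪ X) := hcell₂.union_left hX₂ (Or.inr ⟨h1₂, hle'⟩)
        exact ⟨inLevel_addSet hI₂ hm hb rfl hu (fun _ _ => rfl) (fun _ _ => rfl) (fun _ _ => rfl)
          (fun _ _ => rfl) fun _ _ => rfl, hX₂⟩
      · have hle' : s₂.rvar 20 ≤ s₂.rarr 1 (address r n (i + 1) m b) := by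
          have : ¬ s₂.rarr 1 (address r n (i + 1) m b) ≤ s₂.rvar 20 := by
            simpa [Test.holds, h21] using hle
          exact (not_le.1 this).le
        refine runs_storeProg hI₂ hm hb hd₂ ?_ hX₂
        rw [Set.union_comm]
        exact BestIn.union_left hX₂ hcell₂ (Or.inr ⟨h0₂, hle'⟩)

/-- Load into the registers the cell on the last complete level whose address is in variable `src`,
after an extension by edges of length `tv` below all leaves but the first `mv`; the real variable
`cv` holds the cost of this extension. -/
def pushRegs (src mv tv cv : ℕ) : Prog :=
  .block [.nload 70 1 src, .rload 20 1 src, .radd 20 20 cv, .nmove 71 mv, .nmove 72 tv,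
    .nmove 73 src]

/-- Adding one fixed vector shifts all costs in a set by the same amount, so the minimizer stays the
same. -/
theorem runs_pushRegs {src mv tv cv : ℕ} (hsrc : src < 70) (hmv : mv < 70) (htv : tv < 70)
    (hcv : cv < 20) (h : InLevel r n p s i S) (hm : m < n * (r + 1)) (hb : b ≤ n)
    (hs : s.nvar src = address r n i m b)
    (hc : s.rvar cv = (s.nvar tv : ℝ) * tailWeight p (s.nvar mv)) :
    Runs (pushRegs src mv tv cv) s 6 fun s' => InLevel r n p s' i S ∧
      RegOK r n p s' i
        {δ | ∃ δ' ∈ reach r n i m b, δ = δ' + ind (s.nvar tv) (s.nvar mv)} := by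
  have hs70 : src ≠ 70 := by omega
  have hs71 : src ≠ 71 := by omega
  have hs72 : src ≠ 72 := by omega
  have hm70 : mv ≠ 70 := by omega
  have ht70 : tv ≠ 70 := by omega
  have ht71 : tv ≠ 71 := by omega
  have hc20 : cv ≠ 20 := by omega
  refine (Runs.block (Q := fun s' => s'.nvar 70 = s.narr 1 (address r n i m b) ∧
    s'.rvar 20 = s.rarr 1 (address r n i m b) + s.rvar cv ∧ s'.nvar 71 = s.nvar mv ∧
    s'.nvar 72 = s.nvar tv ∧ s'.nvar 73 = address r n i m b) ?_).mono le_rfl ?_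
  · simp [Instr.run, hs70, hs71, hs72, hm70, ht70, ht71, hc20, hs]
  · rintro s' hf ⟨h70, h20, h71, h72, h73⟩
    have hI : InLevel r n p s' i S :=
      h.of_frame hf (by simp [Prog.block, Prog.anyInstr, Instr.writesNArr]) rfl
    refine ⟨hI, ?_⟩
    have hcell := hI.lower i le_rfl m hm b hb
    rw [← hf.narr 1 rfl] at h70
    rw [← hf.rarr 1 rfl] at h20
    constructor
    · intro h0
      rw [h70] at h0
      rw [hcell.1 h0]
      simp
    · intro h0
      rw [h70] at h0
      obtain ⟨δ, e1, e2, e3, e4⟩ := hcell.2 h0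
      refine ⟨_, ⟨δ, e1, rfl⟩, ⟨?_, δ, ?_, by rw [h72, h71]⟩, ?_, ?_⟩
      · rw [h73]
        exact address_lt hm hb
      · rwa [h73]
      · rw [h20, e3, hc, costVec_add, costVec_ind]
      · rintro _ ⟨δ', hδ', rfl⟩
        rw [costVec_add, costVec_add]
        have := e4 δ' hδ'
        linarith

/-- Load into the registers the cell on the current level whose address is in variable `src`. -/
def loadRegs (src : ℕ) : Prog :=
  .block [.nload 70 1 src, .rload 20 1 src, .nload 71 2 src, .nload 72 3 src, .nload 73 4 src]

theorem runs_loadRegs {src : ℕ} (hsrc : src < 70) (h : InLevel r n p s i S)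
    (hm : m < n * (r + 1)) (hb : b ≤ n) (hs : s.nvar src = address r n (i + 1) m b) :
    Runs (loadRegs src) s 5 fun s' => InLevel r n p s' i S ∧ RegOK r n p s' i (S m b) := by
  have hs70 : src ≠ 70 := by omega
  have hs71 : src ≠ 71 := by omega
  have hs72 : src ≠ 72 := by omega
  refine (Runs.block (Q := fun s' => s'.nvar 70 = s.narr 1 (address r n (i + 1) m b) ∧
    s'.rvar 20 = s.rarr 1 (address r n (i + 1) m b) ∧
    s'.nvar 71 = s.narr 2 (address r n (i + 1) m b) ∧
    s'.nvar 72 = s.narr 3 (address r n (i + 1) m b) ∧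
    s'.nvar 73 = s.narr 4 (address r n (i + 1) m b)) ?_).mono le_rfl ?_
  · simp [Instr.run, hs70, hs71, hs72, hs]
  · rintro s' hf ⟨h70, h20, h71, h72, h73⟩
    have hI : InLevel r n p s' i S :=
      h.of_frame hf (by simp [Prog.block, Prog.anyInstr, Instr.writesNArr]) rfl
    refine ⟨hI, ?_⟩
    have hcell := hI.cur m hm b hb
    rw [← hf.narr 1 rfl] at h70
    rw [← hf.rarr 1 rfl] at h20
    rw [← hf.narr 2 rfl] at h71
    rw [← hf.narr 3 rfl] at h72
    rw [← hf.narr 4 rfl] at h73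
    rw [RegOK, h70, h20, h71, h72, h73]
    exact hcell

end

/-! ### One level of the table -/

section

variable {r n g i m b : ℕ} {p : Fin n → ℝ} {s : Store} {S : ℕ → ℕ → Set (ℕ → ℝ)}
  {X : Set (ℕ → ℝ)}

/-- For all `x` from variable `lo` on and below variable `hi`, transfer the cell `(x, 0)` of the
last complete level to the current level, without changing its cost. -/
def finalsRange (lo off hi doff dinc : ℕ) : Prog :=
  .seq (.block [.nmove 30 lo, .nadd 31 21 off, .nadd 32 22 doff])
    (.loop (.nlt 30 hi) (.seq (pushRegs 31 30 12 1) (.seq (relaxProg 32)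
      (.block [.nadd 30 30 3, .nadd 31 31 5, .nadd 32 32 dinc]))))

theorem keepsEnv_finalsRange (lo off hi doff dinc : ℕ) :
    (finalsRange lo off hi doff dinc).KeepsEnv := by
  refine ⟨fun x hx => ?_, rfl, rfl, rfl⟩
  interval_cases x <;> rfl

/-- The parameter `e` selects the target of the cell `(z, 0)`: for `e = 1` it is again `(z, 0)`, and
for `e = 0` everything is gathered in the cell `(0, 0)`, which amounts to taking a minimum. -/
theorem runs_finalsRange {lo off hi doff dinc e L H : ℕ} (hoff : off < 13)
    (hhi : hi < 13) (hdoff : doff < 13) (hdinc : dinc < 13) (hE : Env r n g p s)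
    (hI : InLevel r n p s i S) (h21 : s.nvar 21 = address r n i 0 0)
    (h22 : s.nvar 22 = address r n (i + 1) 0 0) (vlo : s.nvar lo = L)
    (voff : s.nvar off = L * (n + 1)) (vhi : s.nvar hi = H) (vdoff : s.nvar doff = e * L * (n + 1))
    (vdinc : s.nvar dinc = e * (n + 1)) (he : e ≤ 1) (hLH : L ≤ H) (hH : H ≤ n * (r + 1)) :
    Runs (finalsRange lo off hi doff dinc) s ((H - L) * 20 + 4) fun s' =>
      InLevel r n p s' i fun x y => S x y ∪
        {δ | y = 0 ∧ ∃ z, L ≤ z ∧ z < H ∧ x = e * z ∧ δ ∈ reach r n i z 0} := by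
  have hoff30 : off ≠ 30 := by omega
  have hdoff30 : doff ≠ 30 := by omega
  have hdoff31 : doff ≠ 31 := by omega
  refine (Runs.seq (T' := (H - L) * (19 + 1) + 1) (Q := fun s' => s'.nvar 30 = L ∧
    s'.nvar 31 = address r n i L 0 ∧ s'.nvar 32 = address r n (i + 1) (e * L) 0)
    (Runs.block ?_) fun s₁ hf₁ ⟨h30, h31, h32⟩ => ?_).mono ?_ fun _ _ h => h
  · simp [Instr.run, hoff30, hdoff30, hdoff31, vlo, h21, h22, voff, vdoff,
      address_eq r n _ L 0, address_eq r n _ (e * L) 0]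
  · have hk₁ : ∀ x < 13, s₁.nvar x = s.nvar x := fun x hx => hf₁.nvar x (by
      interval_cases x <;> rfl)
    have hE₁ : Env r n g p s₁ := hE.of_frame hf₁ ⟨fun x hx => by interval_cases x <;> rfl,
      rfl, rfl, rfl⟩
    have hI₁ : InLevel r n p s₁ i S :=
      hI.of_frame hf₁ (by simp [Prog.block, Prog.anyInstr, Instr.writesNArr]) rfl
    refine (Runs.loop (fun k s' => InLevel r n p s' i (fun x y => S x y ∪
        {δ | y = 0 ∧ ∃ z, L ≤ z ∧ z < L + k ∧ x = e * z ∧ δ ∈ reach r n i z 0}) ∧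
      s'.nvar 30 = L + k ∧ s'.nvar 31 = address r n i (L + k) 0 ∧
      s'.nvar 32 = address r n (i + 1) (e * (L + k)) 0) (H - L) ?_ ?_ ?_).mono le_rfl ?_
    · refine ⟨hI₁.congr fun x y => ?_, h30, h31, h32⟩
      symm
      rw [Set.union_eq_left]
      rintro δ ⟨-, z, h1, h2, -⟩
      omega
    · rintro k hk s₂ hf₂ ⟨hI₂, k30, k31, k32⟩
      have hk₂ : ∀ x < 13, s₂.nvar x = s.nvar x := fun x hx => (hf₂.nvar x (by
        interval_cases x <;> rfl)).trans (hk₁ x hx)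
      have hE₂ : Env r n g p s₂ := hE₁.of_frame hf₂ ⟨fun x hx => by interval_cases x <;> rfl,
        rfl, rfl, rfl⟩
      have hz : L + k < n * (r + 1) := by omega
      refine ⟨by
        rw [Test.holds, k30, hk₂ hi hhi, vhi]
        omega, ?_⟩
      refine Runs.seq (T := 6) (T' := 13) (runs_pushRegs (src := 31) (mv := 30) (tv := 12)
        (cv := 1) (by norm_num) (by norm_num) (by norm_num) (by norm_num) hI₂ hz (Nat.zero_le n) k31
        (by rw [hE₂.rz, hE₂.v12]; simp)) fun s₃ hf₃ ⟨hI₃, hX₃⟩ => ?_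
      have hez : e * (L + k) < n * (r + 1) :=
        (Nat.mul_le_mul_right _ he).trans_lt (by rwa [one_mul])
      refine Runs.seq (T := 10) (T' := 3) (runs_relaxProg (d := 32) (by norm_num)
        ((hf₃.nvar 12 rfl).trans hE₂.v12) hI₃ hez (Nat.zero_le n) ((hf₃.nvar 32 rfl).trans k32) hX₃)
        fun s₄ hf₄ ⟨hI₄, _⟩ => ?_
      refine (Runs.block (Q := fun s' => s'.nvar 30 = L + k + 1 ∧
        s'.nvar 31 = address r n i (L + k) 0 + (n + 1) ∧
        s'.nvar 32 = address r n (i + 1) (e * (L + k)) 0 + e * (n + 1)) ?_).mono le_rfl ?_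
      · have hd30 : dinc ≠ 30 := by omega
        have hd31 : dinc ≠ 31 := by omega
        have hd4 : s₄.nvar dinc = e * (n + 1) := by
          rw [hf₄.nvar dinc (by interval_cases dinc <;> rfl),
            hf₃.nvar dinc (by interval_cases dinc <;> rfl), hk₂ dinc hdinc, vdinc]
        simp [Instr.run, hd30, hd31, hd4, hf₄.nvar 30 rfl, hf₃.nvar 30 rfl, k30,
          hf₄.nvar 31 rfl, hf₃.nvar 31 rfl, k31, hf₄.nvar 32 rfl, hf₃.nvar 32 rfl, k32,
          hf₄.nvar 3 rfl, hf₃.nvar 3 rfl, hE₂.v3, hf₄.nvar 5 rfl, hf₃.nvar 5 rfl, hE₂.v5]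
      · rintro s₅ hf₅ ⟨j30, j31, j32⟩
        refine ⟨?_, by omega, ?_, ?_⟩
        · refine (hI₄.of_frame hf₅ (by simp [Prog.block, Prog.anyInstr, Instr.writesNArr])
            rfl).congr fun x y => ?_
          ext δ
          simp only [addSet, Set.mem_union, Set.mem_ofPred_eq, hE₂.v12, k30, ind_zero, add_zero,
            exists_eq_right']
          constructor
          · rintro ((h | ⟨h1, z, h2, h3, h4⟩) | ⟨h1, h2, h3⟩)
            · exact Or.inl h
            · exact Or.inr ⟨h1, z, h2, by omega, h4⟩
            · exact Or.inr ⟨h2, L + k, by omega, by omega, h1, h3⟩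
          · rintro (h | ⟨h1, z, h2, h3, h4, h5⟩)
            · exact Or.inl (Or.inl h)
            · rcases Nat.lt_or_ge z (L + k) with hlt | hge
              · exact Or.inl (Or.inr ⟨h1, z, h2, hlt, h4, h5⟩)
              · obtain rfl : z = L + k := by omega
                exact Or.inr ⟨h4, h1, h5⟩
        · rw [j31, address_eq r n i (L + k) 0, address_eq r n i (L + (k + 1)) 0]
          ring
        · rw [j32, address_eq r n (i + 1) (e * (L + k)) 0,
            address_eq r n (i + 1) (e * (L + (k + 1))) 0]
          ring
    · rintro s₂ hf₂ ⟨-, k30, -⟩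
      rw [Test.holds, k30, hf₂.nvar hi (by interval_cases hi <;> rfl), hk₁ hi hhi, vhi]
      omega
    · rintro s₂ - ⟨h, -⟩
      rwa [show L + (H - L) = H by omega] at h
  · simp
    omega

end

section

variable {r n g i m b : ℕ} {p : Fin n → ℝ} {s : Store} {S : ℕ → ℕ → Set (ℕ → ℝ)}
  {X : Set (ℕ → ℝ)}

theorem Prog.KeepsEnv.seq {P Q : Prog} (hP : P.KeepsEnv) (hQ : Q.KeepsEnv) :
    (Prog.seq P Q).KeepsEnv := by
  refine ⟨fun x hx => ?_, ?_, ?_, ?_⟩ <;> simp only [Prog.anyInstr, Bool.or_eq_false_iff]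
  exacts [⟨hP.1 x hx, hQ.1 x hx⟩, ⟨hP.2.1, hQ.2.1⟩, ⟨hP.2.2.1, hQ.2.2.1⟩, ⟨hP.2.2.2, hQ.2.2.2⟩]

theorem Prog.KeepsEnv.loop {P : Prog} {b : Test} (hP : P.KeepsEnv) : (Prog.loop b P).KeepsEnv := hP

/-! ### Pushing all cells of a level along all edge lengths. -/

/-- Make all children internal. -/
def relaxInternal : Prog :=
  .cond (.nlt 61 5) (.seq (.instr (.nadd 62 32 50)) (relaxProg 62)) .skip

/-- Make all children leaves. -/
def relaxFinal : Prog :=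
  .cond (.nlt 61 0) .skip (.cond (.nlt 61 7) (.seq (.instr (.nadd 62 32 51)) (relaxProg 62))
    (.cond (.nlt 61 8) .skip
      (.cond (.nlt 61 9) (.seq (.instr (.nadd 62 32 51)) (relaxProg 62)) .skip)))

theorem runs_relaxInternal {y : ℕ} (hr : 2 ≤ r) (hn : 2 ≤ n) (hE : Env r n g p s)
    (hI : InLevel r n p s i S) (hX : RegOK r n p s i X) (h32 : s.nvar 32 = address r n (i + 1) m 0) (h50 : s.nvar 50 = y)
    (h61 : s.nvar 61 = m + y) :
    Runs relaxInternal s 12 fun s' => (InLevel r n p s' i fun x z => S x z ∪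
      {δ | (x = m ∧ z = y ∧ x + z ≤ n) ∧ δ ∈ X}) ∧ RegOK r n p s' i X := by
  refine Runs.cond (T := 11) (fun hb => ?_) fun hb => ?_
  · have hle : m + y ≤ n := by
      rw [Test.holds, h61, hE.v5] at hb
      omega
    refine Runs.seq (T := 1) (T' := 10) (Q := fun s' => s'.nvar 62 = address r n (i + 1) m y)
      (Runs.instr ?_) fun s₁ hf₁ h62 => ?_
    · simp [Instr.run, h32, h50, address_eq r n (i + 1) m y, address_eq r n (i + 1) m 0]
    · refine (runs_relaxProg (d := 62) (by norm_num) ((hf₁.nvar 12 rfl).trans hE.v12)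
        (hI.of_frame hf₁ (by simp [Prog.anyInstr, Instr.writesNArr]) rfl) (m := m) (b := y) ?_
        (by omega) h62 (hX.of_frame hf₁ (by simp [Prog.anyInstr, Instr.writesNVar])
        (by simp [Prog.anyInstr, Instr.writesNArr]) rfl)).mono le_rfl fun s₂ _ ⟨h1, h2⟩ =>
        ⟨h1.congr fun x z => ?_, h2⟩
      · rw [mul_add, mul_one]
        have : n * 2 ≤ n * r := Nat.mul_le_mul_left _ hr
        omega
      · ext δ
        simp only [addSet, Set.mem_union, Set.mem_ofPred_eq]
        constructor
        · rintro (h | ⟨rfl, rfl, h⟩)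
          exacts [Or.inl h, Or.inr ⟨⟨rfl, rfl, hle⟩, h⟩]
        · rintro (h | ⟨⟨rfl, rfl, -⟩, h⟩)
          exacts [Or.inl h, Or.inr ⟨rfl, rfl, h⟩]
  · have hle : ¬ m + y ≤ n := by
      rw [Test.holds, h61, hE.v5] at hb
      omega
    refine (Runs.skip ?_).mono (Nat.zero_le _) fun _ _ h => h
    refine ⟨hI.congr fun x z => ?_, hX⟩
    symm
    rw [Set.union_eq_left]
    rintro δ ⟨⟨rfl, rfl, h⟩, -⟩
    exact absurd h hle

/-- The nested tests compare `m + y` with the ends of the two intervals of `Final`. -/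
theorem runs_relaxFinal {y : ℕ} (hr : 2 ≤ r) (hn : 2 ≤ n) (hE : Env r n g p s)
    (hI : InLevel r n p s i S) (hX : RegOK r n p s i X)
    (h32 : s.nvar 32 = address r n (i + 1) m 0) (h51 : s.nvar 51 = y * (n + 1))
    (h61 : s.nvar 61 = m + y) :
    Runs relaxFinal s 15 fun s' => InLevel r n p s' i fun x z => S x z ∪
      {δ | (x = m + y ∧ z = 0 ∧ Final r n x) ∧ δ ∈ X} := by
  have hlog := lt_pow_log_succ hr n
  have hno : ¬ Final r n (m + y) → InLevel r n p s i fun x z => S x z ∪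
      {δ | (x = m + y ∧ z = 0 ∧ Final r n x) ∧ δ ∈ X} := fun h => by
    refine hI.congr fun x z => ?_
    symm
    rw [Set.union_eq_left]
    rintro δ ⟨⟨rfl, rfl, h'⟩, -⟩
    exact absurd h' h
  have hyes : Final r n (m + y) → Runs (.seq (.instr (.nadd 62 32 51)) (relaxProg 62)) s 11
      fun s' => InLevel r n p s' i fun x z => S x z ∪
        {δ | (x = m + y ∧ z = 0 ∧ Final r n x) ∧ δ ∈ X} := by
    intro hF
    refine Runs.seq (T := 1) (T' := 10)
      (Q := fun s' => s'.nvar 62 = address r n (i + 1) (m + y) 0) (Runs.instr ?_)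
      fun s₁ hf₁ h62 => ?_
    · simp only [Instr.run, Function.update_self, h32, h51, address_eq r n (i + 1) m 0,
        address_eq r n (i + 1) (m + y) 0]
      ring
    · refine (runs_relaxProg (d := 62) (by norm_num) ((hf₁.nvar 12 rfl).trans hE.v12)
        (hI.of_frame hf₁ (by simp [Prog.anyInstr, Instr.writesNArr]) rfl) (hF.lt hr hn)
        (Nat.zero_le n) h62 (hX.of_frame hf₁ (by simp [Prog.anyInstr, Instr.writesNVar])
        (by simp [Prog.anyInstr, Instr.writesNArr]) rfl)).mono le_rfl fun s₂ _ h =>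
        h.1.congr fun x z => ?_
      ext δ
      simp only [addSet, Set.mem_union, Set.mem_ofPred_eq]
      constructor
      · rintro (h | ⟨rfl, rfl, h⟩)
        exacts [Or.inl h, Or.inr ⟨⟨rfl, rfl, hF⟩, h⟩]
      · rintro (h | ⟨⟨rfl, rfl, -⟩, h⟩)
        exacts [Or.inl h, Or.inr ⟨rfl, rfl, h⟩]
  have hskip : ∀ T, ¬ Final r n (m + y) → Runs .skip s T fun s' => InLevel r n p s' i fun x z =>
      S x z ∪ {δ | (x = m + y ∧ z = 0 ∧ Final r n x) ∧ δ ∈ X} := fun T h =>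
    (Runs.skip (hno h)).mono (Nat.zero_le _) fun _ _ h => h
  refine Runs.cond (T := 14) (fun hb => hskip _ ?_) fun hb => Runs.cond (T := 13) (fun hb' =>
    (hyes ?_).mono (by norm_num) fun _ _ h => h) fun hb' => Runs.cond (T := 12)
    (fun hb'' => hskip _ ?_) fun hb'' => Runs.cond (T := 11) (fun h3 => hyes ?_) fun h3 => hskip _ ?_
  all_goals simp only [Test.holds, h61, hE.v0, hE.v7, hE.v8, hE.v9] at *
  all_goals simp only [Final]
  all_goals omega

/-- Extend the cell `(m, b)` by edges of length `t`, for `m`, `b` and `t` in the variables `30`,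
`52` and `40`, and make all children internal, or all of them leaves. -/
def pushBody : Prog :=
  .seq (.block [.nadd 50 50 41, .nadd 51 51 42, .nadd 60 31 52, .nadd 61 30 50])
    (.seq (pushRegs 60 30 40 10) (.seq relaxInternal (.seq relaxFinal (.instr (.nadd 52 52 3)))))

theorem keepsEnv_pushBody : pushBody.KeepsEnv := by
  refine ⟨fun x hx => ?_, rfl, rfl, rfl⟩
  interval_cases x <;> rfl

/-- The products `b * r ^ t` and `b * r ^ t * (n + 1)` are kept up to date by additions as `b`
grows, so a cell is handled in constant time. -/
theorem runs_pushBody {t k : ℕ} (hr : 2 ≤ r) (hn : 2 ≤ n) (hE : Env r n g p s)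
    (hI : InLevel r n p s i S) (hmk : m + (k + 1) ≤ n)
    (h30 : s.nvar 30 = m) (h31 : s.nvar 31 = address r n i m 0)
    (h32 : s.nvar 32 = address r n (i + 1) m 0) (h40 : s.nvar 40 = t) (h41 : s.nvar 41 = r ^ t)
    (h42 : s.nvar 42 = r ^ t * (n + 1)) (h10 : s.rvar 10 = (t : ℝ) * tailWeight p m)
    (h50 : s.nvar 50 = k * r ^ t) (h51 : s.nvar 51 = k * r ^ t * (n + 1))
    (h52 : s.nvar 52 = k + 1) :
    Runs pushBody s 38 fun s' =>
      (InLevel r n p s' i fun x y => S x y ∪ pushSet r n i m t (k + 1) x y) ∧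
      s'.nvar 50 = (k + 1) * r ^ t ∧ s'.nvar 51 = (k + 1) * r ^ t * (n + 1) ∧
      s'.nvar 52 = k + 2 := by
  refine Runs.seq (T := 4) (T' := 34) (Q := fun s' => s'.nvar 50 = (k + 1) * r ^ t ∧
    s'.nvar 51 = (k + 1) * r ^ t * (n + 1) ∧ s'.nvar 60 = address r n i m (k + 1) ∧
    s'.nvar 61 = m + (k + 1) * r ^ t) (Runs.block ?_) fun s₁ hf₁ ⟨j50, j51, j60, j61⟩ => ?_
  · simp only [List.foldl, Instr.run, Function.update_self, ne_eq, Nat.reduceEqDiff,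
      not_false_eq_true, Function.update_of_ne, h50, h51, h52, h30, h31, h41, h42,
      address_eq r n i m 0, address_eq r n i m (k + 1)]
    refine ⟨by ring, by ring, by ring, by ring⟩
  have hE₁ : Env r n g p s₁ := hE.of_frame hf₁ ⟨fun x hx => by interval_cases x <;> rfl,
      rfl, rfl, rfl⟩
  have hI₁ := hI.of_frame hf₁ (by simp [Prog.block, Prog.anyInstr, Instr.writesNArr]) rfl
  have hm : m < n * (r + 1) := by
    rw [mul_add, mul_one]
    omega
  refine Runs.seq (T := 6) (T' := 28) (runs_pushRegs (src := 60) (mv := 30) (tv := 40)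
    (cv := 10) (by norm_num) (by norm_num) (by norm_num) (by norm_num) hI₁ hm
    (by omega : k + 1 ≤ n) j60 ?_) fun s₂ hf₂ ⟨hI₂, hX₂⟩ => ?_
  · rw [hf₁.rvar 10 rfl, hf₁.nvar 40 rfl, hf₁.nvar 30 rfl, h10, h40, h30]
  have hE₂ : Env r n g p s₂ := hE₁.of_frame hf₂ ⟨fun x hx => by interval_cases x <;> rfl,
      rfl, rfl, rfl⟩
  refine Runs.seq (T := 12) (T' := 16) (runs_relaxInternal hr hn hE₂ hI₂ hX₂
    (by rw [hf₂.nvar 32 rfl, hf₁.nvar 32 rfl, h32]) ((hf₂.nvar 50 rfl).trans j50)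
    ((hf₂.nvar 61 rfl).trans j61)) fun s₃ hf₃ ⟨hI₃, hX₃⟩ => ?_
  have hE₃ : Env r n g p s₃ := hE₂.of_frame hf₃ ⟨fun x hx => by interval_cases x <;> rfl,
      rfl, rfl, rfl⟩
  refine Runs.seq (T := 15) (T' := 1) (runs_relaxFinal hr hn hE₃ hI₃ hX₃
    (by rw [hf₃.nvar 32 rfl, hf₂.nvar 32 rfl, hf₁.nvar 32 rfl, h32])
    (by rw [hf₃.nvar 51 rfl, hf₂.nvar 51 rfl, j51])
    (by rw [hf₃.nvar 61 rfl, hf₂.nvar 61 rfl, j61])) fun s₄ hf₄ hI₄ => ?_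
  refine (Runs.instr (Q := fun s' => s'.nvar 52 = k + 2) ?_).mono le_rfl fun s₅ hf₅ j52 =>
    ⟨?_, ?_, ?_, j52⟩
  · simp [Instr.run, hf₄.nvar 52 rfl, hf₃.nvar 52 rfl, hf₂.nvar 52 rfl, hf₁.nvar 52 rfl, h52,
      hf₄.nvar 3 rfl, hE₃.v3]
  · refine (hI₄.of_frame hf₅ (by simp [Prog.anyInstr, Instr.writesNArr]) rfl).congr fun x y => ?_
    ext δ
    rw [hf₁.nvar 40 rfl, hf₁.nvar 30 rfl, h40, h30]
    simp only [pushSet, Set.mem_union, Set.mem_ofPred_eq]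
    constructor
    · rintro ((h | ⟨h1, δ', h2, rfl⟩) | ⟨h1, δ', h2, rfl⟩)
      · exact Or.inl h
      · exact Or.inr ⟨δ', h2, rfl, Or.inl h1⟩
      · exact Or.inr ⟨δ', h2, rfl, Or.inr h1⟩
    · rintro (h | ⟨δ', h2, rfl, h1 | h1⟩)
      · exact Or.inl (Or.inl h)
      · exact Or.inl (Or.inr ⟨h1, δ', h2, rfl⟩)
      · exact Or.inr ⟨h1, δ', h2, rfl⟩
  · rw [hf₅.nvar 50 rfl, hf₄.nvar 50 rfl, hf₃.nvar 50 rfl, hf₂.nvar 50 rfl, j50]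
  · rw [hf₅.nvar 51 rfl, hf₄.nvar 51 rfl, hf₃.nvar 51 rfl, hf₂.nvar 51 rfl, j51]

/-- Extend all cells `(m, b)`, `b ≥ 1`, by edges of length `t`, for `m` and `t` in the variables
`30` and `40`. -/
def pushRow : Prog :=
  .seq (.instr (.nload 41 5 40)) (.seq (mulProg 42 41 5)
    (.seq (.block [.nconst 50 0, .nconst 51 0, .nmove 52 3, .nsub 53 5 30])
      (.seq (.loop (.nlt 52 53) pushBody)
        (.block [.rload 11 2 30, .radd 10 10 11, .nadd 40 40 3]))))

theorem keepsEnv_pushRow : pushRow.KeepsEnv := by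
  refine ⟨fun x hx => ?_, rfl, rfl, rfl⟩
  interval_cases x <;> rfl

/-- Real multiplication is not available; `t` times the tail weight is obtained by adding the tail
weight once whenever `t` increases. -/
theorem runs_pushRow {t : ℕ} (hr : 2 ≤ r) (hn : 2 ≤ n) (hE : Env r n g p s)
    (hI : InLevel r n p s i S) (hm : m < n) (ht : t ≤ Nat.log r n + 1)
    (h30 : s.nvar 30 = m) (h31 : s.nvar 31 = address r n i m 0)
    (h32 : s.nvar 32 = address r n (i + 1) m 0) (h40 : s.nvar 40 = t)
    (h10 : s.rvar 10 = (t : ℝ) * tailWeight p m) :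
    Runs pushRow s (50 * n) fun s' =>
      (InLevel r n p s' i fun x y => S x y ∪
        {δ | ∃ b, 1 ≤ b ∧ m + b ≤ n ∧ δ ∈ pushSet r n i m t b x y}) ∧
      s'.nvar 40 = t + 1 ∧ s'.rvar 10 = ((t + 1 : ℕ) : ℝ) * tailWeight p m := by
  -- The total is at most `42 * n + 15`, which is below `50 * n` because `2 ≤ n`.
  refine Runs.mono (T := 1 + ((3 * (n + 1) + 3) + (4 + (((n - m) * (38 + 1) + 1) + 3)))) ?_
    (by omega) fun _ _ h => h
  refine Runs.seq (Q := fun s' => s'.nvar 41 = r ^ t) (Runs.instr ?_) fun s₁ hf₁ h41 => ?_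
  · simp [Instr.run, h40, hE.pow t ht]
  have hE₁ : Env r n g p s₁ := hE.of_frame hf₁ ⟨fun x hx => by interval_cases x <;> rfl,
      rfl, rfl, rfl⟩
  have hI₁ := hI.of_frame hf₁ (by simp [Prog.anyInstr, Instr.writesNArr]) rfl
  refine Runs.seq ((runs_mulProg hE₁.v3 (by norm_num) (by norm_num) (by norm_num) (by norm_num)
    (by norm_num) (by norm_num)).mono (by rw [hE₁.v5]) fun _ _ h => h) fun s₂ hf₂ h42 => ?_
  rw [hE₁.v5, h41] at h42
  have hE₂ : Env r n g p s₂ := hE₁.of_frame hf₂ ⟨fun x hx => by interval_cases x <;> rfl,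
      rfl, rfl, rfl⟩
  have hI₂ := hI₁.of_frame hf₂ (by simp [mulProg, Prog.block, Prog.anyInstr, Instr.writesNArr]) rfl
  refine Runs.seq (T := 4) (Q := fun s' => s'.nvar 50 = 0 ∧ s'.nvar 51 = 0 ∧ s'.nvar 52 = 1 ∧
    s'.nvar 53 = n + 1 - m) (Runs.block ?_) fun s₃ hf₃ ⟨h50, h51, h52, h53⟩ => ?_
  · simp [Instr.run, hE₂.v3, hE₂.v5, hf₂.nvar 30 rfl, hf₁.nvar 30 rfl, h30]
  have hE₃ : Env r n g p s₃ := hE₂.of_frame hf₃ ⟨fun x hx => by interval_cases x <;> rfl,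
      rfl, rfl, rfl⟩
  have hI₃ := hI₂.of_frame hf₃ (by simp [Prog.block, Prog.anyInstr, Instr.writesNArr]) rfl
  refine Runs.seq (Runs.loop (T := 38) (fun k s' => (InLevel r n p s' i fun x y => S x y ∪
        {δ | ∃ b, 1 ≤ b ∧ b ≤ k ∧ δ ∈ pushSet r n i m t b x y}) ∧
      s'.nvar 50 = k * r ^ t ∧ s'.nvar 51 = k * r ^ t * (n + 1) ∧ s'.nvar 52 = k + 1)
      (n - m) ?_ ?_ ?_) fun s₄ hf₄ ⟨hI₄, _⟩ => ?_
  · refine ⟨hI₃.congr fun x y => ?_, by simpa using h50, by simpa using h51, h52⟩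
    symm
    rw [Set.union_eq_left]
    rintro δ ⟨b, h1, h2, -⟩
    omega
  · rintro k hk s' hf ⟨hI', k50, k51, k52⟩
    have hE' : Env r n g p s' := hE₃.of_frame hf keepsEnv_pushBody.loop
    refine ⟨?_, ?_⟩
    · rw [Test.holds, k52, hf.nvar 53 rfl, h53]
      omega
    refine (runs_pushBody hr hn hE' hI' (m := m) (t := t) (k := k) (by omega) ?_ ?_ ?_ ?_ ?_ ?_ ?_
      k50 k51 k52).mono le_rfl fun s'' _ ⟨hI'', l50, l51, l52⟩ =>
      ⟨hI''.congr fun x y => ?_, l50, l51, l52⟩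
    · rw [hf.nvar 30 rfl, hf₃.nvar 30 rfl, hf₂.nvar 30 rfl, hf₁.nvar 30 rfl, h30]
    · rw [hf.nvar 31 rfl, hf₃.nvar 31 rfl, hf₂.nvar 31 rfl, hf₁.nvar 31 rfl, h31]
    · rw [hf.nvar 32 rfl, hf₃.nvar 32 rfl, hf₂.nvar 32 rfl, hf₁.nvar 32 rfl, h32]
    · rw [hf.nvar 40 rfl, hf₃.nvar 40 rfl, hf₂.nvar 40 rfl, hf₁.nvar 40 rfl, h40]
    · rw [hf.nvar 41 rfl, hf₃.nvar 41 rfl, hf₂.nvar 41 rfl, h41]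
    · rw [hf.nvar 42 rfl, hf₃.nvar 42 rfl, h42]
    · rw [hf.rvar 10 rfl, hf₃.rvar 10 rfl, hf₂.rvar 10 rfl, hf₁.rvar 10 rfl, h10]
    · ext δ
      simp only [Set.mem_union, Set.mem_ofPred_eq]
      constructor
      · rintro ((h | ⟨b, h1, h2, h3⟩) | h)
        exacts [Or.inl h, Or.inr ⟨b, h1, by omega, h3⟩, Or.inr ⟨k + 1, by omega, le_rfl, h⟩]
      · rintro (h | ⟨b, h1, h2, h3⟩)
        · exact Or.inl (Or.inl h)
        · rcases h2.eq_or_lt with rfl | h2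
          exacts [Or.inr h3, Or.inl (Or.inr ⟨b, h1, by omega, h3⟩)]
  · rintro s' hf ⟨-, -, -, k52⟩
    rw [Test.holds, k52, hf.nvar 53 rfl, h53]
    omega
  have e30 : s₄.nvar 30 = m := by
    rw [hf₄.nvar 30 rfl, hf₃.nvar 30 rfl, hf₂.nvar 30 rfl, hf₁.nvar 30 rfl, h30]
  have e40 : s₄.nvar 40 = t := by
    rw [hf₄.nvar 40 rfl, hf₃.nvar 40 rfl, hf₂.nvar 40 rfl, hf₁.nvar 40 rfl, h40]
  have e10 : s₄.rvar 10 = (t : ℝ) * tailWeight p m := by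
    rw [hf₄.rvar 10 rfl, hf₃.rvar 10 rfl, hf₂.rvar 10 rfl, hf₁.rvar 10 rfl, h10]
  have hE₄ : Env r n g p s₄ := hE₃.of_frame hf₄ keepsEnv_pushBody.loop
  refine (Runs.block (Q := fun s' => s'.nvar 40 = t + 1 ∧
    s'.rvar 10 = ((t + 1 : ℕ) : ℝ) * tailWeight p m) ?_).mono le_rfl fun s₅ hf₅ h =>
    ⟨(hI₄.of_frame hf₅ (by simp [Prog.block, Prog.anyInstr, Instr.writesNArr]) rfl).congr
      fun x y => ?_, h⟩
  · simp [Instr.run, e30, e40, e10, hE₄.v3, hE₄.w m hm.le]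
    ring
  · ext δ
    simp only [Set.mem_union, Set.mem_ofPred_eq]
    refine or_congr_right ⟨?_, ?_⟩
    · rintro ⟨b, h1, h2, h3⟩
      exact ⟨b, h1, by omega, h3⟩
    · rintro ⟨b, h1, h2, h3⟩
      exact ⟨b, h1, by omega, h3⟩

/-- Extend all cells `(m, b)`, `b ≥ 1`, for `m` in the variable `30`. -/
def pushRows : Prog :=
  .seq (.block [.nconst 40 0, .rzero 10]) (.loop (.nlt 40 4) pushRow)

theorem runs_pushRows (hr : 2 ≤ r) (hn : 2 ≤ n) (hE : Env r n g p s)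
    (hI : InLevel r n p s i S) (hm : m < n) (h30 : s.nvar 30 = m)
    (h31 : s.nvar 31 = address r n i m 0) (h32 : s.nvar 32 = address r n (i + 1) m 0) :
    Runs pushRows s (2 + ((Nat.log r n + 2) * (50 * n + 1) + 1)) fun s' =>
      InLevel r n p s' i fun x y => S x y ∪ {δ | ∃ t ≤ Nat.log r n + 1, ∃ b, 1 ≤ b ∧ m + b ≤ n ∧
        δ ∈ pushSet r n i m t b x y} := by
  refine Runs.seq (T := 2) (Q := fun s' => s'.nvar 40 = 0 ∧ s'.rvar 10 = 0) (Runs.block ?_)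
    fun s₁ hf₁ ⟨h40, h10⟩ => ?_
  · simp [Instr.run]
  have hE₁ : Env r n g p s₁ := hE.of_frame hf₁ ⟨fun x hx => by interval_cases x <;> rfl,
      rfl, rfl, rfl⟩
  have hI₁ := hI.of_frame hf₁ (by simp [Prog.block, Prog.anyInstr, Instr.writesNArr]) rfl
  refine (Runs.loop (T := 50 * n) (fun k s' => (InLevel r n p s' i fun x y => S x y ∪
        {δ | ∃ t < k, ∃ b, 1 ≤ b ∧ m + b ≤ n ∧ δ ∈ pushSet r n i m t b x y}) ∧
      s'.nvar 40 = k ∧ s'.rvar 10 = (k : ℝ) * tailWeight p m)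
      (Nat.log r n + 2) ?_ ?_ ?_).mono le_rfl fun s₂ _ h => h.1.congr fun x y => ?_
  · refine ⟨hI₁.congr fun x y => ?_, h40, by simpa using h10⟩
    symm
    rw [Set.union_eq_left]
    rintro δ ⟨t, h1, -⟩
    omega
  · rintro k hk s' hf ⟨hI', k40, k10⟩
    have hE' : Env r n g p s' := hE₁.of_frame hf keepsEnv_pushRow.loop
    refine ⟨?_, ?_⟩
    · rw [Test.holds, k40, hE'.v4]
      omega
    refine (runs_pushRow hr hn hE' hI' hm (t := k) (by omega) ?_ ?_ ?_ k40 k10).mono le_rfl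
      fun s'' _ ⟨hI'', l40, l10⟩ => ⟨hI''.congr fun x y => ?_, l40, l10⟩
    · rw [hf.nvar 30 rfl, hf₁.nvar 30 rfl, h30]
    · rw [hf.nvar 31 rfl, hf₁.nvar 31 rfl, h31]
    · rw [hf.nvar 32 rfl, hf₁.nvar 32 rfl, h32]
    · ext δ
      simp only [Set.mem_union, Set.mem_ofPred_eq]
      constructor
      · rintro ((h | ⟨t, h1, h3⟩) | h)
        exacts [Or.inl h, Or.inr ⟨t, by omega, h3⟩, Or.inr ⟨k, by omega, h⟩]
      · rintro (h | ⟨t, h1, h3⟩)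
        · exact Or.inl (Or.inl h)
        · rcases (Nat.lt_succ_iff.1 h1).eq_or_lt with rfl | h2
          exacts [Or.inr h3, Or.inl (Or.inr ⟨t, h2, h3⟩)]
  · rintro s' hf ⟨-, k40, -⟩
    have hE' : Env r n g p s' := hE₁.of_frame hf keepsEnv_pushRow.loop
    rw [Test.holds, k40, hE'.v4]
    omega
  · ext δ
    simp only [Set.mem_union, Set.mem_ofPred_eq]
    refine or_congr_right ⟨?_, ?_⟩
    · rintro ⟨t, h1, h3⟩
      exact ⟨t, by omega, h3⟩
    · rintro ⟨t, h1, h3⟩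
      exact ⟨t, by omega, h3⟩

/-- Extend all cells `(m, b)`, `b ≥ 1`. -/
def pushAll : Prog :=
  .seq (.block [.nconst 30 0, .nmove 31 21, .nmove 32 22])
    (.loop (.nlt 30 0) (.seq pushRows (.block [.nadd 30 30 3, .nadd 31 31 5, .nadd 32 32 5])))

theorem keepsEnv_pushAll : pushAll.KeepsEnv := by
  refine ⟨fun x hx => ?_, rfl, rfl, rfl⟩
  interval_cases x <;> rfl

theorem runs_pushAll (hr : 2 ≤ r) (hn : 2 ≤ n) (hE : Env r n g p s)
    (hI : InLevel r n p s i S) (h21 : s.nvar 21 = address r n i 0 0)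
    (h22 : s.nvar 22 = address r n (i + 1) 0 0) :
    Runs pushAll s (3 + (n * ((Nat.log r n + 2) * (50 * n + 1) + 7) + 1)) fun s' =>
      InLevel r n p s' i fun x y => S x y ∪ {δ | ∃ m < n, ∃ t ≤ Nat.log r n + 1, ∃ b, 1 ≤ b ∧
        m + b ≤ n ∧ δ ∈ pushSet r n i m t b x y} := by
  refine Runs.seq (T := 3) (Q := fun s' => s'.nvar 30 = 0 ∧ s'.nvar 31 = address r n i 0 0 ∧
    s'.nvar 32 = address r n (i + 1) 0 0) (Runs.block ?_) fun s₁ hf₁ ⟨h30, h31, h32⟩ => ?_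
  · simp [Instr.run, h21, h22]
  have hE₁ : Env r n g p s₁ := hE.of_frame hf₁ ⟨fun x hx => by interval_cases x <;> rfl,
      rfl, rfl, rfl⟩
  have hI₁ := hI.of_frame hf₁ (by simp [Prog.block, Prog.anyInstr, Instr.writesNArr]) rfl
  refine (Runs.loop (T := (2 + ((Nat.log r n + 2) * (50 * n + 1) + 1)) + 3)
      (fun k s' => (InLevel r n p s' i fun x y => S x y ∪
        {δ | ∃ m < k, ∃ t ≤ Nat.log r n + 1, ∃ b, 1 ≤ b ∧ m + b ≤ n ∧
          δ ∈ pushSet r n i m t b x y}) ∧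
      s'.nvar 30 = k ∧ s'.nvar 31 = address r n i k 0 ∧ s'.nvar 32 = address r n (i + 1) k 0)
      n ?_ ?_ ?_).mono (by apply le_of_eq; ring) fun s₂ _ h => h.1
  · refine ⟨hI₁.congr fun x y => ?_, h30, h31, h32⟩
    symm
    rw [Set.union_eq_left]
    rintro δ ⟨t, h1, -⟩
    omega
  · rintro k hk s' hf ⟨hI', k30, k31, k32⟩
    have hE' : Env r n g p s' := hE₁.of_frame hf ⟨fun x hx => by interval_cases x <;> rfl,
      rfl, rfl, rfl⟩
    refine ⟨?_, ?_⟩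
    · rw [Test.holds, k30, hE'.v0]
      exact hk
    refine Runs.seq (runs_pushRows hr hn hE' hI' hk k30 k31 k32) fun s₃ hf₃ hI₃ => ?_
    refine (Runs.block (Q := fun s' => s'.nvar 30 = k + 1 ∧
      s'.nvar 31 = address r n i k 0 + (n + 1) ∧ s'.nvar 32 = address r n (i + 1) k 0 + (n + 1))
      ?_).mono le_rfl fun s₄ hf₄ ⟨l30, l31, l32⟩ => ⟨(hI₃.of_frame hf₄
      (by simp [Prog.block, Prog.anyInstr, Instr.writesNArr]) rfl).congr fun x y => ?_, l30, ?_, ?_⟩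
    · simp [Instr.run, hf₃.nvar 30 rfl, hf₃.nvar 31 rfl, hf₃.nvar 32 rfl, hf₃.nvar 3 rfl,
        hf₃.nvar 5 rfl, k30, k31, k32, hE'.v3, hE'.v5]
    · ext δ
      simp only [Set.mem_union, Set.mem_ofPred_eq]
      constructor
      · rintro ((h | ⟨t, h1, h3⟩) | h)
        exacts [Or.inl h, Or.inr ⟨t, by omega, h3⟩, Or.inr ⟨k, by omega, h⟩]
      · rintro (h | ⟨t, h1, h3⟩)
        · exact Or.inl (Or.inl h)
        · rcases (Nat.lt_succ_iff.1 h1).eq_or_lt with rfl | h2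
          exacts [Or.inr h3, Or.inl (Or.inr ⟨t, h2, h3⟩)]
    · rw [l31, address_eq r n i k 0, address_eq r n i (k + 1) 0]
      ring
    · rw [l32, address_eq r n (i + 1) k 0, address_eq r n (i + 1) (k + 1) 0]
      ring
  · rintro s' hf ⟨-, k30, -⟩
    have hE' : Env r n g p s' := hE₁.of_frame hf ⟨fun x hx => by interval_cases x <;> rfl,
      rfl, rfl, rfl⟩
    rw [Test.holds, k30, hE'.v0]
    omega

end

section

variable {r n g i m b : ℕ} {p : Fin n → ℝ} {s : Store} {S : ℕ → ℕ → Set (ℕ → ℝ)}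

/-! ### The sweep that turns internal nodes into leaves. -/

/-- Turn one internal node into a leaf, for all signatures `(m - 1, b + 1)`, `b ≥ 1`, with `m` in
the variable `30`. -/
def dropRow : Prog :=
  .seq (.block [.nmove 40 3, .nsub 41 5 30]) (.loop (.nlt 40 41)
    (.seq (.block [.nadd 62 32 40, .nsub 60 62 0]) (.seq (loadRegs 60) (.seq (relaxProg 62)
      (.instr (.nadd 40 40 3))))))

theorem runs_dropRow (hn : 2 ≤ n) (hE : Env r n g p s) (hI : InLevel r n p s i S)
    (hm : m + 1 < n) (h30 : s.nvar 30 = m + 1) (h32 : s.nvar 32 = address r n (i + 1) (m + 1) 0) :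
    Runs dropRow s (20 * n) fun s' => InLevel r n p s' i fun x y => S x y ∪
      {δ | x = m + 1 ∧ 1 ≤ y ∧ x + y ≤ n ∧ δ ∈ S m (y + 1)} := by
  refine Runs.mono (T := 2 + ((n - (m + 1)) * (18 + 1) + 1)) ?_ (by omega) fun _ _ h => h
  refine Runs.seq (Q := fun s' => s'.nvar 40 = 1 ∧ s'.nvar 41 = n + 1 - (m + 1)) (Runs.block ?_)
    fun s₁ hf₁ ⟨h40, h41⟩ => ?_
  · simp [Instr.run, hE.v3, hE.v5, h30]
  have hE₁ : Env r n g p s₁ := hE.of_frame hf₁ ⟨fun x hx => by interval_cases x <;> rfl,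
      rfl, rfl, rfl⟩
  have hI₁ := hI.of_frame hf₁ (by simp [Prog.block, Prog.anyInstr, Instr.writesNArr]) rfl
  have hmn : m + 1 < n * (r + 1) := by
    rw [mul_add, mul_one]
    omega
  refine (Runs.loop (T := 18) (fun k s' => (InLevel r n p s' i fun x y => S x y ∪
        {δ | x = m + 1 ∧ 1 ≤ y ∧ y ≤ k ∧ δ ∈ S m (y + 1)}) ∧ s'.nvar 40 = k + 1)
      (n - (m + 1)) ?_ ?_ ?_).mono le_rfl fun s₂ _ h => h.1.congr fun x y => ?_
  · refine ⟨hI₁.congr fun x y => ?_, h40⟩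
    symm
    rw [Set.union_eq_left]
    rintro δ ⟨-, h1, h2, -⟩
    omega
  · rintro k hk s' hf ⟨hI', k40⟩
    have hE' : Env r n g p s' := hE₁.of_frame hf ⟨fun x hx => by interval_cases x <;> rfl,
      rfl, rfl, rfl⟩
    refine ⟨?_, ?_⟩
    · rw [Test.holds, k40, hf.nvar 41 rfl, h41]
      omega
    -- One row back and one column forward changes an address by `-(n + 1) + 1 = -n`, hence the
    -- subtraction of variable `0`.
    refine Runs.seq (T := 2) (T' := 16) (Q := fun s' =>
      s'.nvar 62 = address r n (i + 1) (m + 1) (k + 1) ∧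
      s'.nvar 60 = address r n (i + 1) m (k + 2)) (Runs.block ?_) fun s₂ hf₂ ⟨h62, h60⟩ => ?_
    · simp only [List.foldl, Instr.run, Function.update_self, ne_eq, Nat.reduceEqDiff,
        not_false_eq_true, Function.update_of_ne, k40, hf.nvar 32 rfl, hf₁.nvar 32 rfl, h32,
        OfNat.zero_ne_ofNat, hE'.v0, address_eq r n (i + 1) (m + 1) 0,
        address_eq r n (i + 1) (m + 1) (k + 1), address_eq r n (i + 1) m (k + 2)]
      rw [add_mul]
      omega
    have hE₂ : Env r n g p s₂ := hE'.of_frame hf₂ ⟨fun x hx => by interval_cases x <;> rfl,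
      rfl, rfl, rfl⟩
    have hI₂ := hI'.of_frame hf₂ (by simp [Prog.block, Prog.anyInstr, Instr.writesNArr]) rfl
    refine Runs.seq (T := 5) (T' := 11) (runs_loadRegs (src := 60) (by norm_num) hI₂
      (m := m) (b := k + 2) (by omega) (by omega) h60) fun s₃ hf₃ ⟨hI₃, hX₃⟩ => ?_
    refine Runs.seq (T := 10) (T' := 1) (runs_relaxProg (d := 62) (by norm_num)
        ((hf₃.nvar 12 rfl).trans hE₂.v12) hI₃ hmn (by omega : k + 1 ≤ n)
        ((hf₃.nvar 62 rfl).trans h62) hX₃) fun s₄ hf₄ ⟨hI₄, _⟩ => ?_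
    refine (Runs.instr (Q := fun s' => s'.nvar 40 = k + 1 + 1) ?_).mono le_rfl fun s₅ hf₅ l40 =>
      ⟨(hI₄.of_frame hf₅ (by simp [Prog.anyInstr, Instr.writesNArr]) rfl).congr fun x y => ?_, l40⟩
    · simp [Instr.run, hf₄.nvar 40 rfl, hf₃.nvar 40 rfl, hf₂.nvar 40 rfl, k40, hf₄.nvar 3 rfl,
        hf₃.nvar 3 rfl, hE₂.v3]
    · ext δ
      simp only [addSet, Set.mem_union, Set.mem_ofPred_eq]
      constructor
      · rintro ((h | ⟨h1, h2, h3, h4⟩) | ⟨rfl, rfl, h | h⟩)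
        · exact Or.inl h
        · exact Or.inr ⟨h1, h2, by omega, h4⟩
        · exact Or.inr ⟨rfl, by omega, le_rfl, h⟩
        · omega
      · rintro (h | ⟨h1, h2, h3, h4⟩)
        · exact Or.inl (Or.inl h)
        · rcases h3.eq_or_lt with rfl | h3
          · exact Or.inr ⟨h1, rfl, Or.inl h4⟩
          · exact Or.inl (Or.inr ⟨h1, h2, by omega, h4⟩)
  · rintro s' hf ⟨-, k40⟩
    rw [Test.holds, k40, hf.nvar 41 rfl, h41]
    omega
  · ext δ
    simp only [Set.mem_union, Set.mem_ofPred_eq]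
    refine or_congr_right ⟨?_, ?_⟩
    · rintro ⟨h1, h2, h3, h4⟩
      exact ⟨h1, h2, by omega, h4⟩
    · rintro ⟨h1, h2, h3, h4⟩
      exact ⟨h1, h2, by omega, h4⟩

/-- Turn internal nodes into leaves, for all signatures in which at least one remains. -/
def dropAll : Prog :=
  .seq (.block [.nmove 30 3, .nadd 32 22 5])
    (.loop (.nlt 30 0) (.seq dropRow (.block [.nadd 30 30 3, .nadd 32 32 5])))

theorem keepsEnv_dropAll : dropAll.KeepsEnv := by
  refine ⟨fun x hx => ?_, rfl, rfl, rfl⟩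
  interval_cases x <;> rfl

/-- Rows are treated in increasing order, since row `k + 1` reads the finished row `k`. Row `0` is
complete from the start, and from row `n` on all sets with `1 ≤ y` are empty. -/
theorem runs_dropAll (hr : 2 ≤ r) (hn : 2 ≤ n) (hE : Env r n g p s)
    (hI : InLevel r n p s i (pushedSet r n i)) (h22 : s.nvar 22 = address r n (i + 1) 0 0) :
    Runs dropAll s (2 + (n * (20 * n + 3) + 1)) fun s' =>
      InLevel r n p s' i (reach r n (i + 1)) := by
  refine Runs.mono (T := 2 + ((n - 1) * (20 * n + 3) + 1)) ?_ ?_ fun _ _ h => h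
  swap
  · have := Nat.mul_le_mul_right (20 * n + 3) (Nat.sub_le n 1)
    omega
  refine Runs.seq (Q := fun s' => s'.nvar 30 = 1 ∧ s'.nvar 32 = address r n (i + 1) 1 0)
    (Runs.block ?_) fun s₁ hf₁ ⟨h30, h32⟩ => ?_
  · simp [Instr.run, hE.v3, hE.v5, h22, address_eq r n (i + 1) 1 0]
  have hE₁ : Env r n g p s₁ := hE.of_frame hf₁ ⟨fun x hx => by interval_cases x <;> rfl,
      rfl, rfl, rfl⟩
  have hI₁ := hI.of_frame hf₁ (by simp [Prog.block, Prog.anyInstr, Instr.writesNArr]) rfl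
  refine (Runs.loop (T := 20 * n + 2) (fun k s' => (InLevel r n p s' i fun x y =>
      if 1 ≤ y ∧ x ≤ k then reach r n (i + 1) x y else pushedSet r n i x y) ∧
      s'.nvar 30 = k + 1 ∧ s'.nvar 32 = address r n (i + 1) (k + 1) 0)
      (n - 1) ?_ ?_ ?_).mono le_rfl fun s₂ _ h => h.1.congr fun x y => ?_
  · refine ⟨hI₁.congr fun x y => ?_, h30, h32⟩
    split_ifs with h
    · obtain rfl : x = 0 := by omega
      rw [reach_succ_eq_zero_left hn h.1]
    · rfl
  · rintro k hk s' hf ⟨hI', k30, k32⟩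
    have hE' : Env r n g p s' := hE₁.of_frame hf ⟨fun x hx => by interval_cases x <;> rfl,
      rfl, rfl, rfl⟩
    refine ⟨?_, ?_⟩
    · rw [Test.holds, k30, hE'.v0]
      omega
    refine Runs.seq (runs_dropRow hn hE' hI' (m := k) (by omega) k30 k32) fun s₃ hf₃ hI₃ => ?_
    refine (Runs.block (Q := fun s' => s'.nvar 30 = k + 1 + 1 ∧
      s'.nvar 32 = address r n (i + 1) (k + 1) 0 + (n + 1)) ?_).mono le_rfl
      fun s₄ hf₄ ⟨l30, l32⟩ => ⟨(hI₃.of_frame hf₄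
      (by simp [Prog.block, Prog.anyInstr, Instr.writesNArr]) rfl).congr fun x y => ?_, l30, ?_⟩
    · simp [Instr.run, hf₃.nvar 30 rfl, hf₃.nvar 32 rfl, hf₃.nvar 3 rfl,
        hf₃.nvar 5 rfl, k30, k32, hE'.v3, hE'.v5]
    · by_cases hxy : x = k + 1 ∧ 1 ≤ y ∧ x + y ≤ n
      · obtain ⟨rfl, h1, h2⟩ := hxy
        rw [if_neg (by omega), if_pos (⟨by omega, le_rfl⟩ : 1 ≤ y + 1 ∧ k ≤ k),
          if_pos (⟨h1, le_rfl⟩ : 1 ≤ y ∧ k + 1 ≤ k + 1), reach_succ_eq_union hn h1 h2]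
        congr 1
        ext δ
        simp [h1, h2]
      · have : {δ | x = k + 1 ∧ 1 ≤ y ∧ x + y ≤ n ∧
            δ ∈ if 1 ≤ y + 1 ∧ k ≤ k then reach r n (i + 1) k (y + 1)
              else pushedSet r n i k (y + 1)} = ∅ :=
          Set.eq_empty_iff_forall_notMem.2 fun δ hδ => hxy ⟨hδ.1, hδ.2.1, hδ.2.2.1⟩
        rw [this, Set.union_empty]
        by_cases h1 : 1 ≤ y ∧ x ≤ k
        · rw [if_pos h1, if_pos ⟨h1.1, by omega⟩]
        · rw [if_neg h1]
          split_ifs with h2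
          -- This is the part of row `k + 1` beyond the diagonal `x + y = n`, which the sweep does
          -- not visit.
          · rw [reach_succ_of_lt h2.1 (by omega), pushedSet_of_lt h2.1 (by omega)]
          · rfl
    · rw [l32, address_eq r n (i + 1) (k + 1) 0, address_eq r n (i + 1) (k + 1 + 1) 0]
      ring
  · rintro s' hf ⟨-, k30, -⟩
    have hE' : Env r n g p s' := hE₁.of_frame hf ⟨fun x hx => by interval_cases x <;> rfl,
      rfl, rfl, rfl⟩
    rw [Test.holds, k30, hE'.v0]
    omega
  · split_ifs with h
    · rfl
    · rcases Nat.eq_zero_or_pos y with rfl | hy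
      · rw [reach_succ_zero hr hn]
      · rw [reach_succ_of_lt hy (by omega), pushedSet_of_lt hy (by omega)]

/-! ### Final signatures and the whole level. -/

/-- Transfer the cells `(x, 0)` for all `x` for which this is a valid signature. -/
def finals (doff doff' dinc : ℕ) : Prog :=
  .seq (finalsRange 0 10 7 doff dinc) (finalsRange 8 11 9 doff' dinc)

theorem keepsEnv_finals (doff doff' dinc : ℕ) : (finals doff doff' dinc).KeepsEnv :=
  (keepsEnv_finalsRange _ _ _ _ _).seq (keepsEnv_finalsRange _ _ _ _ _)

theorem runs_finals {doff doff' dinc e : ℕ} (hdoff : doff < 13) (hdoff' : doff' < 13)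
    (hdinc : dinc < 13) (hr : 2 ≤ r) (hn : 2 ≤ n) (hE : Env r n g p s) (hI : InLevel r n p s i S)
    (h21 : s.nvar 21 = address r n i 0 0) (h22 : s.nvar 22 = address r n (i + 1) 0 0)
    (vdoff : s.nvar doff = e * n * (n + 1))
    (vdoff' : s.nvar doff' = e * r ^ (Nat.log r n + 1) * (n + 1))
    (vdinc : s.nvar dinc = e * (n + 1)) (he : e ≤ 1) :
    Runs (finals doff doff' dinc) s (40 * n + 8) fun s' => InLevel r n p s' i fun x y => S x y ∪
      {δ | y = 0 ∧ ∃ z, Final r n z ∧ x = e * z ∧ δ ∈ reach r n i z 0} := by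
  have h1 := pow_log_le (r := r) hn
  have h2 := pow_log_succ_le (r := r) hn
  have h3 : n * (r + 1) = n * r + n := by ring
  have h4 : n * 2 ≤ n * r := Nat.mul_le_mul_left _ hr
  refine Runs.mono (T := ((n + r ^ Nat.log r n - n) * 20 + 4) +
    ((r ^ (Nat.log r n + 1) + n - r ^ (Nat.log r n + 1)) * 20 + 4)) ?_ (by omega) fun _ _ h => h
  refine Runs.seq (runs_finalsRange (by norm_num) (by norm_num) hdoff hdinc hE hI h21 h22
    hE.v0 hE.v10 hE.v7 vdoff vdinc he (by omega) (by omega)) fun s₁ hf₁ hI₁ => ?_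
  have hK := keepsEnv_finalsRange 0 10 7 doff dinc
  have hE₁ := hE.of_frame hf₁ hK
  refine (runs_finalsRange (by norm_num) (by norm_num) hdoff' hdinc hE₁ hI₁
    ((hf₁.nvar 21 rfl).trans h21) ((hf₁.nvar 22 rfl).trans h22) hE₁.v8 hE₁.v11 hE₁.v9
    ((hf₁.nvar _ (hK.1 _ hdoff')).trans vdoff') ((hf₁.nvar _ (hK.1 _ hdinc)).trans vdinc) he
    (by omega) (by omega)).mono le_rfl fun s₂ _ hI₂ => hI₂.congr fun x y => ?_
  ext δ
  simp only [Set.mem_union, Set.mem_ofPred_eq]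
  constructor
  · rintro ((h | ⟨a1, z, a2, a3, a4⟩) | ⟨a1, z, a2, a3, a4⟩)
    exacts [Or.inl h, Or.inr ⟨a1, z, Or.inl ⟨a2, a3⟩, a4⟩, Or.inr ⟨a1, z, Or.inr ⟨a2, a3⟩, a4⟩]
  · rintro (h | ⟨a1, z, ⟨a2, a3⟩ | ⟨a2, a3⟩, a4⟩)
    exacts [Or.inl (Or.inl h), Or.inl (Or.inr ⟨a1, z, a2, a3, a4⟩), Or.inr ⟨a1, z, a2, a3, a4⟩]

/-- Compute a level of the table from the level above it. -/
def levelStep : Prog := .seq (finals 10 11 5) (.seq pushAll dropAll)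

theorem keepsEnv_levelStep : levelStep.KeepsEnv :=
  (keepsEnv_finals _ _ _).seq (keepsEnv_pushAll.seq keepsEnv_dropAll)

theorem runs_levelStep (hr : 2 ≤ r) (hn : 2 ≤ n) (hE : Env r n g p s)
    (hI : InLevel r n p s i fun _ _ => ∅) (h21 : s.nvar 21 = address r n i 0 0)
    (h22 : s.nvar 22 = address r n (i + 1) 0 0) :
    Runs levelStep s (200 * (n ^ 2 * (Nat.log r n + 2))) fun s' =>
      InLevel r n p s' (i + 1) fun _ _ => ∅ := by
  refine Runs.mono (T := (40 * n + 8) + ((3 + (n * ((Nat.log r n + 2) * (50 * n + 1) + 7) + 1)) +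
    (2 + (n * (20 * n + 3) + 1)))) ?_ ?_ fun _ _ h => h
  swap
  -- The dominant term is `50 * n ^ 2 * (L + 2)` from pushing; the sweep is quadratic and is
  -- absorbed as `2 ≤ L + 2`.
  · generalize Nat.log r n = L
    have h1 : n * 2 ≤ n * n := Nat.mul_le_mul_left _ hn
    have h2 : n * n * 2 ≤ n * n * (L + 2) := Nat.mul_le_mul_left _ (by omega)
    have h3 : n * 2 * (L + 2) ≤ n * n * (L + 2) := Nat.mul_le_mul_right _ h1
    nlinarith
  refine Runs.seq (runs_finals (e := 1) (by norm_num) (by norm_num) (by norm_num) hr hn hE hI h21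
    h22 (by rw [hE.v10]; ring) (by rw [hE.v11]; ring) (by rw [hE.v5]; ring) le_rfl)
    fun s₁ hf₁ hI₁ => ?_
  have hE₁ := hE.of_frame hf₁ (keepsEnv_finals _ _ _)
  refine Runs.seq (runs_pushAll hr hn hE₁ hI₁ ((hf₁.nvar 21 rfl).trans h21)
    ((hf₁.nvar 22 rfl).trans h22)) fun s₂ hf₂ hI₂ => ?_
  have hE₂ := hE₁.of_frame hf₂ keepsEnv_pushAll
  refine (runs_dropAll hr hn hE₂ (hI₂.congr fun x y => ?_) (by
    rw [hf₂.nvar 22 rfl, hf₁.nvar 22 rfl, h22])).mono le_rfl fun s₃ _ h => h.next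
  ext δ
  simp only [pushedSet, Set.mem_union, Set.mem_ofPred_eq, one_mul, Set.mem_empty_iff_false,
    false_or]
  refine or_congr_left ⟨?_, ?_⟩
  · rintro ⟨h1, z, h2, rfl, h3⟩
    exact ⟨h1, h2, h3⟩
  · rintro ⟨h1, h2, h3⟩
    exact ⟨h1, x, h2, rfl, h3⟩

end

section

variable {r n g : ℕ} {p : Fin n → ℝ} {s : Store}

/-! ### The constants -/

theorem tailWeight_of_le {m : ℕ} (hm : n ≤ m) : tailWeight p m = 0 :=
  Finset.sum_eq_zero fun q _ => if_neg (by omega)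

theorem tailWeight_eq_add {m : ℕ} (hm : m < n) :
    tailWeight p m = tailWeight p (m + 1) + pad p m := by
  have h : pad p m = ∑ q : Fin n, if (q : ℕ) = m then p q else 0 := by
    rw [Finset.sum_eq_single (⟨m, hm⟩ : Fin n)]
    · simp [pad, hm]
    · intro q _ hq
      rw [if_neg]
      rintro rfl
      exact hq rfl
    · simp
  rw [h, tailWeight, tailWeight, ← Finset.sum_add_distrib]
  refine Finset.sum_congr rfl fun q _ => ?_
  split_ifs <;> first | omega | simp

/-- Compute the powers of `r`, up to the first one above `n`. -/
def powersProg : Prog :=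
  .seq (.block [.nconst 8 1, .nstore 5 4 8])
    (.seq (.loop (.nlt 8 5) (.seq (.instr (.nmove 7 8)) (.seq (mulProg 22 1 8)
      (.block [.nmove 8 22, .nadd 4 4 3, .nstore 5 4 8]))))
      (.block [.nadd 4 4 3, .nadd 7 7 0, .nadd 9 8 0]))

theorem runs_powersProg (hr : 2 ≤ r) (hn : 2 ≤ n) (h0 : s.nvar 0 = n) (h1 : s.nvar 1 = r)
    (h3 : s.nvar 3 = 1) (h4 : s.nvar 4 = 0) (h5 : s.nvar 5 = n + 1) :
    Runs powersProg s (2 + (((Nat.log r n + 1) * (3 * n + 8) + 1) + 3)) fun s' =>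
      s'.nvar 4 = Nat.log r n + 2 ∧ s'.nvar 7 = n + r ^ Nat.log r n ∧
      s'.nvar 8 = r ^ (Nat.log r n + 1) ∧ s'.nvar 9 = r ^ (Nat.log r n + 1) + n ∧
      ∀ t ≤ Nat.log r n + 1, s'.narr 5 t = r ^ t := by
  refine Runs.seq (Q := fun s' => s'.nvar 8 = 1 ∧ s'.narr 5 0 = 1) (Runs.block ?_)
    fun s₁ hf₁ ⟨k8, k5⟩ => ?_
  · simp [Instr.run, h4]
  -- Variable `7` holds the power before the current one, so that it ends as `r ^ ⌊log_r n⌋`; before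
  -- the first round it has no meaning, which is why the invariant is vacuous for `k = 0`. In each
  -- round the loop of the multiplication runs over `r ^ k ≤ n`.
  refine Runs.seq (Runs.loop (T := 3 * n + 7) (fun k s' => s'.nvar 8 = r ^ k ∧ s'.nvar 4 = k ∧
    s'.nvar 7 = (if k = 0 then s'.nvar 7 else r ^ (k - 1)) ∧ ∀ t ≤ k, s'.narr 5 t = r ^ t)
    (Nat.log r n + 1) ?_ ?_ ?_) fun s₂ hf₂ ⟨j8, j4, j7, j5⟩ => ?_
  · refine ⟨by simpa using k8, (hf₁.nvar 4 rfl).trans h4, by simp, fun t ht => ?_⟩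
    obtain rfl : t = 0 := by omega
    simpa using k5
  · rintro k hk s' hf ⟨j8, j4, -, j5⟩
    have hle : r ^ k ≤ n :=
      (Nat.pow_le_pow_right (by omega) (by omega : k ≤ Nat.log r n)).trans (pow_log_le hn)
    have e5 : s'.nvar 5 = n + 1 := by rw [hf.nvar 5 rfl, hf₁.nvar 5 rfl, h5]
    have e3 : s'.nvar 3 = 1 := by rw [hf.nvar 3 rfl, hf₁.nvar 3 rfl, h3]
    have e1 : s'.nvar 1 = r := by rw [hf.nvar 1 rfl, hf₁.nvar 1 rfl, h1]
    refine ⟨?_, ?_⟩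
    · rw [Test.holds, j8, e5]
      omega
    refine Runs.mono (T := 1 + ((3 * r ^ k + 3) + 3)) ?_ (by omega) fun _ _ h => h
    refine Runs.seq (Q := fun s' => s'.nvar 7 = r ^ k) (Runs.instr (by simp [Instr.run, j8]))
      fun s₃ hf₃ l7 => ?_
    refine Runs.seq ((runs_mulProg ((hf₃.nvar 3 rfl).trans e3) (by norm_num) (by norm_num)
      (by norm_num) (by norm_num) (by norm_num) (by norm_num)).mono
      (by rw [hf₃.nvar 8 rfl, j8]) fun _ _ h => h) fun s₄ hf₄ l22 => ?_
    rw [hf₃.nvar 1 rfl, e1, hf₃.nvar 8 rfl, j8, mul_comm, ← pow_succ] at l22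
    refine Runs.block ?_
    have a4 : s₄.nvar 4 = k := by rw [hf₄.nvar 4 rfl, hf₃.nvar 4 rfl, j4]
    have a3 : s₄.nvar 3 = 1 := by rw [hf₄.nvar 3 rfl, hf₃.nvar 3 rfl, e3]
    refine ⟨by simp [Instr.run, l22], by simp [Instr.run, a4, a3],
      by simp [Instr.run, hf₄.nvar 7 rfl, l7], fun t ht => ?_⟩
    rcases ht.eq_or_lt with rfl | ht
    · simp [Instr.run, l22, a4, a3]
    · have hne : t ≠ k + 1 := by omega
      simp [Instr.run, a4, a3, hne, hf₄.narr 5 rfl, hf₃.narr 5 rfl, j5 t (by omega)]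
  · rintro s' hf ⟨j8, -⟩
    rw [Test.holds, j8, hf.nvar 5 rfl, hf₁.nvar 5 rfl, h5]
    have := lt_pow_log_succ hr n
    omega
  · rw [if_neg (by omega), Nat.add_sub_cancel] at j7
    have e3 : s₂.nvar 3 = 1 := by rw [hf₂.nvar 3 rfl, hf₁.nvar 3 rfl, h3]
    have e0 : s₂.nvar 0 = n := by rw [hf₂.nvar 0 rfl, hf₁.nvar 0 rfl, h0]
    refine (Runs.block (Q := fun s' => s'.nvar 4 = Nat.log r n + 2 ∧
      s'.nvar 7 = n + r ^ Nat.log r n ∧ s'.nvar 9 = r ^ (Nat.log r n + 1) + n) ?_).mono le_rfl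
      fun s₃ hf₃ ⟨l4, l7, l9⟩ => ⟨l4, l7, by rw [hf₃.nvar 8 rfl, j8], l9,
        by rw [hf₃.narr 5 rfl]; exact j5⟩
    simp [Instr.run, j4, j7, j8, e3, e0, add_comm]
    omega

/-- Compute the tail weights. -/
def tailsProg : Prog :=
  .seq (.instr (.nmove 20 0)) (.loop (.nlt 12 20)
    (.block [.nsub 20 20 3, .rload 3 0 20, .radd 2 2 3, .rstore 2 20 2]))

/-- The weights are summed from the last one backwards. -/
theorem runs_tailsProg (h0 : s.nvar 0 = n) (h3 : s.nvar 3 = 1) (h12 : s.nvar 12 = 0)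
    (hr2 : s.rvar 2 = 0) (ha0 : ∀ m, s.rarr 0 m = pad p m) (ha2 : s.rarr 2 n = 0) :
    Runs tailsProg s (1 + (n * 5 + 1)) fun s' => ∀ m ≤ n, s'.rarr 2 m = tailWeight p m := by
  refine Runs.seq (Q := fun s' => s'.nvar 20 = n) (Runs.instr (by simp [Instr.run, h0]))
    fun s₁ hf₁ h20 => ?_
  refine (Runs.loop (T := 4) (fun k s' => s'.nvar 20 = n - k ∧
    s'.rvar 2 = tailWeight p (n - k) ∧ ∀ m, n - k ≤ m → m ≤ n → s'.rarr 2 m = tailWeight p m)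
    n ?_ ?_ ?_).mono le_rfl fun s₂ _ h m hm => h.2.2 m (by omega) hm
  · refine ⟨by simpa using h20, ?_, fun m h1 h2 => ?_⟩
    · rw [hf₁.rvar 2 rfl, hr2, tailWeight_of_le (by omega)]
    · obtain rfl : m = n := by omega
      rw [hf₁.rarr 2 rfl, ha2, tailWeight_of_le le_rfl]
  · rintro k hk s' hf ⟨j20, j2, ja⟩
    refine ⟨?_, Runs.block ?_⟩
    · rw [Test.holds, j20, hf.nvar 12 rfl, hf₁.nvar 12 rfl, h12]
      omega
    · have e3 : s'.nvar 3 = 1 := by rw [hf.nvar 3 rfl, hf₁.nvar 3 rfl, h3]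
      have ea : s'.rarr 0 = s.rarr 0 := by rw [hf.rarr 0 rfl, hf₁.rarr 0 rfl]
      have hsub : n - k - 1 = n - (k + 1) := by omega
      have hw : tailWeight p (n - k) + pad p (n - (k + 1)) = tailWeight p (n - (k + 1)) := by
        rw [tailWeight_eq_add (m := n - (k + 1)) (by omega)]
        congr 2
        omega
      refine ⟨by simp [Instr.run, j20, e3, hsub],
        by simp [Instr.run, j20, e3, hsub, j2, ea, ha0, hw], fun m h1 h2 => ?_⟩
      rcases h1.eq_or_lt with rfl | h1
      · simp [Instr.run, j20, e3, hsub, j2, ea, ha0, hw]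
      · have hne : m ≠ n - (k + 1) := by omega
        simp [Instr.run, j20, e3, hsub, hne, ja m (by omega) h2]
  · rintro s' hf ⟨j20, -⟩
    rw [Test.holds, j20, hf.nvar 12 rfl, hf₁.nvar 12 rfl, h12]
    omega

/-- Compute the constants and initialize the table. -/
def setupProg : Prog :=
  .seq (.block [.nconst 3 1, .nadd 5 0 3, .nadd 20 1 3]) (.seq (mulProg 21 20 0)
    (.seq (mulProg 6 21 5) (.seq (mulProg 10 0 5) (.seq powersProg (.seq (mulProg 11 8 5)
      (.seq tailsProg (.instr (.nstore 1 3 3))))))))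

theorem runs_setupProg (hr : 2 ≤ r) (hn : 2 ≤ n) :
    Runs setupProg (input r g p) (40 * (n * (Nat.log r n + 2))) fun s' => Env r n g p s' ∧
      InLevel r n p s' 0 fun _ _ => ∅ := by
  refine Runs.mono (T := 3 + ((3 * n + 3) + ((3 * (n + 1) + 3) + ((3 * (n + 1) + 3) +
    ((2 + (((Nat.log r n + 1) * (3 * n + 8) + 1) + 3)) + ((3 * (n + 1) + 3) +
    ((1 + (n * 5 + 1)) + 1))))))) ?_ ?_ fun _ _ h => h
  swap
  · generalize Nat.log r n = L
    have : 2 * (L + 1) ≤ n * (L + 1) := Nat.mul_le_mul_right _ hn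
    nlinarith
  refine Runs.seq (Q := fun s' => s'.nvar 3 = 1 ∧ s'.nvar 5 = n + 1 ∧ s'.nvar 20 = r + 1)
    (Runs.block ?_) fun s₁ hf₁ ⟨a3, a5, a20⟩ => ?_
  · simp [Instr.run, input]
  have a0 : s₁.nvar 0 = n := hf₁.nvar 0 rfl
  refine Runs.seq ((runs_mulProg a3 (by norm_num) (by norm_num) (by norm_num) (by norm_num)
    (by norm_num) (by norm_num)).mono (by rw [a0]) fun _ _ h => h) fun s₂ hf₂ b21 => ?_
  rw [a20, a0] at b21
  have b3 := (hf₂.nvar 3 rfl).trans a3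
  have b5 := (hf₂.nvar 5 rfl).trans a5
  refine Runs.seq ((runs_mulProg b3 (by norm_num) (by norm_num) (by norm_num) (by norm_num)
    (by norm_num) (by norm_num)).mono (by rw [b5]) fun _ _ h => h) fun s₃ hf₃ c6 => ?_
  rw [b21, b5] at c6
  have c0 : s₃.nvar 0 = n := by rw [hf₃.nvar 0 rfl, hf₂.nvar 0 rfl, a0]
  have c3 := (hf₃.nvar 3 rfl).trans b3
  have c5 := (hf₃.nvar 5 rfl).trans b5
  refine Runs.seq ((runs_mulProg c3 (by norm_num) (by norm_num) (by norm_num) (by norm_num)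
    (by norm_num) (by norm_num)).mono (by rw [c5]) fun _ _ h => h) fun s₄ hf₄ d10 => ?_
  rw [c0, c5] at d10
  have d0 := (hf₄.nvar 0 rfl).trans c0
  have d3 := (hf₄.nvar 3 rfl).trans c3
  have d5 := (hf₄.nvar 5 rfl).trans c5
  have d1 : s₄.nvar 1 = r := by
    rw [hf₄.nvar 1 rfl, hf₃.nvar 1 rfl, hf₂.nvar 1 rfl, hf₁.nvar 1 rfl]
    rfl
  refine Runs.seq (runs_powersProg hr hn d0 d1 d3 (by
    rw [hf₄.nvar 4 rfl, hf₃.nvar 4 rfl, hf₂.nvar 4 rfl, hf₁.nvar 4 rfl]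
    rfl) d5) fun s₅ hf₅ ⟨e4, e7, e8, e9, epow⟩ => ?_
  have e3 := (hf₅.nvar 3 rfl).trans d3
  have e5 := (hf₅.nvar 5 rfl).trans d5
  refine Runs.seq ((runs_mulProg e3 (by norm_num) (by norm_num) (by norm_num) (by norm_num)
    (by norm_num) (by norm_num)).mono (by rw [e5]) fun _ _ h => h) fun s₆ hf₆ f11 => ?_
  rw [e8, e5] at f11
  have f0 : s₆.nvar 0 = n := by rw [hf₆.nvar 0 rfl, hf₅.nvar 0 rfl, d0]
  have f12 : s₆.nvar 12 = 0 := by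
    rw [hf₆.nvar 12 rfl, hf₅.nvar 12 rfl, hf₄.nvar 12 rfl, hf₃.nvar 12 rfl, hf₂.nvar 12 rfl,
      hf₁.nvar 12 rfl]
    rfl
  have fr : s₆.rvar = fun _ => 0 := by
    funext x
    rw [hf₆.rvar x rfl, hf₅.rvar x rfl, hf₄.rvar x rfl, hf₃.rvar x rfl, hf₂.rvar x rfl,
      hf₁.rvar x rfl]
    rfl
  have fa : s₆.rarr = (input r g p).rarr := by
    funext x
    rw [hf₆.rarr x rfl, hf₅.rarr x rfl, hf₄.rarr x rfl, hf₃.rarr x rfl, hf₂.rarr x rfl,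
      hf₁.rarr x rfl]
  have fn : s₆.narr 1 = fun _ => 0 := by
    rw [hf₆.narr 1 rfl, hf₅.narr 1 rfl, hf₄.narr 1 rfl, hf₃.narr 1 rfl, hf₂.narr 1 rfl,
      hf₁.narr 1 rfl]
    rfl
  refine Runs.seq (runs_tailsProg (p := p) f0 ((hf₆.nvar 3 rfl).trans e3) f12 (by rw [fr])
    (fun m => by rw [fa]; rfl) (by rw [fa]; rfl)) fun s₇ hf₇ gw => ?_
  have g3 : s₇.nvar 3 = 1 := by rw [hf₇.nvar 3 rfl, hf₆.nvar 3 rfl, e3]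
  -- Address `1` is the cell `(0, 1)` on level `0`. Its flag is set, and its cost is the `0` that
  -- real array `1` holds initially.
  refine (Runs.instr (Q := fun s' => s'.narr 1 = Function.update (fun _ => 0) 1 1) ?_).mono le_rfl
    fun s₈ hf₈ h1 => ?_
  · simp [Instr.run, g3, hf₇.narr 1 rfl, fn]
  have hr1 : s₈.rarr 1 = fun _ => 0 := by
    rw [hf₈.rarr 1 rfl, hf₇.rarr 1 rfl, fa]
    rfl
  refine ⟨⟨?_, ?_, ?_, ?_, ?_, ?_, ?_, ?_, ?_, ?_, ?_, ?_, ?_, ?_, ?_, ?_⟩, ?_⟩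
  · rw [hf₈.nvar 0 rfl, hf₇.nvar 0 rfl, f0]
  · rw [hf₈.nvar 1 rfl, hf₇.nvar 1 rfl, hf₆.nvar 1 rfl, hf₅.nvar 1 rfl, d1]
  · rw [hf₈.nvar 2 rfl, hf₇.nvar 2 rfl, hf₆.nvar 2 rfl, hf₅.nvar 2 rfl, hf₄.nvar 2 rfl,
      hf₃.nvar 2 rfl, hf₂.nvar 2 rfl, hf₁.nvar 2 rfl]
    rfl
  · rw [hf₈.nvar 3 rfl, g3]
  · rw [hf₈.nvar 4 rfl, hf₇.nvar 4 rfl, hf₆.nvar 4 rfl, e4]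
  · rw [hf₈.nvar 5 rfl, hf₇.nvar 5 rfl, hf₆.nvar 5 rfl, e5]
  · rw [hf₈.nvar 6 rfl, hf₇.nvar 6 rfl, hf₆.nvar 6 rfl, hf₅.nvar 6 rfl, hf₄.nvar 6 rfl, c6,
      mul_comm n]
  · rw [hf₈.nvar 7 rfl, hf₇.nvar 7 rfl, hf₆.nvar 7 rfl, e7]
  · rw [hf₈.nvar 8 rfl, hf₇.nvar 8 rfl, hf₆.nvar 8 rfl, e8]
  · rw [hf₈.nvar 9 rfl, hf₇.nvar 9 rfl, hf₆.nvar 9 rfl, e9]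
  · rw [hf₈.nvar 10 rfl, hf₇.nvar 10 rfl, hf₆.nvar 10 rfl, hf₅.nvar 10 rfl, d10]
  · rw [hf₈.nvar 11 rfl, hf₇.nvar 11 rfl, f11]
  · rw [hf₈.nvar 12 rfl, hf₇.nvar 12 rfl, f12]
  · rw [hf₈.rvar 1 rfl, hf₇.rvar 1 rfl, fr]
  · rw [hf₈.narr 5 rfl, hf₇.narr 5 rfl, hf₆.narr 5 rfl]
    exact epow
  · rw [hf₈.rarr 2 rfl]
    exact gw
  · have h1' : ∀ a, a ≠ 1 → s₈.narr 1 a = 0 := fun a ha => by rw [h1, Function.update_of_ne ha]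
    have hL : 1 < address r n 1 0 0 := by
      rw [address_succ]
      have : 2 * 1 ≤ n * (r + 1) := Nat.mul_le_mul hn (by omega)
      have : n * (r + 1) * 1 ≤ n * (r + 1) * (n + 1) := Nat.mul_le_mul_left _ (by omega)
      omega
    refine ⟨fun i hi m hm b hb => ?_, fun m hm b hb => ?_, fun a ha => ?_⟩
    · obtain rfl : i = 0 := by omega
      have ha : address r n 0 m b = m * (n + 1) + b := by simp [address]
      by_cases hmb : m = 0 ∧ b = 1
      · obtain ⟨rfl, rfl⟩ := hmb
        have ha1 : address r n 0 0 1 = 1 := by simp [address]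
        rw [ha1]
        refine ⟨fun h => by simp [h1] at h, fun _ => ⟨0, ⟨rfl, rfl, rfl⟩, rfl, ?_, ?_⟩⟩
        · rw [hr1, costVec_zero]
        · rintro δ ⟨-, -, rfl⟩
          exact le_rfl
      · have hne : address r n 0 m b ≠ 1 := by
          rw [ha]
          rcases Nat.eq_zero_or_pos m with rfl | hm0
          · omega
          · have : 1 * (n + 1) ≤ m * (n + 1) := Nat.mul_le_mul_right _ hm0
            omega
        refine ⟨fun _ => ?_, fun h => absurd (h1' _ hne) h⟩
        refine Set.eq_empty_iff_forall_notMem.2 ?_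
        rintro δ ⟨rfl, rfl, -⟩
        exact hmb ⟨rfl, rfl⟩
    · refine ⟨fun _ => rfl, fun h => absurd (h1' _ ?_) h⟩
      rw [address_eq r n (0 + 1) m b]
      simp only [zero_add]
      omega
    · have := address_mono r n (by omega : 1 ≤ 2)
      simp only [zero_add] at ha this
      exact h1' a (by omega)

/-! ### Tracing an optimal solution -/

/-- Follow the pointers from the cell whose address is in variable `22`, and add up the lengths of
the codewords in natural array `0`. -/
def traceProg : Prog :=
  .seq (.block [.nmove 33 22, .nconst 34 0, .nadd 35 2 3])
    (.loop (.nlt 34 35) (.seq (.block [.nload 36 2 33, .nload 37 3 33, .nload 33 4 33])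
      (.seq (.loop (.nlt 36 0)
        (.block [.nload 38 0 36, .nadd 38 38 37, .nstore 0 36 38, .nadd 36 36 3]))
        (.instr (.nadd 34 34 3)))))

/-- Each pointer step contributes one vector `ind t M`, which is added to the entries from `M` to `n
- 1`. The lengths written so far plus the vector still to be traced always equal `δ`. -/
theorem runs_traceProg {δ : ℕ → ℝ} (hE : Env r n g p s) (h0 : ∀ q < n, s.narr 0 q = 0)
    (hT : Traced r n s (g + 1) (s.nvar 22) δ) :
    Runs traceProg s (3 + ((g + 1) * (5 * n + 6) + 1)) fun s' =>
      ∀ q < n, (s'.narr 0 q : ℝ) = δ q := by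
  refine Runs.seq (Q := fun s' => s'.nvar 33 = s.nvar 22 ∧ s'.nvar 34 = 0 ∧ s'.nvar 35 = g + 1)
    (Runs.block ?_) fun s₁ hf₁ ⟨h33, h34, h35⟩ => ?_
  · simp [Instr.run, hE.v2, hE.v3]
  have hE₁ : Env r n g p s₁ := hE.of_frame hf₁ ⟨fun x hx => by interval_cases x <;> rfl,
      rfl, rfl, rfl⟩
  refine (Runs.loop (T := 5 * n + 5) (fun k s' => s'.nvar 34 = k ∧
    ∃ δ', Traced r n s (g + 1 - k) (s'.nvar 33) δ' ∧ ∀ q < n, (s'.narr 0 q : ℝ) + δ' q = δ q)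
    (g + 1) ?_ ?_ ?_).mono le_rfl ?_
  · refine ⟨h34, δ, by rwa [h33], fun q hq => ?_⟩
    rw [hf₁.narr 0 rfl, h0 q hq]
    simp
  · rintro k hk s' hf ⟨j34, δ', hδ', hsum⟩
    have hE' : Env r n g p s' := hE₁.of_frame hf ⟨fun x hx => by interval_cases x <;> rfl,
      rfl, rfl, rfl⟩
    obtain ⟨l, hl⟩ : ∃ l, g + 1 - k = l + 1 := ⟨g - k, by omega⟩
    rw [hl] at hδ'
    obtain ⟨-, ε, hε, rfl⟩ := hδ'
    have e2 : s'.narr 2 = s.narr 2 := by rw [hf.narr 2 rfl, hf₁.narr 2 rfl]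
    have e3 : s'.narr 3 = s.narr 3 := by rw [hf.narr 3 rfl, hf₁.narr 3 rfl]
    have e4 : s'.narr 4 = s.narr 4 := by rw [hf.narr 4 rfl, hf₁.narr 4 rfl]
    refine ⟨?_, ?_⟩
    · rw [Test.holds, j34, hf.nvar 35 rfl, h35]
      exact hk
    set M := s.narr 2 (s'.nvar 33) with hM
    set t := s.narr 3 (s'.nvar 33) with ht
    refine Runs.mono (T := 3 + (((n - M) * (4 + 1) + 1) + 1)) ?_ (by omega) fun _ _ h => h
    refine Runs.seq (Q := fun s₂ => s₂.nvar 36 = M ∧ s₂.nvar 37 = t ∧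
      s₂.nvar 33 = s.narr 4 (s'.nvar 33)) (Runs.block ?_) fun s₂ hf₂ ⟨k36, k37, k33⟩ => ?_
    · simp [Instr.run, e2, e3, e4, hM, ht]
    refine Runs.seq (Runs.loop (fun i s₃ => s₃.nvar 36 = M + i ∧ ∀ q, s₃.narr 0 q =
      s'.narr 0 q + if M ≤ q ∧ q < M + i then t else 0) (n - M) ?_ ?_ ?_)
      fun s₃ hf₃ ⟨l36, lq⟩ => ?_
    · refine ⟨k36, fun q => ?_⟩
      rw [hf₂.narr 0 rfl, if_neg (by omega), add_zero]
    · rintro i hi s₃ hf₃ ⟨l36, lq⟩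
      refine ⟨?_, Runs.block ⟨?_, fun q => ?_⟩⟩
      · rw [Test.holds, l36, hf₃.nvar 0 rfl, hf₂.nvar 0 rfl, hE'.v0]
        omega
      · simp [Instr.run, l36, hf₃.nvar 3 rfl, hf₂.nvar 3 rfl, hE'.v3, add_assoc]
      · rcases eq_or_ne q (M + i) with rfl | hq
        · simp [Instr.run, l36, lq, hf₃.nvar 37 rfl, k37]
        · have : (M ≤ q ∧ q < M + i) ↔ (M ≤ q ∧ q < M + (i + 1)) := by omega
          simp [Instr.run, l36, hq, lq, this]
    · rintro s₃ hf₃ ⟨l36, -⟩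
      rw [Test.holds, l36, hf₃.nvar 0 rfl, hf₂.nvar 0 rfl, hE'.v0]
      omega
    · refine (Runs.instr (Q := fun s₄ => s₄.nvar 34 = k + 1) ?_).mono le_rfl fun s₄ hf₄ m34 =>
        ⟨m34, ε, ?_, fun q hq => ?_⟩
      · simp [Instr.run, hf₃.nvar 34 rfl, hf₂.nvar 34 rfl, j34, hf₃.nvar 3 rfl, hf₂.nvar 3 rfl,
          hE'.v3]
      · rw [hf₄.nvar 33 rfl, hf₃.nvar 33 rfl, k33, show g + 1 - (k + 1) = l by omega]
        exact hε
      · rw [← hsum q hq, hf₄.narr 0 rfl, lq q, Pi.add_apply, ind]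
        have : (M ≤ q ∧ q < M + (n - M)) ↔ M ≤ q := by omega
        simp only [this]
        split_ifs
        · push_cast
          ring
        · push_cast
          ring
  · rintro s' hf ⟨j34, -⟩
    rw [Test.holds, j34, hf.nvar 35 rfl, h35]
    omega
  · rintro s' - ⟨-, δ', hδ', hsum⟩ q hq
    rw [Nat.sub_self] at hδ'
    obtain rfl : δ' = 0 := hδ'
    simpa using hsum q hq

/-! ### The algorithm -/

/-- Compute the table, then the cost and the codeword lengths of an optimal code. -/
def mainProg : Prog :=
  .seq setupProg (.seq (.block [.nconst 20 0, .nconst 21 0, .nmove 22 6])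
    (.seq (.loop (.nlt 20 2) (.seq levelStep
      (.block [.nadd 20 20 3, .nmove 21 22, .nadd 22 22 6])))
      (.seq (finals 12 12 12) (.seq (.instr (.rload 0 1 22)) traceProg))))

/-- After level `g`, the cell `(0, 0)` on level `g + 1` collects the minimum over all final
signatures through edges of length `0`. This is why the trace starts there and takes `g + 1` steps.
-/
theorem runs_mainProg (hr : 2 ≤ r) (hn : 2 ≤ n) (hg : 1 ≤ g) (ha : Antitone p)
    (hp : ∀ t, 0 ≤ p t) :
    Runs mainProg (input r g p) (400 * (g * (n ^ 2 * (Nat.log r n + 2)))) fun s =>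
      (∀ i ≤ g, ∀ m < n * (r + 1), ∀ b ≤ n,
        BestIn p (s.narr 1 (address r n i m b)) (s.rarr 1 (address r n i m b)) (fun _ => True)
          (reach r n i m b)) ∧
      ∃ m, ∃ δ ∈ reach r n g m 0,
        (∀ m' δ', (reservedChoices r n).Path ((reservedChoices r n).Valid n) g (m', 0) δ' →
          costVec p δ ≤ costVec p δ') ∧
        (∀ q < n, (s.narr 0 q : ℝ) = δ q) ∧ s.rvar 0 = costVec p δ := by
  refine Runs.mono (T := 40 * (n * (Nat.log r n + 2)) + (3 +
    ((g * ((200 * (n ^ 2 * (Nat.log r n + 2)) + 3) + 1) + 1) + ((40 * n + 8) + (1 +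
    (3 + ((g + 1) * (5 * n + 6) + 1))))))) ?_ ?_ fun _ _ h => h
  swap
  · generalize Nat.log r n = L
    have h1 : n * (L + 2) * 2 ≤ n * (L + 2) * n := Nat.mul_le_mul_left _ hn
    have h2 : n * 2 ≤ n * (L + 2) := Nat.mul_le_mul_left _ (by omega)
    have h3 : n ^ 2 * (L + 2) = n * (L + 2) * n := by ring
    rw [h3]
    have h4 : 1 * (n * (L + 2) * n) ≤ g * (n * (L + 2) * n) := Nat.mul_le_mul_right _ hg
    have h5 : 1 * n ≤ g * n := Nat.mul_le_mul_right _ hg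
    have h6 : g * (n * (L + 2) * 2) ≤ g * (n * (L + 2) * n) := Nat.mul_le_mul_left _ h1
    have h7 : g * (n * 2) ≤ g * (n * (L + 2)) := Nat.mul_le_mul_left _ h2
    have h8 : g * 2 ≤ g * n := Nat.mul_le_mul_left _ hn
    have h9 : g * (n * (L + 2) * 2) = 2 * (g * (n * (L + 2))) := by ring
    have h10 : g * (n * 2) = 2 * (g * n) := by ring
    have h11 : g * (200 * (n * (L + 2) * n) + 3 + 1) = 200 * (g * (n * (L + 2) * n)) + 4 * g := by
      ring
    have h12 : (g + 1) * (5 * n + 6) = 5 * (g * n) + 6 * g + 5 * n + 6 := by ring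
    omega
  refine Runs.seq (runs_setupProg hr hn) fun s₁ hf₁ ⟨hE₁, hI₁⟩ => ?_
  refine Runs.seq (Q := fun s' => s'.nvar 20 = 0 ∧ s'.nvar 21 = address r n 0 0 0 ∧
    s'.nvar 22 = address r n 1 0 0) (Runs.block ?_) fun s₂ hf₂ ⟨a20, a21, a22⟩ => ?_
  · simp [Instr.run, hE₁.v6, address]
  have hE₂ : Env r n g p s₂ := hE₁.of_frame hf₂ ⟨fun x hx => by interval_cases x <;> rfl,
      rfl, rfl, rfl⟩
  have hI₂ := hI₁.of_frame hf₂ (by simp [Prog.block, Prog.anyInstr, Instr.writesNArr]) rfl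
  have hK : (Prog.loop (.nlt 20 2) (.seq levelStep
      (.block [.nadd 20 20 3, .nmove 21 22, .nadd 22 22 6]))).KeepsEnv :=
    (keepsEnv_levelStep.seq ⟨fun x hx => by interval_cases x <;> rfl, rfl, rfl, rfl⟩).loop
  refine Runs.seq (Runs.loop (fun k s' => InLevel r n p s' k (fun _ _ => ∅) ∧ s'.nvar 20 = k ∧
    s'.nvar 21 = address r n k 0 0 ∧ s'.nvar 22 = address r n (k + 1) 0 0) g
    ⟨hI₂, a20, a21, a22⟩ ?_ ?_) fun s₃ hf₃ ⟨hI₃, _, b21, b22⟩ => ?_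
  · rintro k hk s' hf ⟨hI', j20, j21, j22⟩
    have hE' : Env r n g p s' := hE₂.of_frame hf hK
    refine ⟨?_, ?_⟩
    · rw [Test.holds, j20, hE'.v2]
      exact hk
    refine Runs.seq (runs_levelStep hr hn hE' hI' j21 j22) fun s'' hf'' hI'' => ?_
    have hE'' := hE'.of_frame hf'' keepsEnv_levelStep
    refine (Runs.block (Q := fun s' => s'.nvar 20 = k + 1 ∧ s'.nvar 21 = address r n (k + 1) 0 0 ∧
      s'.nvar 22 = address r n (k + 1 + 1) 0 0) ?_).mono le_rfl fun s₄ hf₄ h =>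
      ⟨hI''.of_frame hf₄ (by simp [Prog.block, Prog.anyInstr, Instr.writesNArr]) rfl, h⟩
    rw [address_succ r n (k + 1)]
    simp [Instr.run, hf''.nvar 20 rfl, hf''.nvar 22 rfl, j20, j22, hE''.v3, hE''.v6]
  · rintro s' hf ⟨-, j20, -⟩
    have hE' : Env r n g p s' := hE₂.of_frame hf hK
    rw [Test.holds, j20, hE'.v2]
    omega
  have hE₃ : Env r n g p s₃ := hE₂.of_frame hf₃ hK
  refine Runs.seq (runs_finals (e := 0) (by norm_num) (by norm_num) (by norm_num) hr hn hE₃ hI₃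
    b21 b22 (by rw [hE₃.v12]; ring) (by rw [hE₃.v12]; ring) (by rw [hE₃.v12]; ring) (by norm_num))
    fun s₄ hf₄ hI₄ => ?_
  have hE₄ := hE₃.of_frame hf₄ (keepsEnv_finals _ _ _)
  have c22 : s₄.nvar 22 = address r n (g + 1) 0 0 := (hf₄.nvar 22 rfl).trans b22
  have hcell := hI₄.cur 0 (by
    have : 2 * 1 ≤ n * (r + 1) := Nat.mul_le_mul hn (by omega)
    omega) 0 (Nat.zero_le n)
  have hreach : ∀ m' δ', (reservedChoices r n).Path ((reservedChoices r n).Valid n) g (m', 0) δ' →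
      ∃ δ'' ∈ reach r n g m' 0, Final r n m' ∧ costVec p δ'' = costVec p δ' := by
    intro m' δ' h
    obtain ⟨δ'', h1, h2⟩ := exists_mem_reach hr hn h
    refine ⟨δ'', h1, (valid_zero_iff_final hr hn).1 h.val, ?_⟩
    exact Finset.sum_congr rfl fun q _ => by rw [h2 q q.2]
  -- Some feasible code exists, hence a path to a final signature, so the collecting cell cannot be
  -- empty.
  have hne : s₄.narr 1 (address r n (g + 1) 0 0) ≠ 0 := by
    intro h0
    have hempty := hcell.1 h0
    obtain ⟨m', δ', h, -⟩ := exists_best_path hr hn hg ha hp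
    obtain ⟨δ'', h1, h2, -⟩ := hreach m' δ' h
    have : δ'' ∈ (∅ : Set (ℕ → ℝ)) := by
      rw [← hempty]
      exact Or.inr ⟨rfl, m', h2, by simp, h1⟩
    exact this
  obtain ⟨δ, hδ, hT, hval, hmin⟩ := hcell.2 hne
  obtain ⟨m, hmF, -, hδm⟩ : ∃ z, Final r n z ∧ 0 = 0 * z ∧ δ ∈ reach r n g z 0 := by
    rcases hδ with hδ | hδ
    · exact hδ.elim
    · exact hδ.2
  refine Runs.seq (Q := fun s' => s'.rvar 0 = costVec p δ)
    (Runs.instr (by simp [Instr.run, c22, hval])) fun s₅ hf₅ d0 => ?_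
  have hE₅ : Env r n g p s₅ := hE₄.of_frame hf₅ ⟨fun x hx => by interval_cases x <;> rfl,
      rfl, rfl, rfl⟩
  have hI₅ := hI₄.of_frame hf₅ (by simp [Prog.anyInstr, Instr.writesNArr]) rfl
  have hz : s₅.narr 0 = fun _ => 0 := by
    rw [hf₅.narr 0 rfl, hf₄.narr 0 rfl, hf₃.narr 0 rfl, hf₂.narr 0 rfl, hf₁.narr 0 rfl]
    rfl
  refine (runs_traceProg hE₅ (δ := δ) (fun q _ => by rw [hz]) ?_).mono le_rfl fun s₆ hf₆ hq =>
    ⟨fun i hi m hm b hb => ?_, m, δ, hδm, fun m' δ' h => ?_, hq, (hf₆.rvar 0 rfl).trans d0⟩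
  · rw [hf₅.nvar 22 rfl, c22]
    exact hT.congr (B := address r n (g + 1) 0 0 + 1) (by omega)
      (fun j hj => (address_mono r n (by omega : j + 1 ≤ g + 1)).trans (Nat.le_succ _))
      (fun x _ => by rw [hf₅.narr 2 rfl]) (fun x _ => by rw [hf₅.narr 3 rfl])
      (fun x _ => by rw [hf₅.narr 4 rfl])
  · rw [hf₆.narr 1 rfl, hf₆.rarr 1 rfl]
    exact BestIn.mono (hI₅.lower i hi m hm b hb) fun _ _ => trivial
  · obtain ⟨δ'', h1, h2, h3⟩ := hreach m' δ' h
    rw [← h3]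
    exact hmin δ'' (Or.inr ⟨rfl, m', h2, by simp, h1⟩)

/-- The logarithm is largest for `r = 2`, and then the left side is at most `3 * Real.log n /
Real.log 2`, with `3 / Real.log 2 < 5`. -/
theorem log_bound (hr : 2 ≤ r) (hn : 2 ≤ n) : ((Nat.log r n + 2 : ℕ) : ℝ) ≤ 5 * Real.log n := by
  have h1 : Nat.log r n ≤ Nat.log 2 n := Nat.log_anti_left (by norm_num) hr
  have h2 : (2 : ℝ) ^ Nat.log 2 n ≤ n := by exact_mod_cast Nat.pow_log_le_self 2 (by omega)
  have h3 : (Nat.log 2 n : ℝ) * Real.log 2 ≤ Real.log n := by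
    rw [← Real.log_pow]
    exact Real.log_le_log (by positivity) h2
  have h4 : Real.log 2 ≤ Real.log n := Real.log_le_log (by norm_num) (by exact_mod_cast hn)
  have h5 := Real.log_two_gt_d9
  have h6 : (Nat.log r n : ℝ) ≤ Nat.log 2 n := by exact_mod_cast h1
  have h7 : (0 : ℝ) ≤ Nat.log 2 n := Nat.cast_nonneg _
  push_cast
  nlinarith

/-- Paths and `reach` give the same costs, which turns table cells into values of `OPT`. The traced
vector is that of a path, so a code with exactly these lengths exists and is optimal. -/
theorem runningTime (hr : 2 ≤ r) (hn : 2 ≤ n) (hg : 1 ≤ g) (ha : Antitone p)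
    (hp : ∀ t, 0 ≤ p t) :
    ∃ (s : Store) (t : ℕ), Exec mainProg (input r g p) s t ∧
      (t : ℝ) ≤ 2000 * ((g : ℝ) * (n : ℝ) ^ 2 * Real.log n) ∧
      (∀ i m b, i ≤ g → (reservedChoices r n).Valid n i (m, b) →
        tableEntry r n s i m b = (reservedChoices r n).OPT p i m b) ∧
      (∃ w : Fin n → List (Fin r), PrefixFree w ∧ AtMostLengths g w ∧
        IsLeast (codeCosts r g p) (codeCost p w) ∧
        (∀ q : Fin n, s.narr 0 q = (w q).length) ∧ s.rvar 0 = codeCost p w) := by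
  have hS := proper_reservedChoices (n := n) hr
  obtain ⟨s, t, hex, ht, htab, m, δ, hδ, hmin, hlen, hcost⟩ := runs_mainProg hr hn hg ha hp
  refine ⟨s, t, hex, ?_, fun i m b hi hV => ?_, ?_⟩
  -- The constant is `2000 = 400 * 5`, from the step count and `log_bound`.
  · have h1 : (t : ℝ) ≤ 400 * ((g : ℝ) * ((n : ℝ) ^ 2 * ((Nat.log r n + 2 : ℕ) : ℝ))) := by
      exact_mod_cast ht
    have h2 := mul_le_mul_of_nonneg_left (log_bound hr hn)
      (by positivity : (0 : ℝ) ≤ 400 * ((g : ℝ) * (n : ℝ) ^ 2))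
    refine h1.trans (le_trans (le_of_eq ?_) (h2.trans (le_of_eq ?_))) <;> ring
  · have hlt := ((validSig_iff hr hn).1 hV).lt hr hn
    obtain ⟨h0, h1⟩ := htab i hi m hlt.1 b hlt.2
    rw [tableEntry]
    split_ifs with hflag
    · symm
      refine LevelChoices.OPT_eq_top p hS fun δ' hδ' => ?_
      obtain ⟨δ'', h2, -⟩ := exists_mem_reach hr hn hδ'
      rw [h0 hflag] at h2
      exact h2
    · obtain ⟨ε, h2, -, h3, h4⟩ := h1 hflag
      rw [h3]
      refine le_antisymm (LevelChoices.le_OPT p hS fun δ' hδ' => ?_)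
        (LevelChoices.OPT_le p hS (path_of_mem_reach hr hn h2))
      obtain ⟨δ'', h5, h6⟩ := exists_mem_reach hr hn hδ'
      refine EReal.coe_le_coe_iff.2 ((h4 δ'' h5).trans (le_of_eq ?_))
      exact Finset.sum_congr rfl fun q _ => by rw [h6 q q.2]
  · have hpath := path_of_mem_reach hr hn hδ
    obtain ⟨w, h1, h2, h3⟩ := exists_code_of_path hr hn hpath (le_of_path_zero hpath)
    have hc : codeCost p w = costVec p δ := Finset.sum_congr rfl fun q _ => by rw [h3]
    refine ⟨w, h1, h2, ?_, fun q => ?_, hcost.trans hc.symm⟩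
    · rw [hc]
      exact isLeast_codeCosts hr hn ha hp hpath hmin
    · have := (hlen q q.2).trans (h3 q).symm
      exact_mod_cast this

end

end ReservedLength

end

theorem mainTheorem4 :
    -- the dynamic program for trees with choices of arity and edge length on each level
    (∀ (n : ℕ) (_ : 2 ≤ n) (p : Fin n → ℝ) (_ : Antitone p) (_ : ∀ t, 0 ≤ p t)
        (S : ReservedLength.LevelChoices) (_ : S.Proper),
      -- the minima are attained
      (∀ i m b, S.OPT p i m b ≠ ⊤ → ∃ x ∈ S.partialCosts p i m b, S.OPT p i m b = (x : EReal)) ∧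
      -- validity of the truncations is a restriction for `b = 0` only
      (∀ i m b, 0 < b → m + b ≤ n → S.partialCosts p i m b = S.allPartialCosts p i m b) ∧
      -- initial conditions
      S.OPT p 0 0 1 = 0 ∧
      (∀ m b, (m, b) ≠ (0, 1) → S.OPT p 0 m b = ⊤) ∧
      -- the recurrence
      (∀ i, 1 ≤ i → ∀ m b, S.Valid n i (m, b) →
        S.OPT p i m b = ⨅ j ∈ Finset.Icc 1 (S.Δ i), S.OPTj p i j m b) ∧
      -- the batched recurrence for the entries with `m + b = d`
      (∀ i, 1 ≤ i → ∀ j, 1 ≤ j → j ≤ S.Δ i → ∀ d, d ≤ n → ∀ b, 1 ≤ b → b ≤ d →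
        (S.arity i j * (d / S.arity i j) < b → S.OPTj p i j (d - b) b = ⊤) ∧
        (b = S.arity i j * (d / S.arity i j) →
          S.OPTj p i j (d - b) b = S.gam p i j d (d / S.arity i j)) ∧
        (b < S.arity i j * (d / S.arity i j) → ¬ S.arity i j ∣ b →
          S.OPTj p i j (d - b) b = S.OPTj p i j (d - b - 1) (b + 1)) ∧
        (b < S.arity i j * (d / S.arity i j) → S.arity i j ∣ b →
          S.OPTj p i j (d - b) b =
            min (S.OPTj p i j (d - b - 1) (b + 1)) (S.gam p i j d (b / S.arity i j))))) ∧
    -- the reduction of the `g`-lengths problem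
    (∀ (r n g : ℕ) (_ : 2 ≤ r) (_ : 2 ≤ n) (_ : 1 ≤ g)
        (p : Fin n → ℝ) (_ : Antitone p) (_ : ∀ t, 0 ≤ p t),
      (ReservedLength.reservedChoices r n).treeCosts g p ⊆ ReservedLength.codeCosts r g p ∧
      (∀ x ∈ ReservedLength.codeCosts r g p,
        ∃ y ∈ (ReservedLength.reservedChoices r n).treeCosts g p, y ≤ x) ∧
      ∃ x : ℝ, IsLeast (ReservedLength.codeCosts r g p) x ∧
        IsLeast ((ReservedLength.reservedChoices r n).treeCosts g p) x ∧
        (⨅ (m : ℕ) (_ : (ReservedLength.reservedChoices r n).Valid n g (m, 0)),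
          (ReservedLength.reservedChoices r n).OPT p g m 0) = (x : EReal)) ∧
    -- the running time
    (∃ (P : ReservedLength.Prog) (K : ℝ),
      ∀ (r n g : ℕ) (_ : 2 ≤ r) (_ : 2 ≤ n) (_ : 1 ≤ g)
        (p : Fin n → ℝ) (_ : Antitone p) (_ : ∀ t, 0 ≤ p t),
      ∃ (s : ReservedLength.Store) (t : ℕ),
        ReservedLength.Exec P (ReservedLength.input r g p) s t ∧
        (t : ℝ) ≤ K * ((g : ℝ) * (n : ℝ) ^ 2 * Real.log n) ∧
        -- the whole table is computed
        (∀ i m b, i ≤ g → (ReservedLength.reservedChoices r n).Valid n i (m, b) →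
          ReservedLength.tableEntry r n s i m b =
            (ReservedLength.reservedChoices r n).OPT p i m b) ∧
        -- the codeword lengths and the cost of an optimal code are computed
        (∃ w : Fin n → List (Fin r),
          ReservedLength.PrefixFree w ∧ ReservedLength.AtMostLengths g w ∧
          IsLeast (ReservedLength.codeCosts r g p) (ReservedLength.codeCost p w) ∧
          (∀ q : Fin n, s.narr 0 q = (w q).length) ∧
          s.rvar 0 = ReservedLength.codeCost p w)) := by
  refine ⟨fun n hn p _ _ S hS => ReservedLength.LevelChoices.dynamicProgram hn p hS,
    fun r n g hr hn hg p ha hp => ReservedLength.reduction hr hn hg ha hp,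
    ReservedLength.mainProg, 2000, fun r n g hr hn hg p ha hp => ?_⟩
  exact ReservedLength.runningTime hr hn hg ha hp
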